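/- Let $d\ge 2$, $\nu,\lambda_1,\lambda_2,N>0$ and $\mathfrak C\in\mathbb R$. For $k\in\mathbb R^d$ put $\omega_k=\sqrt{\lambda_1+\lambda_2|k|^2}$, and let $L^1_N=L^1_N(\mathbb R^d)$ be the space of functions with $\|f\|_{L^1_N}=\int_{\mathbb R^d}|f(k)|\,\omega_k^N\,dk<\infty$. Consider $$\partial_t f(t,k)+2\nu|k|^2f(t,k)=Q[f](t,k),\qquad f(0,k)=f_0(k),\tag{1}$$ $$Q[f](k)=\iint_{\mathbb R^{2d}}\big[R_{k,k_1,k_2}[f]-R_{k_1,k,k_2}[f]-R_{k_2,k,k_1}[f]\big]\,dk_1dk_2,$$ $$R_{k,k_1,k_2}[f]=|V_{k,k_1,k_2}|^2\,\delta(k-k_1-k_2)\,\frac{\Gamma_{k,k_1,k_2}}{(\omega_k-\omega_{k_1}-\omega_{k_2})^2+\Gamma_{k,k_1,k_2}^2}\,(f_1f_2-ff_1-ff_2),$$ where $f=f(k)$, $f_j=f(k_j)$, $V_{k,k_1,k_2}=\mathfrak C(|k||k_1||k_2|)^{1/2}$ and $\Gamma_{k,k_1,k_2}=(|k|^2+|k_1|^2+|k_2|^2)\int_{\mathbb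 R^d}f(p)\,dp$. Given $R_*,R^*,C_0,R_0,T>0$ and $f_0$ with $\|f_0\chi_{R_0}\|_{L^1}>0$, where $\chi_{R_0}$ is the characteristic function of the ball $B(0,R_0)\subset\mathbb R^d$, put $$C_*=\frac{C_0\big(1+e^{(4\nu R_0^2+8R_0)T}\big)}{\|f_0\chi_{R_0}\|_{L^1}},\qquad C^*=4\nu R_0^2+8R_0,$$ and for $t\ge0$ let $\mathcal S_t$ be the set of $f\in L^1_{N+3}$ with $f\ge0$, $\|f\|_{L^1_{N+3}}\le(2R_*+1)e^{C_*t}$ and $\|f\|_{L^1}\ge\tfrac12R^*e^{-C^*t}$. (The set $\mathcal S_0$ does not depend on $C_0,R_0,T$.) **Theorem.** Let $R_*>R^*>0$, and let $f_0\in\mathcal S_0$ satisfy $R^*<\|f_0\|_{L^1_{N+3}}<R_*$. Then: 1. For every $T>0$, equation (1) has a unique strong solution $f$ on $[0,T)$ with $0\le f\in C([0,T);L^1_N)\cap C^1((0,T);L^1_N)$; here (1) holds for every $t\in(0,T)$ and almost every $k$, with $\partial_tf$ the derivative in $L^1_N$. The integrals defining $Q[f(t)](k)$ converge absolutely for every $t\in[0,T)$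 and almost every $k$. 2. For every $C_0>0$ and every sufficiently large $R_0$ (how large may depend on $f_0$, $C_0$, $R_*$, $R^*$ and the parameters of the equation and of the spaces, but not on $T$), one has $\|f_0\chi_{R_0}\|_{L^1}>0$, and for every $T>0$ the solution satisfies $f(t)\in\mathcal S_T$ for all $t\in[0,T)$. 3. Consequently the solutions for different $T$ are restrictions of one unique global solution defined for all $t\ge0$. -/

import Mathlib

open MeasureTheory Set

noncomputable section

/-- The dispersion law `ω_k = √(λ₁ + λ₂ |k|²)`. -/
def omega {d : ℕ} (lam1 lam2 : ℝ) (k : EuclideanSpace ℝ (Fin d)) : ℝ :=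
  Real.sqrt (lam1 + lam2 * ‖k‖ ^ 2)

/-- The measure `ω_k^N dk`. -/
def weightedMeasure (d : ℕ) (lam1 lam2 N : ℝ) : Measure (EuclideanSpace ℝ (Fin d)) :=
  volume.withDensity fun k => ENNReal.ofReal (omega lam1 lam2 k ^ N)

/-- The Banach space `L¹_N(ℝ^d) = L¹(ℝ^d, ω_k^N dk)`. -/
abbrev WeightedL1 (d : ℕ) (lam1 lam2 N : ℝ) : Type :=
  Lp ℝ 1 (weightedMeasure d lam1 lam2 N)

/-- `‖f‖_{L¹_N} = ∫ |f(k)| ω_k^N dk`. -/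
def weightedNorm {d : ℕ} (lam1 lam2 N : ℝ) (f : EuclideanSpace ℝ (Fin d) → ℝ) : ℝ :=
  ∫ k, |f k| * omega lam1 lam2 k ^ N

/-- The collision kernel `V_{k,k₁,k₂} = c (|k| |k₁| |k₂|)^{1/2}`. -/
def kernelV {d : ℕ} (c : ℝ) (k k1 k2 : EuclideanSpace ℝ (Fin d)) : ℝ :=
  c * Real.sqrt (‖k‖ * ‖k1‖ * ‖k2‖)

/-- `γ_k = |k|² ∫ f`. -/
def dampingGamma {d : ℕ} (f : EuclideanSpace ℝ (Fin d) → ℝ)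
    (k : EuclideanSpace ℝ (Fin d)) : ℝ :=
  ‖k‖ ^ 2 * ∫ p, f p

/-- The resonance broadening frequency `Γ_{k,k₁,k₂} = γ_k + γ_{k₁} + γ_{k₂}`. -/
def broadening {d : ℕ} (f : EuclideanSpace ℝ (Fin d) → ℝ)
    (k k1 k2 : EuclideanSpace ℝ (Fin d)) : ℝ :=
  dampingGamma f k + dampingGamma f k1 + dampingGamma f k2

/-- The Lorentzian `Γ / (ζ² + Γ²)`. -/
def lorentzian (G z : ℝ) : ℝ := G / (z ^ 2 + G ^ 2)

/-- The density of `R_{k,k₁,k₂}[f]` with respect to the Dirac mass `δ(k - k₁ - k₂)`: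
`|V|² L_f(ω_k - ω_{k₁} - ω_{k₂}) (f₁ f₂ - f f₁ - f f₂)`. -/
def triad {d : ℕ} (c lam1 lam2 : ℝ) (f : EuclideanSpace ℝ (Fin d) → ℝ)
    (k k1 k2 : EuclideanSpace ℝ (Fin d)) : ℝ :=
  |kernelV c k k1 k2| ^ 2
    * lorentzian (broadening f k k1 k2)
        (omega lam1 lam2 k - omega lam1 lam2 k1 - omega lam1 lam2 k2)
    * (f k1 * f k2 - f k * f k1 - f k * f k2)

/-- The collision operator
`Q[f](k) = ∬ (R_{k,k₁,k₂} - R_{k₁,k,k₂} - R_{k₂,k,k₁}) dk₁ dk₂`.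
The Dirac masses `δ(k - k₁ - k₂)`, `δ(k₁ - k - k₂)`, `δ(k₂ - k - k₁)` are integrated out
in `k₂`, `k₁`, `k₂` respectively. -/
def collision {d : ℕ} (c lam1 lam2 : ℝ) (f : EuclideanSpace ℝ (Fin d) → ℝ)
    (k : EuclideanSpace ℝ (Fin d)) : ℝ :=
  (∫ k1, triad c lam1 lam2 f k k1 (k - k1))
    - (∫ k2, triad c lam1 lam2 f (k + k2) k k2)
    - (∫ k1, triad c lam1 lam2 f (k + k1) k k1)

/-- For almost every `k` the integrals in `Q[f](k)` converge absolutely. -/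
def CollisionConverges {d : ℕ} (c lam1 lam2 : ℝ) (f : EuclideanSpace ℝ (Fin d) → ℝ) : Prop :=
  ∀ᵐ k : EuclideanSpace ℝ (Fin d),
    Integrable (fun k1 => triad c lam1 lam2 f k k1 (k - k1)) ∧
    Integrable (fun k2 => triad c lam1 lam2 f (k + k2) k k2)

/-- `f` is a strong solution on `[0,T)` of
`∂_t f + 2ν|k|² f = Q[f]`, `f(0) = f₀`, with
`0 ≤ f ∈ C([0,T); L¹_N) ∩ C¹((0,T); L¹_N)`. The values of `f` outside `[0,T)` are irrelevant. -/
structure IsStrongSolution {d : ℕ} (c lam1 lam2 nu N : ℝ)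
    (f0 : EuclideanSpace ℝ (Fin d) → ℝ) (T : ℝ) (f : ℝ → WeightedL1 d lam1 lam2 N) : Prop where
  nonneg : ∀ t ∈ Ico 0 T, ∀ᵐ k : EuclideanSpace ℝ (Fin d), 0 ≤ f t k
  continuousOn : ContinuousOn f (Ico 0 T)
  contDiffOn : ContDiffOn ℝ 1 f (Ioo 0 T)
  equation : ∀ t ∈ Ioo 0 T, ∀ᵐ k : EuclideanSpace ℝ (Fin d),
    (deriv f t : WeightedL1 d lam1 lam2 N) k + 2 * nu * ‖k‖ ^ 2 * f t k
      = collision c lam1 lam2 (f t) k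
  initial : ∀ᵐ k : EuclideanSpace ℝ (Fin d), f 0 k = f0 k

/-- `‖f χ_R‖_{L¹}`, where `χ_R` is the characteristic function of the ball `B(0,R)`. -/
def localMass {d : ℕ} (R : ℝ) (f : EuclideanSpace ℝ (Fin d) → ℝ) : ℝ :=
  ∫ k in Metric.ball (0 : EuclideanSpace ℝ (Fin d)) R, |f k|

/-- The growth rate `C_* = C₀ (1 + e^{(4νR₀² + 8R₀)T}) / ‖f₀ χ_{R₀}‖_{L¹}`. -/
def growthRate {d : ℕ} (nu C0 R0 T : ℝ) (f0 : EuclideanSpace ℝ (Fin d) → ℝ) : ℝ :=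
  C0 * (1 + Real.exp ((4 * nu * R0 ^ 2 + 8 * R0) * T)) / localMass R0 f0

/-- The decay rate `C^* = 4νR₀² + 8R₀`. -/
def decayRate (nu R0 : ℝ) : ℝ := 4 * nu * R0 ^ 2 + 8 * R0

/-- The set `S_t` (`Rup` is `R_*`, `Rlow` is `R^*`): functions `f ∈ L¹_{N+3}` with `f ≥ 0`,
`‖f‖_{L¹_{N+3}} ≤ (2R_* + 1) e^{C_* t}` and `‖f‖_{L¹} ≥ R^* e^{-C^* t} / 2`. -/
def invariantSet {d : ℕ} (lam1 lam2 nu N Rup Rlow C0 R0 T : ℝ)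
    (f0 : EuclideanSpace ℝ (Fin d) → ℝ) (t : ℝ) : Set (EuclideanSpace ℝ (Fin d) → ℝ) :=
  {f | MemLp f 1 (weightedMeasure d lam1 lam2 (N + 3)) ∧
    (∀ᵐ k : EuclideanSpace ℝ (Fin d), 0 ≤ f k) ∧
    weightedNorm lam1 lam2 (N + 3) f
      ≤ (2 * Rup + 1) * Real.exp (growthRate nu C0 R0 T f0 * t) ∧
    Rlow * Real.exp (-(decayRate nu R0) * t) / 2 ≤ ∫ k, |f k|}

/-- The set `S_0`, which does not depend on `C₀`, `R₀`, `T`, `f₀`. -/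
def initialSet (d : ℕ) (lam1 lam2 N Rup Rlow : ℝ) : Set (EuclideanSpace ℝ (Fin d) → ℝ) :=
  {f | MemLp f 1 (weightedMeasure d lam1 lam2 (N + 3)) ∧
    (∀ᵐ k : EuclideanSpace ℝ (Fin d), 0 ≤ f k) ∧
    weightedNorm lam1 lam2 (N + 3) f ≤ 2 * Rup + 1 ∧
    Rlow / 2 ≤ ∫ k, |f k|}

theorem invariantSet_zero {d : ℕ} (lam1 lam2 nu N Rup Rlow C0 R0 T : ℝ)
    (f0 : EuclideanSpace ℝ (Fin d) → ℝ) :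
    invariantSet lam1 lam2 nu N Rup Rlow C0 R0 T f0 0
      = initialSet d lam1 lam2 N Rup Rlow := by
  simp [invariantSet, initialSet]

end

namespace WaveKinetic

open Filter Topology
open scoped ENNReal NNReal

noncomputable section

/-! ### The weights -/

section Weights

variable {d : ℕ} {lam1 lam2 : ℝ}

local notation "X" => EuclideanSpace ℝ (Fin d)

/-! Write m for the mass ∫ f and S for |k|² + |k₁|² + |k₂|², so that Γ = S m. Since Γ/(z² + Γ²) ≤
1/Γ and, by AM–GM, |k||k₁||k₂| ≤ S|x|/2 for each member x of the triad, the collision kernel is at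
most c²|x|/(2m), whatever the resonance defect z (`mass_mul_kern_le`). This has two consequences.
First, Q loses one power of |k| while the viscosity controls two: C|k| ≤ 2ν|k|² + C²/(8ν). Second, Q
is quadratic with a kernel of size 1/m, so on nonnegative functions it grows only linearly, and the
moments obey a linear differential inequality (`gronwall_weighted`, `IsTruncSolution.norm_le`);
nothing blows up in finite time. The remaining danger is m → 0. Dropping nonnegative terms gives
Q[f] ≥ -2c²|k| f (`polColl_ge`), so the mass in a fixed ball decays at most exponentially
(`localMass_ge`).

Existence: keep only triads inside a ball of radius n. The truncated operator is globally Lipschitz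
on nonnegative functions, because the factor 1/m cancels one factor of f (`truncColl_lipschitz`),
and a fixed point argument gives solutions for all times. Two kernels differ by a term proportional
to the difference of the masses plus a truncation error O(|x||y|/n), for any two members x, y of the
triad (`abs_sub_truncKern_le`). With the uniform moments of order N+3 and Gronwall, the truncated
solutions are Cauchy in L¹_{N+2} at rate 1/n, and their time derivatives converge in L¹_N. Fatou's
lemma keeps the moment of order N+3 in the limit.

Uniqueness: a strong solution is a priori only in L¹_N, but the equation, read as a formula for
2ν|k|² f, shows that |k|² ω^N f is integrable (`integrable_normSq_of_eq`). The damped Gronwall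
inequality then applies to the difference with the solution constructed above
(`IsRegularSolution.eq_of_eq`).

Invariant set: the moments grow like e^{Kt} and the local mass decays at worst like e^{-ℓt}, with K
and ℓ independent of R₀ and T. For large R₀ both rates in the definition of the set dominate,
uniformly in T (`mul_le_half_add`, `mul_exp_neg_le`). -/

theorem continuous_omega : Continuous (omega lam1 lam2 : X → ℝ) := by
  unfold omega; fun_prop

theorem sqrt_le_omega (h2 : 0 < lam2) (k : X) : √lam1 ≤ omega lam1 lam2 k :=
  Real.sqrt_le_sqrt (by nlinarith [sq_nonneg ‖k‖])

theorem omega_pos (h1 : 0 < lam1) (h2 : 0 < lam2) (k : X) : 0 < omega lam1 lam2 k :=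
  (Real.sqrt_pos.2 h1).trans_le (sqrt_le_omega h2 k)

theorem omega_sq (h1 : 0 < lam1) (h2 : 0 < lam2) (k : X) :
    omega lam1 lam2 k ^ 2 = lam1 + lam2 * ‖k‖ ^ 2 :=
  Real.sq_sqrt (by positivity)

theorem omega_neg (k : X) : omega lam1 lam2 (-k) = omega lam1 lam2 k := by
  simp [omega]

theorem norm_le_omega (h1 : 0 < lam1) (h2 : 0 < lam2) (k : X) :
    ‖k‖ ≤ omega lam1 lam2 k / √lam2 := by
  rw [le_div_iff₀ (Real.sqrt_pos.2 h2)]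
  apply Real.le_sqrt_of_sq_le
  rw [mul_pow, Real.sq_sqrt h2.le]; nlinarith

theorem norm_sq_le_omega_sq (h1 : 0 < lam1) (h2 : 0 < lam2) (k : X) :
    ‖k‖ ^ 2 ≤ omega lam1 lam2 k ^ 2 / lam2 := by
  rw [le_div_iff₀ h2, omega_sq h1 h2]; nlinarith

theorem omega_le_of_norm_le (h2 : 0 < lam2) {k : X} {R : ℝ} (hk : ‖k‖ ≤ R) :
    omega lam1 lam2 k ≤ √(lam1 + lam2 * R ^ 2) := by
  unfold omega; gcongr

theorem omega_add_le (h1 : 0 < lam1) (h2 : 0 < lam2) (p q : X) :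
    omega lam1 lam2 (p + q) ≤ omega lam1 lam2 p + omega lam1 lam2 q := by
  have hp := omega_pos h1 h2 p
  have hq := omega_pos h1 h2 q
  apply Real.sqrt_le_iff.2 ⟨by positivity, ?_⟩
  have h3 : lam2 * (‖p‖ * ‖q‖) ≤ omega lam1 lam2 p * omega lam1 lam2 q := by
    have := mul_le_mul (norm_le_omega h1 h2 p) (norm_le_omega h1 h2 q) (norm_nonneg _)
      (by positivity)
    rw [div_mul_div_comm, Real.mul_self_sqrt h2.le, le_div_iff₀ h2] at this
    linarith
  have h4 : ‖p + q‖ ^ 2 ≤ (‖p‖ + ‖q‖) ^ 2 := by gcongr; exact norm_add_le p q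
  have h5 := omega_sq h1 h2 p
  have h6 := omega_sq h1 h2 q
  nlinarith

theorem omega_sub_le (h1 : 0 < lam1) (h2 : 0 < lam2) (p q : X) :
    omega lam1 lam2 (p - q) ≤ omega lam1 lam2 p + omega lam1 lam2 q := by
  rw [sub_eq_add_neg, ← omega_neg q]; exact omega_add_le h1 h2 _ _

/-- The weight `ω^s`. -/
abbrev weight (lam1 lam2 s : ℝ) (k : X) : ℝ := omega lam1 lam2 k ^ s

theorem weight_pos (h1 : 0 < lam1) (h2 : 0 < lam2) (s : ℝ) (k : X) : 0 < weight lam1 lam2 s k :=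
  Real.rpow_pos_of_pos (omega_pos h1 h2 k) s

theorem continuous_weight (h1 : 0 < lam1) (h2 : 0 < lam2) (s : ℝ) :
    Continuous (weight lam1 lam2 s : X → ℝ) :=
  continuous_omega.rpow_const fun k => Or.inl (omega_pos h1 h2 k).ne'

theorem rpow_le_of_le_add {x a b s : ℝ} (hx : 0 ≤ x) (ha : 0 ≤ a) (hb : 0 ≤ b) (h : x ≤ a + b)
    (hs : 0 ≤ s) : x ^ s ≤ 2 ^ s * (a ^ s + b ^ s) := by
  have hm : x ≤ 2 * max a b := by
    have := le_max_left a b; have := le_max_right a b; linarith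
  calc x ^ s ≤ (2 * max a b) ^ s := Real.rpow_le_rpow hx hm hs
    _ = 2 ^ s * (max a b) ^ s := Real.mul_rpow (by norm_num) (by positivity)
    _ ≤ 2 ^ s * (a ^ s + b ^ s) := by
        gcongr
        rcases max_choice a b with h | h <;> rw [h]
        · have := Real.rpow_nonneg hb s; linarith
        · have := Real.rpow_nonneg ha s; linarith

theorem weight_add_le (h1 : 0 < lam1) (h2 : 0 < lam2) {s : ℝ} (hs : 0 ≤ s) (p q : X) :
    weight lam1 lam2 s (p + q) ≤ 2 ^ s * (weight lam1 lam2 s p + weight lam1 lam2 s q) :=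
  rpow_le_of_le_add (omega_pos h1 h2 _).le (omega_pos h1 h2 _).le (omega_pos h1 h2 _).le
    (omega_add_le h1 h2 p q) hs

theorem weight_sub_le (h1 : 0 < lam1) (h2 : 0 < lam2) {s : ℝ} (hs : 0 ≤ s) (p q : X) :
    weight lam1 lam2 s (p - q) ≤ 2 ^ s * (weight lam1 lam2 s p + weight lam1 lam2 s q) :=
  rpow_le_of_le_add (omega_pos h1 h2 _).le (omega_pos h1 h2 _).le (omega_pos h1 h2 _).le
    (omega_sub_le h1 h2 p q) hs

theorem weight_le_left (h1 : 0 < lam1) (h2 : 0 < lam2) {s : ℝ} (hs : 0 ≤ s) (p q : X) :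
    weight lam1 lam2 s p ≤ 2 ^ s * (weight lam1 lam2 s p + weight lam1 lam2 s q) := by
  have h2s : (1 : ℝ) ≤ 2 ^ s := Real.one_le_rpow (by norm_num) hs
  have hp := weight_pos h1 h2 s p
  have hq := weight_pos h1 h2 s q
  nlinarith

end Weights

/-! ### The collision kernel -/

section Kernel

variable {d : ℕ}

local notation "X" => EuclideanSpace ℝ (Fin d)

theorem lorentzian_nonneg {G z : ℝ} (hG : 0 ≤ G) : 0 ≤ lorentzian G z := by
  unfold lorentzian; positivity

theorem mul_lorentzian_le_one {G z : ℝ} : G * lorentzian G z ≤ 1 := by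
  unfold lorentzian
  rcases eq_or_ne G 0 with rfl | hG
  · simp
  · rw [mul_div_assoc', div_le_one (by positivity)]
    nlinarith [sq_nonneg z]

/-- The difference factors as (G - H)(z² - GH)/((z² + G²)(z² + H²)), and |z² - GH| ≤ z² + GH.
Multiplying by both widths makes the bound uniform in z and meaningful when a width vanishes. -/
theorem mul_mul_abs_lorentzian_sub_le {G H z : ℝ} (hG : 0 ≤ G) (hH : 0 ≤ H) :
    G * H * |lorentzian G z - lorentzian H z| ≤ |G - H| := by
  rcases hG.eq_or_lt with rfl | hG
  · simp
  rcases hH.eq_or_lt with rfl | hH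
  · simp
  have e : lorentzian G z - lorentzian H z
      = (G - H) * ((z ^ 2 - G * H) / ((z ^ 2 + G ^ 2) * (z ^ 2 + H ^ 2))) := by
    unfold lorentzian
    have : z ^ 2 + G ^ 2 ≠ 0 := by positivity
    have : z ^ 2 + H ^ 2 ≠ 0 := by positivity
    field_simp
    ring
  rw [e, abs_mul, mul_left_comm]
  refine mul_le_of_le_one_right (abs_nonneg _) ?_
  rw [abs_div, abs_of_pos (show 0 < (z ^ 2 + G ^ 2) * (z ^ 2 + H ^ 2) by positivity),
    mul_div_assoc', div_le_one (by positivity)]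
  have : |z ^ 2 - G * H| ≤ z ^ 2 + G * H := by
    rw [abs_le]; constructor <;> nlinarith [sq_nonneg z, mul_pos hG hH]
  calc G * H * |z ^ 2 - G * H| ≤ G * H * (z ^ 2 + G * H) := by gcongr
    _ ≤ _ := by nlinarith [sq_nonneg (z ^ 2), mul_nonneg (sq_nonneg z) (sq_nonneg (G - H)),
        mul_nonneg (sq_nonneg z) (mul_pos hG hH).le]

/-- `|V|² L(m (|p+q|² + |p|² + |q|²), ω_{p+q} - ω_p - ω_q)`, the collision kernel at mass `m`. -/
def kern (c lam1 lam2 m : ℝ) (p q : X) : ℝ :=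
  |kernelV c (p + q) p q| ^ 2 *
    lorentzian ((‖p + q‖ ^ 2 + ‖p‖ ^ 2 + ‖q‖ ^ 2) * m)
      (omega lam1 lam2 (p + q) - omega lam1 lam2 p - omega lam1 lam2 q)

/-- `x` is one of the three wave vectors `p`, `q`, `p + q`. -/
def InTriad (p q x : X) : Prop := x = p ∨ x = q ∨ x = p + q

theorem abs_kernelV_sq (c : ℝ) (k p q : X) :
    |kernelV c k p q| ^ 2 = c ^ 2 * (‖k‖ * ‖p‖ * ‖q‖) := by
  rw [sq_abs, kernelV, mul_pow, Real.sq_sqrt (by positivity)]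

theorem kern_nonneg {c lam1 lam2 m : ℝ} (hm : 0 ≤ m) (p q : X) : 0 ≤ kern c lam1 lam2 m p q :=
  mul_nonneg (by positivity) (lorentzian_nonneg (by positivity))

theorem prod_le_half_mul {a b e : ℝ} (he : 0 ≤ e) :
    a * b * e ≤ 1 / 2 * (a ^ 2 + b ^ 2 + e ^ 2) * e := by
  have := mul_nonneg he (sq_nonneg (a - b))
  nlinarith [mul_nonneg he (sq_nonneg e)]

/-- AM–GM on the two factors other than ‖x‖. The freedom in choosing x is essential: later estimates
decide which variable carries the only unbounded factor. -/
theorem norm_prod_le {p q x : X} (hx : InTriad p q x) :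
    ‖p + q‖ * ‖p‖ * ‖q‖ ≤ 1 / 2 * (‖p + q‖ ^ 2 + ‖p‖ ^ 2 + ‖q‖ ^ 2) * ‖x‖ := by
  rcases hx with rfl | rfl | rfl
  · have := prod_le_half_mul (a := ‖x + q‖) (b := ‖q‖) (norm_nonneg x); linarith
  · have := prod_le_half_mul (a := ‖p + x‖) (b := ‖p‖) (norm_nonneg x); linarith
  · have := prod_le_half_mul (a := ‖p‖) (b := ‖q‖) (norm_nonneg (p + q)); linarith

theorem le_of_mul_le_of_le {S P E F : ℝ} (hP : P ≤ 1 / 2 * S * E)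
    (hF : S * F ≤ 1) (hF0 : 0 ≤ F) (hE : 0 ≤ E) : P * F ≤ 1 / 2 * E := by
  calc P * F ≤ 1 / 2 * S * E * F := by gcongr
    _ = 1 / 2 * E * (S * F) := by ring
    _ ≤ 1 / 2 * E * 1 := by gcongr
    _ = _ := by ring

theorem mass_mul_kern_le {c lam1 lam2 m : ℝ} (hm : 0 ≤ m) {p q x : X} (hx : InTriad p q x) :
    m * kern c lam1 lam2 m p q ≤ c ^ 2 / 2 * ‖x‖ := by
  rw [kern, abs_kernelV_sq]
  set S := ‖p + q‖ ^ 2 + ‖p‖ ^ 2 + ‖q‖ ^ 2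
  set z := omega lam1 lam2 (p + q) - omega lam1 lam2 p - omega lam1 lam2 q
  have hS : 0 ≤ S := by positivity
  have h := le_of_mul_le_of_le (norm_prod_le hx) (F := m * lorentzian (S * m) z)
    (by rw [← mul_assoc]; exact mul_lorentzian_le_one)
    (mul_nonneg hm (lorentzian_nonneg (by positivity))) (norm_nonneg x)
  have := mul_le_mul_of_nonneg_left h (sq_nonneg c)
  linarith

/-- Continuity of the kernel in the mass, at the same cost of one power of ‖x‖ as the bound on the
kernel itself. -/
theorem mass_mul_mass_mul_abs_kern_sub_le {c lam1 lam2 m m' : ℝ} (hm : 0 ≤ m) (hm' : 0 ≤ m')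
    {p q x : X} (hx : InTriad p q x) :
    m * m' * |kern c lam1 lam2 m p q - kern c lam1 lam2 m' p q|
      ≤ c ^ 2 / 2 * |m - m'| * ‖x‖ := by
  rw [kern, kern, abs_kernelV_sq, ← mul_sub, abs_mul, abs_of_nonneg (by positivity)]
  have hxx := norm_prod_le hx
  set S := ‖p + q‖ ^ 2 + ‖p‖ ^ 2 + ‖q‖ ^ 2
  set z := omega lam1 lam2 (p + q) - omega lam1 lam2 p - omega lam1 lam2 q
  have hS : 0 ≤ S := by positivity
  have h0 := mul_mul_abs_lorentzian_sub_le (z := z) (mul_nonneg hS hm) (mul_nonneg hS hm')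
  rw [← mul_sub, abs_mul, abs_of_nonneg hS] at h0
  set D := |lorentzian (S * m) z - lorentzian (S * m') z|
  have hD : 0 ≤ D := abs_nonneg _
  rcases hS.eq_or_lt with h | hSpos
  · rw [← h] at hxx
    have : ‖p + q‖ * ‖p‖ * ‖q‖ = 0 := le_antisymm (by simpa using hxx) (by positivity)
    rw [this]; simp; positivity
  -- The product of the two widths contains S² and their difference only S. One S cancels here, the
  -- other is spent on the AM–GM bound of the three norms.
  have h1 : S * (m * m' * D) ≤ |m - m'| := by
    refine le_of_mul_le_mul_left ?_ hSpos
    linarith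
  calc m * m' * (c ^ 2 * (‖p + q‖ * ‖p‖ * ‖q‖) * D)
      = c ^ 2 * (m * m' * D) * (‖p + q‖ * ‖p‖ * ‖q‖) := by ring
    _ ≤ c ^ 2 * (m * m' * D) * (1 / 2 * S * ‖x‖) := by gcongr
    _ = c ^ 2 / 2 * ‖x‖ * (S * (m * m' * D)) := by ring
    _ ≤ c ^ 2 / 2 * ‖x‖ * |m - m'| := by gcongr
    _ = _ := by ring

theorem measurable_kern (c lam1 lam2 m : ℝ) :
    Measurable (Function.uncurry (kern c lam1 lam2 m : X → X → ℝ)) := by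
  have : Measurable (omega lam1 lam2 : X → ℝ) := continuous_omega.measurable
  unfold kern Function.uncurry lorentzian kernelV
  simp only [sq_abs]
  fun_prop

/-- The kernel restricted to triads inside the ball of radius `n`. -/
def truncKern (c lam1 lam2 n m : ℝ) (p q : X) : ℝ :=
  if max (max ‖p‖ ‖q‖) ‖p + q‖ ≤ n then kern c lam1 lam2 m p q else 0

theorem measurable_truncKern (c lam1 lam2 n m : ℝ) :
    Measurable (Function.uncurry (truncKern c lam1 lam2 n m : X → X → ℝ)) := by
  refine Measurable.ite (measurableSet_le ?_ measurable_const) (measurable_kern c lam1 lam2 m)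
    measurable_const
  fun_prop

theorem truncKern_of_le {c lam1 lam2 n m : ℝ} {p q : X} (h : max (max ‖p‖ ‖q‖) ‖p + q‖ ≤ n) :
    truncKern c lam1 lam2 n m p q = kern c lam1 lam2 m p q := if_pos h

theorem truncKern_of_lt {c lam1 lam2 n m : ℝ} {p q : X} (h : n < max (max ‖p‖ ‖q‖) ‖p + q‖) :
    truncKern c lam1 lam2 n m p q = 0 := if_neg h.not_ge

end Kernel

/-! ### The collision operator of an arbitrary kernel, in polarized form -/

section Polarized

variable {d : ℕ}

local notation "X" => EuclideanSpace ℝ (Fin d)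

/-- The symmetric bilinear form whose diagonal is `f_q f_r - f_p f_q - f_p f_r`. -/
def polTriad (u v : X → ℝ) (p q r : X) : ℝ :=
  (u q * v r + v q * u r - u p * v q - v p * u q - u p * v r - v p * u r) / 2

/-- The first integrand of the polarized collision operator. -/
def gainIntegrand (b : X → X → ℝ) (u v : X → ℝ) (k q : X) : ℝ :=
  b q (k - q) * polTriad u v k q (k - q)

/-- The second integrand of the polarized collision operator. -/
def lossIntegrand (b : X → X → ℝ) (u v : X → ℝ) (k q : X) : ℝ :=
  b k q * polTriad u v (k + q) k q

/-- The polarized collision operator with kernel `b`. -/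
def polColl (b : X → X → ℝ) (u v : X → ℝ) (k : X) : ℝ :=
  (∫ q, gainIntegrand b u v k q) - 2 * ∫ q, lossIntegrand b u v k q

/-- The collision operator with absolute values inside the integrals. -/
def absColl (b : X → X → ℝ) (u v : X → ℝ) (k : X) : ℝ≥0∞ :=
  (∫⁻ q, ‖gainIntegrand b u v k q‖ₑ) + 2 * ∫⁻ q, ‖lossIntegrand b u v k q‖ₑ

theorem enorm_polColl_le (b : X → X → ℝ) (u v : X → ℝ) (k : X) :
    ‖polColl b u v k‖ₑ ≤ absColl b u v k := by
  unfold polColl absColl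
  refine enorm_sub_le.trans (add_le_add (enorm_integral_le_lintegral_enorm _) ?_)
  rw [enorm_mul]
  gcongr
  · simp [enorm_eq_nnnorm]
  · exact enorm_integral_le_lintegral_enorm _

theorem enorm_polTriad_le (u v : X → ℝ) (p q r : X) :
    ‖polTriad u v p q r‖ₑ ≤ ‖u q‖ₑ * ‖v r‖ₑ + ‖v q‖ₑ * ‖u r‖ₑ + ‖u p‖ₑ * ‖v q‖ₑ
      + ‖v p‖ₑ * ‖u q‖ₑ + ‖u p‖ₑ * ‖v r‖ₑ + ‖v p‖ₑ * ‖u r‖ₑ := by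
  have h : |polTriad u v p q r| ≤ |u q| * |v r| + |v q| * |u r| + |u p| * |v q|
      + |v p| * |u q| + |u p| * |v r| + |v p| * |u r| := by
    simp only [← abs_mul, polTriad, abs_div, abs_two]
    set a := u q * v r
    have key : |a + v q * u r - u p * v q - v p * u q - u p * v r - v p * u r| ≤
      |a| + |v q * u r| + |u p * v q| + |v p * u q| + |u p * v r| + |v p * u r| := by
      refine (abs_sub _ _).trans ?_; gcongr
      refine (abs_sub _ _).trans ?_; gcongr
      refine (abs_sub _ _).trans ?_; gcongr
      refine (abs_sub _ _).trans ?_; gcongr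
      exact abs_add_le _ _
    have : (0:ℝ) ≤ |a + v q * u r - u p * v q - v p * u q - u p * v r - v p * u r| :=
      abs_nonneg _
    linarith
  simp only [← ofReal_norm, Real.norm_eq_abs]
  repeat rw [← ENNReal.ofReal_mul (abs_nonneg _)]
  repeat rw [← ENNReal.ofReal_add (by positivity) (by positivity)]
  exact ENNReal.ofReal_le_ofReal h

/-- This identity, the next two and `lintegral_pair_snd_sub` are measure-preserving linear changes
of variables. They carry every pair of members of a triad to the pair (k, q). -/
theorem lintegral_pair_fst_sub {H : X → X → ℝ≥0∞} (hH : Measurable (Function.uncurry H)) :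
    ∫⁻ k, ∫⁻ q, H q (k - q) = ∫⁻ k, ∫⁻ q, H k q := by
  rw [lintegral_lintegral_swap]
  · exact lintegral_congr fun q => lintegral_sub_right_eq_self (fun k => H q k) q
  · exact (hH.comp (measurable_snd.prodMk (measurable_fst.sub measurable_snd))).aemeasurable

theorem lintegral_pair_add_fst {H : X → X → ℝ≥0∞} (hH : Measurable (Function.uncurry H)) :
    ∫⁻ k, ∫⁻ q, H (k + q) k = ∫⁻ k, ∫⁻ q, H k q := by
  rw [lintegral_lintegral_swap hH.aemeasurable]
  exact lintegral_congr fun k => lintegral_add_left_eq_self (fun q => H q k) k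

theorem lintegral_pair_add_snd {H : X → X → ℝ≥0∞} (hH : Measurable (Function.uncurry H)) :
    ∫⁻ k, ∫⁻ q, H (k + q) q = ∫⁻ k, ∫⁻ q, H k q := by
  rw [lintegral_lintegral_swap, lintegral_lintegral_swap hH.aemeasurable]
  · exact lintegral_congr fun q => lintegral_add_right_eq_self (fun k => H k q) q
  · exact (hH.comp ((measurable_fst.add measurable_snd).prodMk measurable_snd)).aemeasurable

theorem lintegral_pair_add {F G : X → X → ℝ≥0∞} (hF : Measurable fun x : X × X => F x.1 x.2) :
    ∫⁻ k, ∫⁻ q, (F k q + G k q) = (∫⁻ k, ∫⁻ q, F k q) + ∫⁻ k, ∫⁻ q, G k q := by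
  rw [← lintegral_add_left hF.lintegral_prod_right']
  exact lintegral_congr fun k => lintegral_add_left (hF.comp measurable_prodMk_left) _

theorem lintegral_pair_add_six {F₁ F₂ F₃ F₄ F₅ F₆ : X → X → ℝ≥0∞}
    (h₁ : Measurable fun x : X × X => F₁ x.1 x.2) (h₂ : Measurable fun x : X × X => F₂ x.1 x.2)
    (h₃ : Measurable fun x : X × X => F₃ x.1 x.2) (h₄ : Measurable fun x : X × X => F₄ x.1 x.2)
    (h₅ : Measurable fun x : X × X => F₅ x.1 x.2) :
    ∫⁻ k, ∫⁻ q, (F₁ k q + F₂ k q + F₃ k q + F₄ k q + F₅ k q + F₆ k q)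
      = (∫⁻ k, ∫⁻ q, F₁ k q) + (∫⁻ k, ∫⁻ q, F₂ k q) + (∫⁻ k, ∫⁻ q, F₃ k q)
        + (∫⁻ k, ∫⁻ q, F₄ k q) + (∫⁻ k, ∫⁻ q, F₅ k q) + ∫⁻ k, ∫⁻ q, F₆ k q := by
  rw [lintegral_pair_add (F := fun k q => F₁ k q + F₂ k q + F₃ k q + F₄ k q + F₅ k q)
      ((((h₁.add h₂).add h₃).add h₄).add h₅),
    lintegral_pair_add (F := fun k q => F₁ k q + F₂ k q + F₃ k q + F₄ k q)
      (((h₁.add h₂).add h₃).add h₄),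
    lintegral_pair_add (F := fun k q => F₁ k q + F₂ k q + F₃ k q) ((h₁.add h₂).add h₃),
    lintegral_pair_add (F := fun k q => F₁ k q + F₂ k q) (h₁.add h₂), lintegral_pair_add h₁]

theorem lintegral_pair_snd_sub (H : X → X → ℝ≥0∞) :
    ∫⁻ k, ∫⁻ q, H k (k - q) = ∫⁻ k, ∫⁻ q, H k q :=
  lintegral_congr fun k => lintegral_sub_left_eq_self (fun q => H k q) k

theorem measurable_polTriad {u v : X → ℝ} (hu : Measurable u) (hv : Measurable v)
    {α : Type*} [MeasurableSpace α] {f g h : α → X} (hf : Measurable f) (hg : Measurable g)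
    (hh : Measurable h) : Measurable fun a => polTriad u v (f a) (g a) (h a) := by
  unfold polTriad
  have := hu.comp hf; have := hu.comp hg; have := hu.comp hh
  have := hv.comp hf; have := hv.comp hg; have := hv.comp hh
  simp only [Function.comp_def] at *
  fun_prop

theorem measurable_gainIntegrand {b : X → X → ℝ} (hb : Measurable (Function.uncurry b))
    {u v : X → ℝ} (hu : Measurable u) (hv : Measurable v) :
    Measurable fun x : X × X => gainIntegrand b u v x.1 x.2 :=
  (hb.comp (measurable_snd.prodMk (measurable_fst.sub measurable_snd))).mul
    (measurable_polTriad hu hv measurable_fst measurable_snd (measurable_fst.sub measurable_snd))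

theorem measurable_lossIntegrand {b : X → X → ℝ} (hb : Measurable (Function.uncurry b))
    {u v : X → ℝ} (hu : Measurable u) (hv : Measurable v) :
    Measurable fun x : X × X => lossIntegrand b u v x.1 x.2 :=
  hb.mul
    (measurable_polTriad hu hv (measurable_fst.add measurable_snd) measurable_fst measurable_snd)

theorem measurable_absColl {b : X → X → ℝ} (hb : Measurable (Function.uncurry b))
    {u v : X → ℝ} (hu : Measurable u) (hv : Measurable v) : Measurable (absColl b u v) :=
  ((measurable_gainIntegrand hb hu hv).enorm.lintegral_prod_right').add
    ((measurable_lossIntegrand hb hu hv).enorm.lintegral_prod_right'.const_mul 2)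

theorem measurable_polColl {b : X → X → ℝ} (hb : Measurable (Function.uncurry b))
    {u v : X → ℝ} (hu : Measurable u) (hv : Measurable v) : Measurable (polColl b u v) :=
  ((measurable_gainIntegrand hb hu hv).stronglyMeasurable.integral_prod_right'.measurable).sub
    ((measurable_lossIntegrand hb hu hv).stronglyMeasurable.integral_prod_right'.measurable.const_mul
      2)

/-- The pair weight `W` dominates `φ |b|` on every pair of members of a triad. -/
structure Dominates (W : X → X → ℝ≥0∞) (φ : X → ℝ≥0∞) (b : X → X → ℝ) : Prop where
  symm : ∀ p q, W p q = W q p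
  meas : Measurable (Function.uncurry W)
  low : ∀ p q k, InTriad p q k → φ k * ‖b p q‖ₑ ≤ W p q
  left : ∀ p q k, InTriad p q k → φ k * ‖b p q‖ₑ ≤ W (p + q) p
  right : ∀ p q k, InTriad p q k → φ k * ‖b p q‖ₑ ≤ W (p + q) q

/-- Each of the six products in `polTriad` involves two members of the triad. A linear change of
variables turns its integral into the one on the right, or into that integral with u and v
exchanged, which is equal by the symmetry of W. Six products in the gain and twice six in the loss
make 18; the factor 1/2 of `polTriad` is given away. Working with values in `ℝ≥0∞` avoids any prior
integrability. -/
theorem lintegral_absColl_le {W : X → X → ℝ≥0∞} {φ : X → ℝ≥0∞} {b : X → X → ℝ}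
    (hW : Dominates W φ b) (hφ : Measurable φ) (hb : Measurable (Function.uncurry b))
    {u v : X → ℝ} (hu : Measurable u) (hv : Measurable v) :
    ∫⁻ k, φ k * absColl b u v k ≤ 18 * ∫⁻ p, ∫⁻ q, W p q * (‖u p‖ₑ * ‖v q‖ₑ) := by
  set H : X → X → ℝ≥0∞ := fun p q => W p q * (‖u p‖ₑ * ‖v q‖ₑ) with hHdef
  set H' : X → X → ℝ≥0∞ := fun p q => W p q * (‖v p‖ₑ * ‖u q‖ₑ) with hHdef'
  have mH : Measurable (Function.uncurry H) :=
    hW.meas.mul ((hu.comp measurable_fst).enorm.mul (hv.comp measurable_snd).enorm)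
  have mH' : Measurable (Function.uncurry H') :=
    hW.meas.mul ((hv.comp measurable_fst).enorm.mul (hu.comp measurable_snd).enorm)
  set I := ∫⁻ p, ∫⁻ q, H p q with hI
  have hI' : ∫⁻ p, ∫⁻ q, H' p q = I := by
    rw [hI, lintegral_lintegral_swap mH'.aemeasurable]
    refine lintegral_congr fun p => lintegral_congr fun q => ?_
    simp only [hHdef, hHdef']
    rw [hW.symm, mul_comm ‖v q‖ₑ]
  have m1 : Measurable fun x : X × X => H x.2 (x.1 - x.2) :=
    mH.comp (measurable_snd.prodMk (measurable_fst.sub measurable_snd))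
  have m1' : Measurable fun x : X × X => H' x.2 (x.1 - x.2) :=
    mH'.comp (measurable_snd.prodMk (measurable_fst.sub measurable_snd))
  have m2 : Measurable fun x : X × X => H x.1 (x.1 - x.2) :=
    mH.comp (measurable_fst.prodMk (measurable_fst.sub measurable_snd))
  have m2' : Measurable fun x : X × X => H' x.1 (x.1 - x.2) :=
    mH'.comp (measurable_fst.prodMk (measurable_fst.sub measurable_snd))
  have m3 : Measurable fun x : X × X => H x.1 x.2 := mH
  have m3' : Measurable fun x : X × X => H' x.1 x.2 := mH'
  have m4 : Measurable fun x : X × X => H (x.1 + x.2) x.1 :=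
    mH.comp ((measurable_fst.add measurable_snd).prodMk measurable_fst)
  have m4' : Measurable fun x : X × X => H' (x.1 + x.2) x.1 :=
    mH'.comp ((measurable_fst.add measurable_snd).prodMk measurable_fst)
  have m5 : Measurable fun x : X × X => H (x.1 + x.2) x.2 :=
    mH.comp ((measurable_fst.add measurable_snd).prodMk measurable_snd)
  have m5' : Measurable fun x : X × X => H' (x.1 + x.2) x.2 :=
    mH'.comp ((measurable_fst.add measurable_snd).prodMk measurable_snd)
  have key1 : ∀ k q, φ k * ‖gainIntegrand b u v k q‖ₑ ≤ H q (k - q) + H' q (k - q) + H k q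
      + H' k q + H k (k - q) + H' k (k - q) := by
    intro k q
    have e : q + (k - q) = k := by abel
    have t : InTriad q (k - q) k := Or.inr (Or.inr e.symm)
    have l1 := hW.low q (k - q) k t
    have l2 := hW.left q (k - q) k t
    have l3 := hW.right q (k - q) k t
    rw [e] at l2 l3
    rw [gainIntegrand, enorm_mul, ← mul_assoc]
    refine (mul_le_mul_right (enorm_polTriad_le u v k q (k - q)) _).trans ?_
    simp only [mul_add, hHdef, hHdef']
    gcongr
  have key2 : ∀ k q, φ k * ‖lossIntegrand b u v k q‖ₑ ≤ H k q + H' k q + H (k + q) k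
      + H' (k + q) k + H (k + q) q + H' (k + q) q := by
    intro k q
    have t : InTriad k q k := Or.inl rfl
    have l1 := hW.low k q k t
    have l2 := hW.left k q k t
    have l3 := hW.right k q k t
    rw [lossIntegrand, enorm_mul, ← mul_assoc]
    refine (mul_le_mul_right (enorm_polTriad_le u v (k + q) k q) _).trans ?_
    simp only [mul_add, hHdef, hHdef']
    gcongr
  have mg := (measurable_gainIntegrand hb hu hv).enorm
  have ml := (measurable_lossIntegrand hb hu hv).enorm
  have e1 : ∫⁻ k, φ k * ∫⁻ q, ‖gainIntegrand b u v k q‖ₑ ≤ 6 * I := by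
    calc _ = ∫⁻ k, ∫⁻ q, φ k * ‖gainIntegrand b u v k q‖ₑ :=
          lintegral_congr fun k => (lintegral_const_mul _ (mg.comp measurable_prodMk_left)).symm
      _ ≤ ∫⁻ k, ∫⁻ q, (H q (k - q) + H' q (k - q) + H k q
            + H' k q + H k (k - q) + H' k (k - q)) :=
          lintegral_mono fun k => lintegral_mono fun q => key1 k q
      _ = I + I + I + I + I + I := by
          rw [lintegral_pair_add_six m1 m1' m3 m3' m2, lintegral_pair_fst_sub mH,
            lintegral_pair_fst_sub mH', lintegral_pair_snd_sub H, lintegral_pair_snd_sub H', hI']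
      _ = 6 * I := by ring
  have e2 : ∫⁻ k, φ k * ∫⁻ q, ‖lossIntegrand b u v k q‖ₑ ≤ 6 * I := by
    calc _ = ∫⁻ k, ∫⁻ q, φ k * ‖lossIntegrand b u v k q‖ₑ :=
          lintegral_congr fun k => (lintegral_const_mul _ (ml.comp measurable_prodMk_left)).symm
      _ ≤ ∫⁻ k, ∫⁻ q, (H k q + H' k q + H (k + q) k
            + H' (k + q) k + H (k + q) q + H' (k + q) q) :=
          lintegral_mono fun k => lintegral_mono fun q => key2 k q
      _ = I + I + I + I + I + I := by
          rw [lintegral_pair_add_six m3 m3' m4 m4' m5, lintegral_pair_add_fst mH,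
            lintegral_pair_add_fst mH', lintegral_pair_add_snd mH, lintegral_pair_add_snd mH',
            hI']
      _ = 6 * I := by ring
  calc ∫⁻ k, φ k * absColl b u v k
      = (∫⁻ k, φ k * ∫⁻ q, ‖gainIntegrand b u v k q‖ₑ)
        + 2 * ∫⁻ k, φ k * ∫⁻ q, ‖lossIntegrand b u v k q‖ₑ := by
        have hl : Measurable fun k => φ k * ∫⁻ q, ‖lossIntegrand b u v k q‖ₑ :=
          hφ.mul ml.lintegral_prod_right'
        have hg : Measurable fun k => φ k * ∫⁻ q, ‖gainIntegrand b u v k q‖ₑ :=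
          hφ.mul mg.lintegral_prod_right'
        rw [← lintegral_const_mul _ hl, ← lintegral_add_left hg]
        exact lintegral_congr fun k => by rw [absColl, mul_add, mul_left_comm]
    _ ≤ 6 * I + 2 * (6 * I) := by gcongr
    _ = 18 * I := by ring

theorem integrable_gainIntegrand {b : X → X → ℝ} (hb : Measurable (Function.uncurry b))
    {u v : X → ℝ} (hu : Measurable u) (hv : Measurable v) {k : X} (hk : absColl b u v k < ∞) :
    Integrable (gainIntegrand b u v k) :=
  ⟨((measurable_gainIntegrand hb hu hv).comp measurable_prodMk_left).aestronglyMeasurable,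
    lt_of_le_of_lt le_self_add hk⟩

theorem integrable_lossIntegrand {b : X → X → ℝ} (hb : Measurable (Function.uncurry b))
    {u v : X → ℝ} (hu : Measurable u) (hv : Measurable v) {k : X} (hk : absColl b u v k < ∞) :
    Integrable (lossIntegrand b u v k) := by
  refine ⟨((measurable_lossIntegrand hb hu hv).comp measurable_prodMk_left).aestronglyMeasurable,
    lt_of_le_of_lt ?_ hk⟩
  calc _ ≤ 2 * ∫⁻ q, ‖lossIntegrand b u v k q‖ₑ := le_mul_of_one_le_left' (by norm_num)
    _ ≤ _ := le_add_self

/-- Telescoping of a difference of two collision operators. -/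
theorem polColl_sub {b b' : X → X → ℝ} (hb : Measurable (Function.uncurry b))
    (hb' : Measurable (Function.uncurry b')) {f g : X → ℝ} (hf : Measurable f) (hg : Measurable g)
    {k : X} (h1 : absColl b (g - f) (g + f) k < ∞) (h2 : absColl (b - b') f f k < ∞)
    (h3 : absColl b' f f k < ∞) :
    polColl b g g k - polColl b' f f k
      = polColl b (g - f) (g + f) k + polColl (b - b') f f k := by
  have hbb : Measurable (Function.uncurry (b - b')) := hb.sub hb'
  have e1 : gainIntegrand b g g k = gainIntegrand b (g - f) (g + f) k
      + gainIntegrand (b - b') f f k + gainIntegrand b' f f k := by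
    ext q; simp only [gainIntegrand, polTriad, Pi.sub_apply, Pi.add_apply]; ring
  have e2 : lossIntegrand b g g k = lossIntegrand b (g - f) (g + f) k
      + lossIntegrand (b - b') f f k + lossIntegrand b' f f k := by
    ext q; simp only [lossIntegrand, polTriad, Pi.sub_apply, Pi.add_apply]; ring
  have i1 := integrable_gainIntegrand hb (hg.sub hf) (hg.add hf) h1
  have i2 := integrable_gainIntegrand hbb hf hf h2
  have i3 := integrable_gainIntegrand hb' hf hf h3
  have j1 := integrable_lossIntegrand hb (hg.sub hf) (hg.add hf) h1
  have j2 := integrable_lossIntegrand hbb hf hf h2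
  have j3 := integrable_lossIntegrand hb' hf hf h3
  simp only [polColl, e1, e2]
  rw [integral_add' (i1.add i2) i3, integral_add' i1 i2, integral_add' (j1.add j2) j3,
    integral_add' j1 j2]
  ring

theorem ae_comp_sub_left {p : X → Prop} (h : ∀ᵐ x, p x) (k : X) : ∀ᵐ q, p (k - q) :=
  (Measure.measurePreserving_sub_left volume k).quasiMeasurePreserving.ae h

theorem ae_comp_add_left {p : X → Prop} (h : ∀ᵐ x, p x) (k : X) : ∀ᵐ q, p (k + q) :=
  (measurePreserving_add_left volume k).quasiMeasurePreserving.ae h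

/-- Translations and reflections preserve null sets, so the operator is well defined on classes of
functions modulo null sets, although it samples f at k - q and k + q. -/
theorem polColl_congr_ae (b : X → X → ℝ) {f g : X → ℝ} (h : f =ᵐ[volume] g) :
    polColl b f f =ᵐ[volume] polColl b g g := by
  filter_upwards [h] with k hk
  unfold polColl
  congr 1
  · refine integral_congr_ae ?_
    filter_upwards [h, ae_comp_sub_left h k] with q h1 h2
    simp [gainIntegrand, polTriad, hk, h1, h2]
  · congr 1
    refine integral_congr_ae ?_
    filter_upwards [h, ae_comp_add_left h k] with q h1 h2
    simp [lossIntegrand, polTriad, hk, h1, h2]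

theorem gainIntegrand_kern (c lam1 lam2 : ℝ) (f : X → ℝ) (k q : X) :
    gainIntegrand (kern c lam1 lam2 (∫ p, f p)) f f k q = triad c lam1 lam2 f k q (k - q) := by
  have e : q + (k - q) = k := by abel
  simp only [gainIntegrand, kern, polTriad, triad, e, broadening, dampingGamma]
  ring_nf

theorem lossIntegrand_kern (c lam1 lam2 : ℝ) (f : X → ℝ) (k q : X) :
    lossIntegrand (kern c lam1 lam2 (∫ p, f p)) f f k q = triad c lam1 lam2 f (k + q) k q := by
  simp only [lossIntegrand, kern, polTriad, triad, broadening, dampingGamma]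
  ring_nf

/-- The two loss integrals of `collision` are the same integral with a different name for the
variable, hence the factor 2 in `polColl`. -/
theorem collision_eq_polColl (c lam1 lam2 : ℝ) (f : X → ℝ) :
    collision c lam1 lam2 f = polColl (kern c lam1 lam2 (∫ p, f p)) f f := by
  ext k
  simp only [collision, polColl, ← gainIntegrand_kern, ← lossIntegrand_kern]
  ring

theorem collision_congr_ae (c lam1 lam2 : ℝ) {f g : X → ℝ} (h : f =ᵐ[volume] g) :
    collision c lam1 lam2 f =ᵐ[volume] collision c lam1 lam2 g := by
  rw [collision_eq_polColl, collision_eq_polColl, integral_congr_ae h]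
  exact polColl_congr_ae _ h

end Polarized

/-! ### Weighted estimates of the collision operator -/

section Estimates

variable {d : ℕ}

local notation "X" => EuclideanSpace ℝ (Fin d)

/-- The weighted absolute integral `∫ w |f|`. -/
def absInt (w f : X → ℝ) : ℝ := ∫ k, w k * |f k|

theorem absInt_nonneg {w : X → ℝ} (hw : ∀ k, 0 ≤ w k) (f : X → ℝ) : 0 ≤ absInt w f :=
  integral_nonneg fun k => mul_nonneg (hw k) (abs_nonneg _)

theorem integrable_mul_abs {w f : X → ℝ} (hw : ∀ k, 0 ≤ w k)
    (h : Integrable fun k => w k * f k) : Integrable fun k => w k * |f k| := by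
  simpa only [abs_mul, abs_of_nonneg (hw _)] using h.abs

theorem ofReal_absInt {w f : X → ℝ} (hw : ∀ k, 0 ≤ w k) (h : Integrable fun k => w k * f k) :
    ∫⁻ k, ENNReal.ofReal (w k) * ‖f k‖ₑ = ENNReal.ofReal (absInt w f) := by
  rw [absInt, ofReal_integral_eq_lintegral_ofReal (integrable_mul_abs hw h)
    (ae_of_all _ fun k => mul_nonneg (hw k) (abs_nonneg _))]
  refine lintegral_congr fun k => ?_
  rw [ENNReal.ofReal_mul (hw k), ← Real.norm_eq_abs, ofReal_norm]

theorem absInt_mono {w w' f : X → ℝ} (hw : ∀ k, 0 ≤ w k) (hww : ∀ k, w k ≤ w' k)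
    (h : Integrable fun k => w' k * f k) : absInt w f ≤ absInt w' f :=
  integral_mono_of_nonneg (ae_of_all _ fun k => mul_nonneg (hw k) (abs_nonneg _))
    (integrable_mul_abs (fun k => (hw k).trans (hww k)) h)
    (ae_of_all _ fun k => mul_le_mul_of_nonneg_right (hww k) (abs_nonneg _))

theorem integrable_of_weight_le {w w' f : X → ℝ} (hw : ∀ k, 0 ≤ w k) (hww : ∀ k, w k ≤ w' k)
    (hm : Measurable w) (hf : Measurable f) (h : Integrable fun k => w' k * f k) :
    Integrable fun k => w k * f k := by
  refine h.mono (hm.mul hf).aestronglyMeasurable (ae_of_all _ fun k => ?_)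
  rw [norm_mul, norm_mul, Real.norm_of_nonneg (hw k), Real.norm_of_nonneg ((hw k).trans (hww k))]
  gcongr
  exact hww k

theorem absInt_const_mul (a : ℝ) (w f : X → ℝ) : absInt (fun k => a * w k) f = a * absInt w f := by
  simp only [absInt, mul_assoc]; exact integral_const_mul _ _

theorem absInt_add_weight {w w' f : X → ℝ} (hw : ∀ k, 0 ≤ w k) (hw' : ∀ k, 0 ≤ w' k)
    (h : Integrable fun k => w k * f k) (h' : Integrable fun k => w' k * f k) :
    absInt (fun k => w k + w' k) f = absInt w f + absInt w' f := by
  simp only [absInt, add_mul]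
  exact integral_add (integrable_mul_abs hw h) (integrable_mul_abs hw' h')

/-- Real form of domination by a sum of two products. -/
theorem lintegral_absColl_le_of_two {φ a₁ b₁ a₂ b₂ u v : X → ℝ} {w : X → X → ℝ} {b : X → X → ℝ}
    (hdom : Dominates (fun p q => ENNReal.ofReal (w p q)) (fun k => ENNReal.ofReal (φ k)) b)
    (hφ : Measurable φ) (hb : Measurable (Function.uncurry b)) (hu : Measurable u)
    (hv : Measurable v) (hw : ∀ p q, w p q ≤ a₁ p * b₁ q + a₂ p * b₂ q)
    (pa₁ : ∀ k, 0 ≤ a₁ k) (pb₁ : ∀ k, 0 ≤ b₁ k) (pa₂ : ∀ k, 0 ≤ a₂ k) (pb₂ : ∀ k, 0 ≤ b₂ k)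
    (ma₁ : Measurable a₁) (mb₁ : Measurable b₁) (ma₂ : Measurable a₂) (mb₂ : Measurable b₂)
    (ia₁ : Integrable fun k => a₁ k * u k) (ib₁ : Integrable fun k => b₁ k * v k)
    (ia₂ : Integrable fun k => a₂ k * u k) (ib₂ : Integrable fun k => b₂ k * v k) :
    ∫⁻ k, ENNReal.ofReal (φ k) * absColl b u v k
      ≤ ENNReal.ofReal (18 * (absInt a₁ u * absInt b₁ v + absInt a₂ u * absInt b₂ v)) := by
  refine (lintegral_absColl_le hdom hφ.ennreal_ofReal hb hu hv).trans ?_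
  rw [ENNReal.ofReal_mul (by norm_num), show ENNReal.ofReal 18 = 18 by simp]
  gcongr
  have A₁ : Measurable fun p => ENNReal.ofReal (a₁ p) * ‖u p‖ₑ := ma₁.ennreal_ofReal.mul hu.enorm
  have B₁ : Measurable fun p => ENNReal.ofReal (b₁ p) * ‖v p‖ₑ := mb₁.ennreal_ofReal.mul hv.enorm
  have A₂ : Measurable fun p => ENNReal.ofReal (a₂ p) * ‖u p‖ₑ := ma₂.ennreal_ofReal.mul hu.enorm
  have B₂ : Measurable fun p => ENNReal.ofReal (b₂ p) * ‖v p‖ₑ := mb₂.ennreal_ofReal.mul hv.enorm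
  calc ∫⁻ p, ∫⁻ q, ENNReal.ofReal (w p q) * (‖u p‖ₑ * ‖v q‖ₑ)
      ≤ ∫⁻ p, ∫⁻ q, ((ENNReal.ofReal (a₁ p) * ‖u p‖ₑ) * (ENNReal.ofReal (b₁ q) * ‖v q‖ₑ)
          + (ENNReal.ofReal (a₂ p) * ‖u p‖ₑ) * (ENNReal.ofReal (b₂ q) * ‖v q‖ₑ)) := by
        refine lintegral_mono fun p => lintegral_mono fun q => ?_
        calc _ ≤ (ENNReal.ofReal (a₁ p) * ENNReal.ofReal (b₁ q)
              + ENNReal.ofReal (a₂ p) * ENNReal.ofReal (b₂ q)) * (‖u p‖ₑ * ‖v q‖ₑ) := by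
              gcongr
              rw [← ENNReal.ofReal_mul (pa₁ p), ← ENNReal.ofReal_mul (pa₂ p),
                ← ENNReal.ofReal_add (mul_nonneg (pa₁ p) (pb₁ q)) (mul_nonneg (pa₂ p) (pb₂ q))]
              exact ENNReal.ofReal_le_ofReal (hw p q)
          _ = _ := by ring
    _ = _ := by
        rw [lintegral_pair_add (F := fun p q => (ENNReal.ofReal (a₁ p) * ‖u p‖ₑ)
            * (ENNReal.ofReal (b₁ q) * ‖v q‖ₑ))
            ((A₁.comp measurable_fst).mul (B₁.comp measurable_snd)),
          lintegral_lintegral_mul A₁.aemeasurable B₁.aemeasurable,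
          lintegral_lintegral_mul A₂.aemeasurable B₂.aemeasurable,
          ofReal_absInt pa₁ ia₁, ofReal_absInt pb₁ ib₁, ofReal_absInt pa₂ ia₂,
          ofReal_absInt pb₂ ib₂, ← ENNReal.ofReal_mul (absInt_nonneg pa₁ _),
          ← ENNReal.ofReal_mul (absInt_nonneg pa₂ _), ← ENNReal.ofReal_add]
        · exact mul_nonneg (absInt_nonneg pa₁ _) (absInt_nonneg pb₁ _)
        · exact mul_nonneg (absInt_nonneg pa₂ _) (absInt_nonneg pb₂ _)

theorem ae_absColl_lt_top_of_le {φ : X → ℝ} {b : X → X → ℝ} {u v : X → ℝ} {C : ℝ}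
    (hφ : Measurable φ) (hφ0 : ∀ k, 0 < φ k) (hb : Measurable (Function.uncurry b))
    (hu : Measurable u) (hv : Measurable v)
    (h : ∫⁻ k, ENNReal.ofReal (φ k) * absColl b u v k ≤ ENNReal.ofReal C) :
    ∀ᵐ k, absColl b u v k < ∞ := by
  filter_upwards [ae_lt_top (hφ.ennreal_ofReal.mul (measurable_absColl hb hu hv))
    (h.trans_lt ENNReal.ofReal_lt_top).ne] with k hk
  exact ENNReal.lt_top_of_mul_ne_top_right hk.ne (by simpa using hφ0 k)

theorem integrable_weight_mul {φ F : X → ℝ} {C : ℝ} (hφ : Measurable φ) (hφ0 : ∀ k, 0 ≤ φ k)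
    (hF : Measurable F) (hC : 0 ≤ C)
    (h : ∫⁻ k, ENNReal.ofReal (φ k) * ‖F k‖ₑ ≤ ENNReal.ofReal C) :
    (Integrable fun k => φ k * F k) ∧ absInt φ F ≤ C := by
  have e : ∀ k, ‖φ k * F k‖ₑ = ENNReal.ofReal (φ k) * ‖F k‖ₑ := fun k => by
    rw [enorm_mul, Real.enorm_eq_ofReal (hφ0 k)]
  have hi : Integrable fun k => φ k * F k :=
    ⟨(hφ.mul hF).aestronglyMeasurable, by
      simp only [HasFiniteIntegral, e]; exact h.trans_lt ENNReal.ofReal_lt_top⟩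
  refine ⟨hi, ?_⟩
  rw [ofReal_absInt hφ0 hi] at h
  exact (ENNReal.ofReal_le_ofReal_iff hC).1 h

/-- `x` and `y` are two different members of the triad `p`, `q`, `p + q`. -/
def IsPair (p q x y : X) : Prop :=
  (x = p ∧ y = q) ∨ (x = q ∧ y = p) ∨ (x = p + q ∧ y = p) ∨ (x = p ∧ y = p + q)
    ∨ (x = p + q ∧ y = q) ∨ (x = q ∧ y = p + q)

theorem IsPair.fst {p q x y : X} (h : IsPair p q x y) : InTriad p q x := by
  rcases h with ⟨rfl, -⟩ | ⟨rfl, -⟩ | ⟨rfl, -⟩ | ⟨rfl, -⟩ | ⟨rfl, -⟩ | ⟨rfl, -⟩ <;>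
    simp [InTriad]

theorem IsPair.symm {p q x y : X} (h : IsPair p q x y) : IsPair p q y x := by
  unfold IsPair at *; tauto

/-- Any two members of a triad determine the third as a sum or a difference, and ω is even and
subadditive. -/
theorem IsPair.weight_le {lam1 lam2 : ℝ} (h1 : 0 < lam1) (h2 : 0 < lam2) {s : ℝ} (hs : 0 ≤ s)
    {p q x y k : X} (h : IsPair p q x y) (hk : InTriad p q k) :
    weight lam1 lam2 s k ≤ 2 ^ s * (weight lam1 lam2 s x + weight lam1 lam2 s y) := by
  have hcomm := add_comm (weight lam1 lam2 s x) (weight lam1 lam2 s y)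
  have hl := weight_le_left h1 h2 hs x y
  have hr := weight_le_left h1 h2 hs y x
  have ha := weight_add_le h1 h2 hs x y
  have hd := weight_sub_le h1 h2 hs x y
  have hd' := weight_sub_le h1 h2 hs y x
  have ha' := weight_add_le h1 h2 hs y x
  rw [← hcomm] at hr hd' ha'
  rcases h with ⟨rfl, rfl⟩ | ⟨rfl, rfl⟩ | ⟨rfl, rfl⟩ | ⟨rfl, rfl⟩ | ⟨rfl, rfl⟩ | ⟨rfl, rfl⟩ <;>
    rcases hk with rfl | rfl | rfl <;>
    first
      | assumption
      | (simp only [add_sub_cancel_left, add_sub_cancel_right] at hd hd'; assumption)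

/-- The pair weight used for kernels of size `‖x‖ (η + ζ ‖y‖)`. -/
def pairWeight (lam1 lam2 s η ζ : ℝ) (p q : X) : ℝ :=
  2 ^ s * (weight lam1 lam2 s p + weight lam1 lam2 s q)
    * min (‖p‖ * (η + ζ * ‖q‖)) (‖q‖ * (η + ζ * ‖p‖))

theorem dominates_pairWeight {lam1 lam2 : ℝ} (h1 : 0 < lam1) (h2 : 0 < lam2) {s : ℝ} (hs : 0 ≤ s)
    {η ζ : ℝ} {b : X → X → ℝ}
    (hb : ∀ p q x y, IsPair p q x y → |b p q| ≤ ‖x‖ * (η + ζ * ‖y‖)) :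
    Dominates (fun p q => ENNReal.ofReal (pairWeight lam1 lam2 s η ζ p q))
      (fun k => ENNReal.ofReal (weight lam1 lam2 s k)) b := by
  have key : ∀ p q x y k, IsPair p q x y → InTriad p q k →
      ENNReal.ofReal (weight lam1 lam2 s k) * ‖b p q‖ₑ
        ≤ ENNReal.ofReal (pairWeight lam1 lam2 s η ζ x y) := by
    intro p q x y k hxy hk
    rw [← ofReal_norm, ← ENNReal.ofReal_mul (weight_pos h1 h2 s k).le]
    refine ENNReal.ofReal_le_ofReal ?_
    have hx := weight_pos h1 h2 s x
    have hy := weight_pos h1 h2 s y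
    exact mul_le_mul (hxy.weight_le h1 h2 hs hk) (le_min (hb _ _ _ _ hxy) (hb _ _ _ _ hxy.symm))
      (norm_nonneg _) (by positivity)
  refine ⟨fun p q => ?_, ?_, fun p q k hk => key _ _ _ _ _ (by simp [IsPair]) hk,
    fun p q k hk => key _ _ _ _ _ (by simp [IsPair]) hk,
    fun p q k hk => key _ _ _ _ _ (by simp [IsPair]) hk⟩
  · simp only [pairWeight, min_comm, add_comm]
  · have : Measurable (omega lam1 lam2 : X → ℝ) := continuous_omega.measurable
    unfold pairWeight Function.uncurry
    fun_prop

/-- The minimum is used differently on the two summands of the weight: the variable that carries ω^s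
also carries the bare factor ‖·‖. Hence no moment of order ‖k‖² ω^s appears even when ζ ≠ 0. -/
theorem pairWeight_le {lam1 lam2 : ℝ} (h1 : 0 < lam1) (h2 : 0 < lam2) (s η ζ : ℝ) (p q : X) :
    pairWeight lam1 lam2 s η ζ p q
      ≤ (2 ^ s * (‖p‖ * weight lam1 lam2 s p)) * (η + ζ * ‖q‖)
        + (η + ζ * ‖p‖) * (2 ^ s * (‖q‖ * weight lam1 lam2 s q)) := by
  have hp := weight_pos h1 h2 s p
  have hq := weight_pos h1 h2 s q
  have h3 : (0 : ℝ) < 2 ^ s := by positivity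
  have m1 := min_le_left (‖p‖ * (η + ζ * ‖q‖)) (‖q‖ * (η + ζ * ‖p‖))
  have m2 := min_le_right (‖p‖ * (η + ζ * ‖q‖)) (‖q‖ * (η + ζ * ‖p‖))
  have e1 := mul_le_mul_of_nonneg_left m1 (mul_pos h3 hp).le
  have e2 := mul_le_mul_of_nonneg_left m2 (mul_pos h3 hq).le
  unfold pairWeight
  linarith

/-- Here the factor ‖·‖ is always placed on the first variable. In the difference estimate the first
argument is g - f, whose extra power is absorbed by viscosity, while g + f is needed only in L¹_s.
-/
theorem pairWeight_le' {lam1 lam2 : ℝ} (h1 : 0 < lam1) (h2 : 0 < lam2) (s η : ℝ) (p q : X) :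
    pairWeight lam1 lam2 s η 0 p q
      ≤ (2 ^ s * η * (‖p‖ * weight lam1 lam2 s p)) * 1
        + (2 ^ s * η * ‖p‖) * weight lam1 lam2 s q := by
  have hp := weight_pos h1 h2 s p
  have hq := weight_pos h1 h2 s q
  have h3 : (0 : ℝ) < 2 ^ s := by positivity
  have m1 := min_le_left (‖p‖ * (η + 0 * ‖q‖)) (‖q‖ * (η + 0 * ‖p‖))
  have e1 := mul_le_mul_of_nonneg_left m1 (mul_pos h3 (add_pos hp hq)).le
  unfold pairWeight
  linarith

/-- Functions with a finite moment of weight `(1 + ‖k‖) ω^s`. -/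
structure Moments (lam1 lam2 s : ℝ) (f : X → ℝ) : Prop where
  meas : Measurable f
  int : Integrable f
  intNorm : Integrable fun k => ‖k‖ * f k
  intWeight : Integrable fun k => weight lam1 lam2 s k * f k
  intNormWeight : Integrable fun k => ‖k‖ * weight lam1 lam2 s k * f k

theorem Moments.add {lam1 lam2 s : ℝ} {f g : X → ℝ} (hf : Moments lam1 lam2 s f)
    (hg : Moments lam1 lam2 s g) : Moments lam1 lam2 s (f + g) where
  meas := hf.meas.add hg.meas
  int := hf.int.add hg.int
  intNorm := by simpa only [Pi.add_apply, mul_add] using! hf.intNorm.add hg.intNorm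
  intWeight := by simpa only [Pi.add_apply, mul_add] using! hf.intWeight.add hg.intWeight
  intNormWeight := by
    simpa only [Pi.add_apply, mul_add] using! hf.intNormWeight.add hg.intNormWeight

theorem Moments.sub {lam1 lam2 s : ℝ} {f g : X → ℝ} (hf : Moments lam1 lam2 s f)
    (hg : Moments lam1 lam2 s g) : Moments lam1 lam2 s (f - g) where
  meas := hf.meas.sub hg.meas
  int := hf.int.sub hg.int
  intNorm := by simpa only [Pi.sub_apply, mul_sub] using! hf.intNorm.sub hg.intNorm
  intWeight := by simpa only [Pi.sub_apply, mul_sub] using! hf.intWeight.sub hg.intWeight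
  intNormWeight := by
    simpa only [Pi.sub_apply, mul_sub] using! hf.intNormWeight.sub hg.intNormWeight

variable {lam1 lam2 s : ℝ}

/-- `∫ |f|`. -/
abbrev mom0 (f : X → ℝ) : ℝ := absInt (fun _ => 1) f
/-- `∫ |k| |f|`. -/
abbrev mom1 (f : X → ℝ) : ℝ := absInt (fun k => ‖k‖) f
/-- `∫ ω^s |f|`. -/
abbrev momW (lam1 lam2 s : ℝ) (f : X → ℝ) : ℝ := absInt (weight lam1 lam2 s) f
/-- `∫ |k| ω^s |f|`. -/
abbrev momKW (lam1 lam2 s : ℝ) (f : X → ℝ) : ℝ := absInt (fun k => ‖k‖ * weight lam1 lam2 s k) f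

theorem lintegral_absColl_diag_le (h1 : 0 < lam1) (h2 : 0 < lam2) (hs : 0 ≤ s)
    {η ζ : ℝ} (hη : 0 ≤ η) (hζ : 0 ≤ ζ) {b : X → X → ℝ} (hbm : Measurable (Function.uncurry b))
    (hb : ∀ p q x y, IsPair p q x y → |b p q| ≤ ‖x‖ * (η + ζ * ‖y‖)) {f : X → ℝ}
    (hf : Moments lam1 lam2 s f) :
    ∫⁻ k, ENNReal.ofReal (weight lam1 lam2 s k) * absColl b f f k
      ≤ ENNReal.ofReal (36 * 2 ^ s * momKW lam1 lam2 s f * (η * mom0 f + ζ * mom1 f)) := by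
  have hw := (continuous_weight h1 h2 s (d := d)).measurable
  have pw : ∀ k : X, 0 ≤ ‖k‖ * weight lam1 lam2 s k := fun k =>
    mul_nonneg (norm_nonneg _) (weight_pos h1 h2 s k).le
  have iη : Integrable fun k => (η + ζ * ‖k‖) * f k := by
    simpa only [add_mul, mul_assoc] using! (hf.int.const_mul η).add (hf.intNorm.const_mul ζ)
  have iW : Integrable fun k => (2 ^ s * (‖k‖ * weight lam1 lam2 s k)) * f k := by
    simpa only [mul_assoc] using! hf.intNormWeight.const_mul (2 ^ s)
  have pη : ∀ k : X, 0 ≤ η + ζ * ‖k‖ := fun k => by positivity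
  have pW : ∀ k : X, 0 ≤ 2 ^ s * (‖k‖ * weight lam1 lam2 s k) := fun k =>
    mul_nonneg (by positivity) (pw k)
  refine (lintegral_absColl_le_of_two (dominates_pairWeight h1 h2 hs hb) hw hbm hf.meas hf.meas
    (pairWeight_le h1 h2 s η ζ) pW pη pη pW (by fun_prop) (by fun_prop) (by fun_prop)
    (by fun_prop) iW iη iη iW).trans (le_of_eq ?_)
  have e1 : absInt (fun k => η + ζ * ‖k‖) f = η * mom0 f + ζ * mom1 f := by
    have : (fun k : X => η + ζ * ‖k‖) = fun k => (η * 1) + ζ * ‖k‖ := by simp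
    rw [this, absInt_add_weight (fun _ => by positivity) (fun _ => by positivity),
      absInt_const_mul, absInt_const_mul]
    · simpa using hf.int.const_mul η
    · simpa only [mul_assoc] using hf.intNorm.const_mul ζ
  rw [e1, absInt_const_mul]
  congr 1
  ring

theorem lintegral_absColl_offdiag_le (h1 : 0 < lam1) (h2 : 0 < lam2) (hs : 0 ≤ s)
    {β : ℝ} (hβ : 0 ≤ β) {b : X → X → ℝ} (hbm : Measurable (Function.uncurry b))
    (hb : ∀ p q x, InTriad p q x → |b p q| ≤ β * ‖x‖) {u v : X → ℝ}
    (hu : Moments lam1 lam2 s u) (hv : Moments lam1 lam2 s v) :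
    ∫⁻ k, ENNReal.ofReal (weight lam1 lam2 s k) * absColl b u v k
      ≤ ENNReal.ofReal (18 * 2 ^ s * β *
        (momKW lam1 lam2 s u * mom0 v + mom1 u * momW lam1 lam2 s v)) := by
  have hw := (continuous_weight h1 h2 s (d := d)).measurable
  have pw : ∀ k : X, 0 ≤ weight lam1 lam2 s k := fun k => (weight_pos h1 h2 s k).le
  have hb' : ∀ p q x y, IsPair p q x y → |b p q| ≤ ‖x‖ * (β + 0 * ‖y‖) := fun p q x y h => by
    have := hb p q x h.fst; linarith
  have p1 : ∀ k : X, 0 ≤ 2 ^ s * β * (‖k‖ * weight lam1 lam2 s k) := fun k => by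
    have := pw k; positivity
  have p2 : ∀ k : X, 0 ≤ 2 ^ s * β * ‖k‖ := fun k => by positivity
  refine (lintegral_absColl_le_of_two (dominates_pairWeight h1 h2 hs hb') hw hbm hu.meas hv.meas
    (pairWeight_le' h1 h2 s β) p1 (fun _ => zero_le_one) p2 pw (by fun_prop) (by fun_prop)
    (by fun_prop) (by fun_prop) ?_ ?_ ?_ hv.intWeight).trans (le_of_eq ?_)
  · simpa only [mul_assoc] using! hu.intNormWeight.const_mul (2 ^ s * β)
  · simpa using hv.int
  · simpa only [mul_assoc] using! hu.intNorm.const_mul (2 ^ s * β)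
  · rw [absInt_const_mul, absInt_const_mul]
    congr 1
    ring

/-- Difference estimate for two collision operators with different kernels. -/
theorem polColl_sub_estimate (h1 : 0 < lam1) (h2 : 0 < lam2) (hs : 0 ≤ s)
    {β β' η ζ : ℝ} (hβ : 0 ≤ β) (hβ' : 0 ≤ β') (hη : 0 ≤ η) (hζ : 0 ≤ ζ) {b b' : X → X → ℝ}
    (hbm : Measurable (Function.uncurry b)) (hbm' : Measurable (Function.uncurry b'))
    (hb : ∀ p q x, InTriad p q x → |b p q| ≤ β * ‖x‖)
    (hb' : ∀ p q x, InTriad p q x → |b' p q| ≤ β' * ‖x‖)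
    (hbb : ∀ p q x y, IsPair p q x y → |b p q - b' p q| ≤ ‖x‖ * (η + ζ * ‖y‖)) {f g : X → ℝ}
    (hf : Moments lam1 lam2 s f) (hg : Moments lam1 lam2 s g) :
    (Integrable fun k => weight lam1 lam2 s k * (polColl b g g k - polColl b' f f k)) ∧
    absInt (weight lam1 lam2 s) (fun k => polColl b g g k - polColl b' f f k)
      ≤ 18 * 2 ^ s * β * (momKW lam1 lam2 s (g - f) * mom0 (g + f)
          + mom1 (g - f) * momW lam1 lam2 s (g + f))
        + 36 * 2 ^ s * momKW lam1 lam2 s f * (η * mom0 f + ζ * mom1 f) := by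
  have hw := (continuous_weight h1 h2 s (d := d)).measurable
  have pw : ∀ k : X, 0 ≤ weight lam1 lam2 s k := fun k => (weight_pos h1 h2 s k).le
  have pkw : ∀ k : X, 0 ≤ ‖k‖ * weight lam1 lam2 s k := fun k => mul_nonneg (norm_nonneg _) (pw k)
  have hbbm : Measurable (Function.uncurry (b - b')) := hbm.sub hbm'
  have E1 := lintegral_absColl_offdiag_le h1 h2 hs hβ hbm hb (hg.sub hf) (hg.add hf)
  have E2 := lintegral_absColl_diag_le h1 h2 hs hη hζ hbbm hbb hf
  have E3 := lintegral_absColl_offdiag_le h1 h2 hs hβ' hbm' hb' hf hf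
  have n0 : ∀ F : X → ℝ, 0 ≤ mom0 F := absInt_nonneg fun _ => zero_le_one
  have n1 : ∀ F : X → ℝ, 0 ≤ mom1 F := absInt_nonneg fun _ => norm_nonneg _
  have nW : ∀ F : X → ℝ, 0 ≤ momW lam1 lam2 s F := absInt_nonneg pw
  have nKW : ∀ F : X → ℝ, 0 ≤ momKW lam1 lam2 s F := absInt_nonneg pkw
  set C1 := 18 * 2 ^ s * β * (momKW lam1 lam2 s (g - f) * mom0 (g + f)
          + mom1 (g - f) * momW lam1 lam2 s (g + f)) with hC1
  set C2 := 36 * 2 ^ s * momKW lam1 lam2 s f * (η * mom0 f + ζ * mom1 f) with hC2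
  have pC1 : 0 ≤ C1 := mul_nonneg (by positivity)
    (add_nonneg (mul_nonneg (nKW _) (n0 _)) (mul_nonneg (n1 _) (nW _)))
  have pC2 : 0 ≤ C2 := mul_nonneg (mul_nonneg (by positivity) (nKW _))
    (add_nonneg (mul_nonneg hη (n0 _)) (mul_nonneg hζ (n1 _)))
  have ae1 := ae_absColl_lt_top_of_le hw (weight_pos h1 h2 s) hbm (hg.sub hf).meas
    (hg.add hf).meas E1
  have ae2 := ae_absColl_lt_top_of_le hw (weight_pos h1 h2 s) hbbm hf.meas hf.meas E2
  have ae3 := ae_absColl_lt_top_of_le hw (weight_pos h1 h2 s) hbm' hf.meas hf.meas E3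
  refine integrable_weight_mul hw pw ((measurable_polColl hbm hg.meas hg.meas).sub
    (measurable_polColl hbm' hf.meas hf.meas)) (add_nonneg pC1 pC2) ?_
  calc ∫⁻ k, ENNReal.ofReal (weight lam1 lam2 s k) * ‖polColl b g g k - polColl b' f f k‖ₑ
      ≤ ∫⁻ k, (ENNReal.ofReal (weight lam1 lam2 s k) * absColl b (g - f) (g + f) k
          + ENNReal.ofReal (weight lam1 lam2 s k) * absColl (b - b') f f k) := by
        refine lintegral_mono_ae ?_
        filter_upwards [ae1, ae2, ae3] with k a1 a2 a3
        rw [polColl_sub hbm hbm' hf.meas hg.meas a1 a2 a3, ← mul_add]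
        gcongr
        exact (enorm_add_le _ _).trans (add_le_add (enorm_polColl_le _ _ _ _)
          (enorm_polColl_le _ _ _ _))
    _ ≤ ENNReal.ofReal C1 + ENNReal.ofReal C2 := by
        have m : Measurable fun k => ENNReal.ofReal (weight lam1 lam2 s k)
            * absColl b (g - f) (g + f) k :=
          hw.ennreal_ofReal.mul (measurable_absColl hbm (hg.sub hf).meas (hg.add hf).meas)
        rw [lintegral_add_left m]
        exact add_le_add E1 E2
    _ = ENNReal.ofReal (C1 + C2) := (ENNReal.ofReal_add pC1 pC2).symm

/-- For f ≥ 0 and β = c²/(2 ∫ f) the product β · `mom0 f` is the constant c²/2, so this quadratic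
bound becomes linear in f. This is the source of global existence. -/
theorem polColl_estimate (h1 : 0 < lam1) (h2 : 0 < lam2) (hs : 0 ≤ s)
    {β : ℝ} (hβ : 0 ≤ β) {b : X → X → ℝ} (hbm : Measurable (Function.uncurry b))
    (hb : ∀ p q x, InTriad p q x → |b p q| ≤ β * ‖x‖) {f : X → ℝ} (hf : Moments lam1 lam2 s f) :
    (∀ᵐ k, absColl b f f k < ∞) ∧ (Integrable fun k => weight lam1 lam2 s k * polColl b f f k) ∧
    absInt (weight lam1 lam2 s) (polColl b f f)
      ≤ 36 * 2 ^ s * (β * mom0 f) * momKW lam1 lam2 s f := by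
  have hw := (continuous_weight h1 h2 s (d := d)).measurable
  have pw : ∀ k : X, 0 ≤ weight lam1 lam2 s k := fun k => (weight_pos h1 h2 s k).le
  have pkw : ∀ k : X, 0 ≤ ‖k‖ * weight lam1 lam2 s k := fun k => mul_nonneg (norm_nonneg _) (pw k)
  have hb' : ∀ p q x y, IsPair p q x y → |b p q| ≤ ‖x‖ * (β + 0 * ‖y‖) := fun p q x y h => by
    have := hb p q x h.fst; linarith
  have E := lintegral_absColl_diag_le h1 h2 hs hβ le_rfl hbm hb' hf
  refine ⟨ae_absColl_lt_top_of_le hw (weight_pos h1 h2 s) hbm hf.meas hf.meas E, ?_⟩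
  refine integrable_weight_mul hw pw (measurable_polColl hbm hf.meas hf.meas) ?_ ?_
  · exact mul_nonneg (mul_nonneg (by positivity) (mul_nonneg hβ (absInt_nonneg
      (fun _ => zero_le_one) _))) (absInt_nonneg pkw _)
  · refine (lintegral_mono fun k => ?_).trans (E.trans (le_of_eq (by congr 1; ring)))
    gcongr
    exact enorm_polColl_le _ _ _ _

end Estimates

/-! ### Global solutions of Lipschitz differential equations -/

section GlobalODE

variable {E : Type*} [NormedAddCommGroup E] [NormedSpace ℝ E]

theorem integral_exp_mul_le {κ t : ℝ} (hκ : 0 < κ) :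
    ∫ s in (0)..t, Real.exp (κ * s) ≤ Real.exp (κ * t) / κ := by
  have h : ∀ s ∈ uIcc 0 t, HasDerivAt (fun s => Real.exp (κ * s) / κ) (Real.exp (κ * s)) s := by
    intro s _
    have := ((hasDerivAt_id s).const_mul κ).exp.div_const κ
    simp only [id, mul_one] at this
    rwa [mul_div_cancel_right₀ _ hκ.ne'] at this
  rw [intervalIntegral.integral_eq_sub_of_hasDerivAt h
    (Continuous.intervalIntegrable (by fun_prop) _ _)]
  have : 0 ≤ Real.exp (κ * 0) / κ := by positivity
  linarith

/-- Integrating against an exponential weight gains a factor 1/κ, independent of t; a large κ turns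
the Picard map into a contraction on the whole half-line. -/
theorem norm_exp_smul_integral_le {G : ℝ → E} {C κ t : ℝ} (hκ : 0 < κ) (ht : 0 ≤ t) (hC : 0 ≤ C)
    (hG : ∀ s ∈ Icc 0 t, ‖G s‖ ≤ C * Real.exp (κ * s)) :
    ‖Real.exp (-(κ * t)) • ∫ s in (0)..t, G s‖ ≤ C / κ := by
  have h1 : ‖∫ s in (0)..t, G s‖ ≤ ∫ s in (0)..t, C * Real.exp (κ * s) :=
    intervalIntegral.norm_integral_le_of_norm_le ht
      (ae_of_all _ fun s hs => hG s ⟨hs.1.le, hs.2⟩)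
      (Continuous.intervalIntegrable (by fun_prop) _ _)
  rw [intervalIntegral.integral_const_mul] at h1
  rw [norm_smul, Real.norm_of_nonneg (Real.exp_pos _).le]
  calc _ ≤ Real.exp (-(κ * t)) * (C * (Real.exp (κ * t) / κ)) := by
        gcongr
        exact h1.trans (mul_le_mul_of_nonneg_left (integral_exp_mul_le hκ) hC)
    _ = C / κ * (Real.exp (-(κ * t)) * Real.exp (κ * t)) := by ring
    _ = C / κ := by rw [← Real.exp_add]; simp

/-- A globally Lipschitz autonomous equation has a solution on `[0, ∞)`. -/
theorem exists_forall_hasDerivAt_of_lipschitzWith [CompleteSpace E] {F : E → E} {L : ℝ≥0}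
    (hF : LipschitzWith L F) (x₀ : E) :
    ∃ u : ℝ → E, u 0 = x₀ ∧ ∀ t, 0 ≤ t → HasDerivAt u (F (u t)) t := by
  -- This choice gives L/κ ≤ 1/2, the contraction constant below.
  set κ : ℝ := 2 * L + 1
  have hκ : 0 < κ := by positivity
  let G : BoundedContinuousFunction ℝ E → ℝ → E := fun w s => F (Real.exp (κ * s) • w s)
  have hGc : ∀ w, Continuous (G w) := fun w => hF.continuous.comp (by fun_prop)
  have hGb : ∀ w s, 0 ≤ s → ‖G w s‖ ≤ (‖F 0‖ + L * ‖w‖) * Real.exp (κ * s) := by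
    intro w s hs
    have h1 : ‖G w s‖ ≤ ‖F 0‖ + ‖G w s - F 0‖ := by
      simpa using norm_add_le (F 0) (G w s - F 0)
    have h2 := hF.norm_sub_le (Real.exp (κ * s) • w s) 0
    rw [sub_zero, norm_smul, Real.norm_of_nonneg (Real.exp_pos _).le] at h2
    have h3 : (1 : ℝ) ≤ Real.exp (κ * s) := Real.one_le_exp (by positivity)
    have h4 : L * (Real.exp (κ * s) * ‖w s‖) ≤ L * (Real.exp (κ * s) * ‖w‖) := by
      gcongr; exact w.norm_coe_le_norm s
    have h5 : ‖F 0‖ * 1 ≤ ‖F 0‖ * Real.exp (κ * s) := by gcongr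
    change ‖G w s - F 0‖ ≤ _ at h2
    linarith
  -- The unknown w stands for e^{-κt} u(t), which stays bounded for t ≥ 0. Replacing t by `max t 0`
  -- freezes the map at negative times, so that it acts on bounded continuous functions on all of ℝ.
  let Ψ : BoundedContinuousFunction ℝ E → ℝ → E := fun w t =>
    Real.exp (-(κ * max t 0)) • x₀ + Real.exp (-(κ * max t 0)) • ∫ s in (0)..(max t 0), G w s
  have hΨc : ∀ w, Continuous (Ψ w) := by
    intro w
    have h1 : Continuous fun t => ∫ s in (0)..t, G w s :=
      intervalIntegral.continuous_primitive (fun a b => (hGc w).intervalIntegrable a b) 0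
    have h2 : Continuous fun t : ℝ => ∫ s in (0)..(max t 0), G w s :=
      h1.comp (continuous_id.max continuous_const)
    fun_prop
  have hΨb : ∀ w t, ‖Ψ w t‖ ≤ ‖x₀‖ + (‖F 0‖ + L * ‖w‖) / κ := by
    intro w t
    refine (norm_add_le _ _).trans (add_le_add ?_ ?_)
    · rw [norm_smul, Real.norm_of_nonneg (Real.exp_pos _).le]
      refine mul_le_of_le_one_left (norm_nonneg _) (Real.exp_le_one_iff.2 ?_)
      have : 0 ≤ κ * max t 0 := mul_nonneg hκ.le (le_max_right _ _)
      linarith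
    · exact norm_exp_smul_integral_le hκ (le_max_right _ _) (by positivity)
        fun s hs => hGb w s hs.1
  let Φ : BoundedContinuousFunction ℝ E → BoundedContinuousFunction ℝ E := fun w =>
    BoundedContinuousFunction.ofNormedAddCommGroup (Ψ w) (hΨc w) _ (hΨb w)
  have hΦ : ContractingWith (1 / 2) Φ := by
    refine ⟨by rw [← NNReal.coe_lt_coe]; norm_num, LipschitzWith.of_dist_le_mul fun w w' => ?_⟩
    refine (BoundedContinuousFunction.dist_le (by positivity)).2 fun t => ?_
    have e : Ψ w t - Ψ w' t
        = Real.exp (-(κ * max t 0)) • ∫ s in (0)..(max t 0), (G w s - G w' s) := by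
      rw [intervalIntegral.integral_sub ((hGc w).intervalIntegrable _ _)
        ((hGc w').intervalIntegrable _ _), smul_sub]
      simp only [Ψ]; abel
    change dist (Ψ w t) (Ψ w' t) ≤ _
    rw [dist_eq_norm, e]
    refine (norm_exp_smul_integral_le (C := L * dist w w') hκ (le_max_right _ _) (by positivity)
      fun s _ => ?_).trans ?_
    · refine (hF.norm_sub_le _ _).trans ?_
      rw [← smul_sub, norm_smul, Real.norm_of_nonneg (Real.exp_pos _).le, ← dist_eq_norm]
      have := BoundedContinuousFunction.dist_coe_le_dist (f := w) (g := w') s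
      have h0 : 0 ≤ (L : ℝ) * Real.exp (κ * s) := by positivity
      nlinarith
    · rw [div_le_iff₀ hκ]
      have : 0 ≤ dist w w' := dist_nonneg
      simp only [κ]; push_cast; nlinarith
  set w := hΦ.fixedPoint Φ
  have hw : Φ w = w := hΦ.fixedPoint_isFixedPt
  -- The solution is read off from the integral without `max`, so its derivative at t = 0 is
  -- two-sided.
  refine ⟨fun t => x₀ + ∫ s in (0)..t, G w s, by simp, fun t ht => ?_⟩
  have hwt : x₀ + ∫ s in (0)..t, G w s = Real.exp (κ * t) • w t := by
    have h1 : Ψ w t = w t := congrArg (fun v : BoundedContinuousFunction ℝ E => v t) hw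
    simp only [Ψ, max_eq_left ht] at h1
    rw [← h1, ← smul_add, smul_smul, ← Real.exp_add]
    simp
  have hd := (intervalIntegral.integral_hasDerivAt_right ((hGc w).intervalIntegrable 0 t)
    ((hGc w).stronglyMeasurableAtFilter _ _) (hGc w).continuousAt).const_add x₀
  simp only [hwt]
  exact hd

end GlobalODE

/-! ### A Gronwall inequality in `L¹` with damping -/

section Gronwall

variable {α : Type*} [MeasurableSpace α] {μ : Measure α}

theorem L1_norm_eq (h : Lp ℝ 1 μ) : ‖h‖ = ∫ x, |h x| ∂μ := by
  simp [L1.norm_eq_integral_norm]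

/-- An upper bound for the right derivative of the L¹ norm along h' = -a h + q. The triangle
inequality alone would yield +∫ a|h|; the sign of the damping survives because |1 - τa| = 1 - τa for
small τ, at each point separately since a may be unbounded. -/
theorem eventually_norm_add_smul_lt {h h' : Lp ℝ 1 μ} {a q : α → ℝ} (ha : ∀ x, 0 ≤ a x)
    (ham : Measurable a) (hah : Integrable (fun x => a x * h x) μ) (hq : Integrable q μ)
    (heq : ∀ᵐ x ∂μ, h' x = -(a x * h x) + q x) {r : ℝ}
    (hr : -(∫ x, a x * |h x| ∂μ) + ∫ x, |q x| ∂μ < r) :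
    ∀ᶠ τ in 𝓝[>] (0 : ℝ), ‖h + τ • h'‖ < ‖h‖ + τ * r := by
  have hh : Integrable (fun x => h x) μ := L1.integrable_coeFn h
  have haa : Integrable (fun x => a x * |h x|) μ := by
    simpa only [abs_mul, abs_of_nonneg (ha _)] using hah.abs
  -- The difference quotient of the damped part: dominated by a|h| for every τ > 0, and equal to
  -- -a|h| once τ a(x) < 1. Dominated convergence does the rest.
  let G : ℝ → α → ℝ := fun τ x => (|1 - τ * a x| - 1) / τ * |h x|
  have hGm : ∀ τ, AEStronglyMeasurable (G τ) μ := fun τ =>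
    (by fun_prop : Measurable fun x => (|1 - τ * a x| - 1) / τ).aestronglyMeasurable.mul
      hh.abs.aestronglyMeasurable
  have hGb : ∀ τ, 0 < τ → ∀ x, ‖G τ x‖ ≤ a x * |h x| := by
    intro τ hτ x
    rw [norm_mul, Real.norm_eq_abs, Real.norm_eq_abs, abs_abs, abs_div, abs_of_pos hτ]
    gcongr
    rw [div_le_iff₀ hτ]
    have := abs_abs_sub_abs_le (1 - τ * a x) 1
    rw [abs_one] at this
    refine this.trans (le_of_eq ?_)
    rw [show 1 - τ * a x - 1 = -(a x * τ) by ring, abs_neg,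
      abs_of_nonneg (mul_nonneg (ha x) hτ.le)]
  have hGi : ∀ τ, 0 < τ → Integrable (G τ) μ := fun τ hτ =>
    haa.mono' (hGm τ) (ae_of_all _ (hGb τ hτ))
  have hlim : Tendsto (fun τ => ∫ x, G τ x ∂μ) (𝓝[>] 0) (𝓝 (∫ x, -(a x * |h x|) ∂μ)) := by
    refine tendsto_integral_filter_of_dominated_convergence (fun x => a x * |h x|)
      (Eventually.of_forall hGm) ?_ haa (ae_of_all _ fun x => ?_)
    · filter_upwards [self_mem_nhdsWithin] with τ hτ using ae_of_all _ (hGb τ hτ)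
    · have h1 : ∀ᶠ τ in 𝓝[>] (0 : ℝ), τ * a x < 1 := by
        have : Tendsto (fun τ : ℝ => τ * a x) (𝓝[>] 0) (𝓝 (0 * a x)) :=
          ((continuous_id.mul continuous_const).tendsto 0).mono_left nhdsWithin_le_nhds
        rw [zero_mul] at this
        exact this.eventually_lt_const zero_lt_one
      refine tendsto_const_nhds.congr' ?_
      filter_upwards [h1, self_mem_nhdsWithin] with τ h1 (hτ : 0 < τ)
      simp only [G]
      rw [abs_of_pos (a := 1 - τ * a x) (by linarith)]
      field_simp
      ring
  rw [integral_neg] at hlim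
  have hev : ∀ᶠ τ in 𝓝[>] (0 : ℝ), (∫ x, G τ x ∂μ) < r - ∫ x, |q x| ∂μ :=
    hlim.eventually_lt_const (by linarith)
  filter_upwards [hev, self_mem_nhdsWithin] with τ h1 (hτ : 0 < τ)
  have hle : ‖h + τ • h'‖ ≤ ∫ x, (|h x| + τ * (G τ x + |q x|)) ∂μ := by
    rw [L1_norm_eq]
    refine integral_mono_ae (L1.integrable_coeFn _).abs
      (hh.abs.add (((hGi τ hτ).add hq.abs).const_mul τ)) ?_
    filter_upwards [heq, Lp.coeFn_add h (τ • h'), Lp.coeFn_smul τ h'] with x e1 e2 e3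
    rw [e2, Pi.add_apply, e3, Pi.smul_apply, e1, smul_eq_mul]
    have e4 : h x + τ * (-(a x * h x) + q x) = (1 - τ * a x) * h x + τ * q x := by ring
    have e5 : τ * G τ x = |1 - τ * a x| * |h x| - |h x| := by
      simp only [G]; field_simp
    rw [e4]
    calc _ ≤ |(1 - τ * a x) * h x| + |τ * q x| := abs_add_le _ _
      _ = |1 - τ * a x| * |h x| + τ * |q x| := by rw [abs_mul, abs_mul, abs_of_pos hτ]
      _ = |h x| + τ * (G τ x + |q x|) := by rw [mul_add, e5]; ring
  have hGq : Integrable (fun x => τ * (G τ x + |q x|)) μ := ((hGi τ hτ).add hq.abs).const_mul τ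
  rw [integral_add hh.abs hGq, integral_const_mul,
    integral_add (hGi τ hτ) hq.abs, ← L1_norm_eq] at hle
  nlinarith

/-- The damping integral enters `hbound` with a minus sign, so it can absorb a part of q that the
norm of u does not control. -/
theorem norm_le_gronwallBound_of_damped {u u' : ℝ → Lp ℝ 1 μ} {a : α → ℝ} {q : ℝ → α → ℝ}
    {T K ε : ℝ} (hu : ContinuousOn u (Icc 0 T)) (hu' : ∀ t ∈ Ioo 0 T, HasDerivAt u (u' t) t)
    (ha : ∀ x, 0 ≤ a x) (ham : Measurable a)
    (hau : ∀ t ∈ Ioo 0 T, Integrable (fun x => a x * u t x) μ)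
    (hq : ∀ t ∈ Ioo 0 T, Integrable (q t) μ)
    (heq : ∀ t ∈ Ioo 0 T, ∀ᵐ x ∂μ, u' t x = -(a x * u t x) + q t x)
    (hbound : ∀ t ∈ Ioo 0 T,
      -(∫ x, a x * |u t x| ∂μ) + ∫ x, |q t x| ∂μ ≤ K * ‖u t‖ + ε) :
    ∀ t ∈ Icc 0 T, ‖u t‖ ≤ gronwallBound ‖u 0‖ K ε t := by
  intro t ht
  rcases ht.1.eq_or_lt with rfl | ht0
  · simp [gronwallBound_x0]
  -- The derivative is available only for positive times, so Gronwall starts at σ > 0 and σ → 0 by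
  -- continuity.
  have step : ∀ σ ∈ Ioo 0 t, ‖u t‖ ≤ gronwallBound ‖u σ‖ K ε (t - σ) := by
    intro σ hσ
    have hsub : Ico σ t ⊆ Ioo 0 T := fun x hx => ⟨hσ.1.trans_le hx.1, hx.2.trans_le ht.2⟩
    refine le_gronwallBound_of_liminf_deriv_right_le (f := fun x => ‖u x‖)
      (f' := fun x => -(∫ y, a y * |u x y| ∂μ) + ∫ y, |q x y| ∂μ)
      (hu.mono fun x hx => ⟨hσ.1.le.trans hx.1, hx.2.trans ht.2⟩).norm ?_ le_rfl
      (fun x hx => hbound x (hsub hx)) t ⟨hσ.2.le, le_rfl⟩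
    intro x hx r hr
    have hx' := hsub hx
    obtain ⟨r', hr1, hr2⟩ := exists_between hr
    have hev := eventually_norm_add_smul_lt ha ham (hau x hx') (hq x hx') (heq x hx') hr1
    have hsh : Tendsto (fun z : ℝ => z - x) (𝓝[>] x) (𝓝[>] 0) := by
      refine tendsto_nhdsWithin_iff.2 ⟨?_, ?_⟩
      · have : Tendsto (fun z : ℝ => z - x) (𝓝 x) (𝓝 (x - x)) :=
          (continuous_id.sub continuous_const).tendsto x
        rw [sub_self] at this
        exact this.mono_left nhdsWithin_le_nhds
      · filter_upwards [self_mem_nhdsWithin] with z (hz : x < z) using sub_pos.2 hz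
    have hev' := hsh.eventually hev
    have hlo := (hasDerivAt_iff_isLittleO.1 (hu' x hx')).def (sub_pos.2 hr2)
    refine Eventually.frequently ?_
    filter_upwards [hev', hlo.filter_mono nhdsWithin_le_nhds, self_mem_nhdsWithin]
      with z h1 h2 (hz : x < z)
    have hz0 : 0 < z - x := sub_pos.2 hz
    rw [inv_mul_lt_iff₀ hz0]
    rw [Real.norm_of_nonneg hz0.le] at h2
    have h3 : ‖u z‖ ≤ ‖u z - u x - (z - x) • u' x‖ + ‖u x + (z - x) • u' x‖ := by
      refine le_of_eq_of_le ?_ (norm_add_le _ _)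
      congr 1; abel
    nlinarith
  have hc : ContinuousWithinAt u (Ioo 0 t) 0 :=
    (hu 0 ⟨le_rfl, ht0.le.trans ht.2⟩).mono fun x hx => ⟨hx.1.le, hx.2.le.trans ht.2⟩
  have hne : (𝓝[Ioo 0 t] (0 : ℝ)).NeBot := left_nhdsWithin_Ioo_neBot ht0
  have hg : Continuous fun x : ℝ × ℝ => gronwallBound x.1 K ε x.2 := by
    by_cases hK : K = 0
    · simp only [hK, gronwallBound_K0]; fun_prop
    · simp only [gronwallBound_of_K_ne_0 hK]; fun_prop
  have hid : Tendsto (fun σ : ℝ => t - σ) (𝓝[Ioo 0 t] 0) (𝓝 (t - 0)) :=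
    ((continuous_const.sub continuous_id).tendsto 0).mono_left nhdsWithin_le_nhds
  have hlim : Tendsto (fun σ => gronwallBound ‖u σ‖ K ε (t - σ)) (𝓝[Ioo 0 t] 0)
      (𝓝 (gronwallBound ‖u 0‖ K ε (t - 0))) :=
    (hg.tendsto (‖u 0‖, t - 0)).comp (hc.norm.tendsto.prodMk_nhds hid)
  rw [sub_zero] at hlim
  exact ge_of_tendsto hlim (by filter_upwards [self_mem_nhdsWithin] with σ hσ using step σ hσ)

end Gronwall

/-! ### The weighted spaces -/

section Spaces

variable {d : ℕ} {lam1 lam2 : ℝ}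

local notation "X" => EuclideanSpace ℝ (Fin d)

theorem ae_weighted (h1 : 0 < lam1) (h2 : 0 < lam2) (s : ℝ) {p : X → Prop} :
    (∀ᵐ k ∂weightedMeasure d lam1 lam2 s, p k) ↔ ∀ᵐ k, p k := by
  have hm := (continuous_weight h1 h2 s (d := d)).measurable.ennreal_ofReal
  rw [weightedMeasure, ae_withDensity_iff hm]
  have : ∀ k : X, ENNReal.ofReal (omega lam1 lam2 k ^ s) ≠ 0 := fun k => by
    simpa using weight_pos h1 h2 s k
  simp [this]

theorem integrable_weighted (h1 : 0 < lam1) (h2 : 0 < lam2) (s : ℝ) {f : X → ℝ} :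
    Integrable f (weightedMeasure d lam1 lam2 s)
      ↔ Integrable fun k => weight lam1 lam2 s k * f k := by
  have hm := (continuous_weight h1 h2 s (d := d)).measurable
  rw [weightedMeasure, integrable_withDensity_iff_integrable_smul' hm.ennreal_ofReal (by simp)]
  refine integrable_congr (ae_of_all _ fun k => ?_)
  simp only [smul_eq_mul]
  rw [ENNReal.toReal_ofReal (weight_pos h1 h2 s k).le]

theorem integral_weighted (h1 : 0 < lam1) (h2 : 0 < lam2) (s : ℝ) (f : X → ℝ) :
    ∫ k, f k ∂weightedMeasure d lam1 lam2 s = ∫ k, weight lam1 lam2 s k * f k := by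
  have hm := (continuous_weight h1 h2 s (d := d)).measurable
  rw [weightedMeasure, integral_withDensity_eq_integral_toReal_smul hm.ennreal_ofReal (by simp)]
  refine integral_congr_ae (ae_of_all _ fun k => ?_)
  simp only [smul_eq_mul]
  rw [ENNReal.toReal_ofReal (weight_pos h1 h2 s k).le]

theorem measurable_coeFn {s : ℝ} (u : WeightedL1 d lam1 lam2 s) : Measurable u :=
  (Lp.stronglyMeasurable u).measurable

theorem integrable_coeFn (h1 : 0 < lam1) (h2 : 0 < lam2) {s : ℝ} (u : WeightedL1 d lam1 lam2 s) :
    Integrable fun k => weight lam1 lam2 s k * u k :=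
  (integrable_weighted h1 h2 s).1 (L1.integrable_coeFn u)

theorem norm_eq_absInt (h1 : 0 < lam1) (h2 : 0 < lam2) {s : ℝ} (u : WeightedL1 d lam1 lam2 s) :
    ‖u‖ = absInt (weight lam1 lam2 s) u := by
  rw [L1_norm_eq, integral_weighted h1 h2, absInt]

theorem absInt_congr {w f g : X → ℝ} (h : f =ᵐ[volume] g) : absInt w f = absInt w g :=
  integral_congr_ae (h.mono fun k hk => by simp only [hk])

theorem ae_of_ae_weighted (h1 : 0 < lam1) (h2 : 0 < lam2) {s : ℝ} {f g : X → ℝ}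
    (h : f =ᵐ[weightedMeasure d lam1 lam2 s] g) : f =ᵐ[volume] g :=
  (ae_weighted h1 h2 s).1 h

theorem coeFn_sub_ae (h1 : 0 < lam1) (h2 : 0 < lam2) {s : ℝ} (u v : WeightedL1 d lam1 lam2 s) :
    ⇑(u - v) =ᵐ[volume] ⇑u - ⇑v :=
  ae_of_ae_weighted h1 h2 (Lp.coeFn_sub u v)

theorem ext_ae (h1 : 0 < lam1) (h2 : 0 < lam2) {s : ℝ} {u v : WeightedL1 d lam1 lam2 s}
    (h : u =ᵐ[volume] v) : u = v :=
  Lp.ext ((ae_weighted h1 h2 s).2 h)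

/-- The element of `L¹_s` given by an integrable function. -/
def ofFun (h1 : 0 < lam1) (h2 : 0 < lam2) {s : ℝ} (f : X → ℝ)
    (hf : Integrable fun k => weight lam1 lam2 s k * f k) : WeightedL1 d lam1 lam2 s :=
  ((integrable_weighted h1 h2 s).2 hf).toL1 f

theorem coeFn_ofFun (h1 : 0 < lam1) (h2 : 0 < lam2) {s : ℝ} {f : X → ℝ}
    (hf : Integrable fun k => weight lam1 lam2 s k * f k) :
    ofFun h1 h2 f hf =ᵐ[volume] f :=
  ae_of_ae_weighted h1 h2 (Integrable.coeFn_toL1 _)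

theorem norm_ofFun (h1 : 0 < lam1) (h2 : 0 < lam2) {s : ℝ} {f : X → ℝ}
    (hf : Integrable fun k => weight lam1 lam2 s k * f k) :
    ‖ofFun h1 h2 f hf‖ = absInt (weight lam1 lam2 s) f := by
  rw [norm_eq_absInt h1 h2, absInt_congr (coeFn_ofFun h1 h2 hf)]

theorem integrable_mul_of_abs_le (h1 : 0 < lam1) (h2 : 0 < lam2) {s s' : ℝ} {w : X → ℝ} {C : ℝ}
    (hw : Measurable w)
    (hC : ∀ k, |w k| * weight lam1 lam2 s' k ≤ C * weight lam1 lam2 s k)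
    (u : WeightedL1 d lam1 lam2 s) :
    Integrable fun k => weight lam1 lam2 s' k * (w k * u k) := by
  have hw' := (continuous_weight h1 h2 s' (d := d)).measurable
  refine ((integrable_coeFn h1 h2 u).abs.const_mul C).mono'
    (hw'.mul (hw.mul (measurable_coeFn u))).aestronglyMeasurable (ae_of_all _ fun k => ?_)
  rw [Real.norm_eq_abs, abs_mul, abs_mul, abs_mul, abs_of_pos (weight_pos h1 h2 s' k),
    abs_of_pos (weight_pos h1 h2 s k), ← mul_assoc, ← mul_assoc,
    mul_comm (weight lam1 lam2 s' k)]
  exact mul_le_mul_of_nonneg_right (hC k) (abs_nonneg _)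

/-- Multiplication by a function `w` with `|w| ω^s' ≤ C ω^s`, as an operator `L¹_s → L¹_s'`. -/
def mulCLM (h1 : 0 < lam1) (h2 : 0 < lam2) {s s' : ℝ} (w : X → ℝ) {C : ℝ} (hw : Measurable w)
    (hC : ∀ k, |w k| * weight lam1 lam2 s' k ≤ C * weight lam1 lam2 s k) :
    WeightedL1 d lam1 lam2 s →L[ℝ] WeightedL1 d lam1 lam2 s' :=
  LinearMap.mkContinuous
    { toFun := fun u => ofFun h1 h2 (fun k => w k * u k) (integrable_mul_of_abs_le h1 h2 hw hC u)
      map_add' := fun u v => by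
        apply ext_ae h1 h2
        filter_upwards [coeFn_ofFun h1 h2 (integrable_mul_of_abs_le h1 h2 hw hC (u + v)),
          coeFn_ofFun h1 h2 (integrable_mul_of_abs_le h1 h2 hw hC u),
          coeFn_ofFun h1 h2 (integrable_mul_of_abs_le h1 h2 hw hC v),
          ae_of_ae_weighted h1 h2 (Lp.coeFn_add u v),
          ae_of_ae_weighted h1 h2 (Lp.coeFn_add
            (ofFun h1 h2 (fun k => w k * u k) (integrable_mul_of_abs_le h1 h2 hw hC u))
            (ofFun h1 h2 (fun k => w k * v k) (integrable_mul_of_abs_le h1 h2 hw hC v)))]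
          with k e1 e2 e3 e4 e5
        rw [e1, e5, Pi.add_apply, e2, e3, e4, Pi.add_apply, mul_add]
      map_smul' := fun r u => by
        apply ext_ae h1 h2
        filter_upwards [coeFn_ofFun h1 h2 (integrable_mul_of_abs_le h1 h2 hw hC (r • u)),
          coeFn_ofFun h1 h2 (integrable_mul_of_abs_le h1 h2 hw hC u),
          ae_of_ae_weighted h1 h2 (Lp.coeFn_smul r u),
          ae_of_ae_weighted h1 h2 (Lp.coeFn_smul r
            (ofFun h1 h2 (fun k => w k * u k) (integrable_mul_of_abs_le h1 h2 hw hC u)))]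
          with k e1 e2 e3 e4
        rw [e1, RingHom.id_apply, e4, Pi.smul_apply, e2, e3, Pi.smul_apply, smul_eq_mul,
          smul_eq_mul, mul_left_comm] }
    C (fun u => by
      change ‖ofFun h1 h2 _ (integrable_mul_of_abs_le h1 h2 hw hC u)‖ ≤ _
      rw [norm_ofFun, norm_eq_absInt h1 h2, absInt, absInt, ← integral_const_mul]
      refine integral_mono (integrable_mul_abs (fun k => (weight_pos h1 h2 s' k).le)
        (integrable_mul_of_abs_le h1 h2 hw hC u))
        ((integrable_mul_abs (fun k => (weight_pos h1 h2 s k).le)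
          (integrable_coeFn h1 h2 u)).const_mul C) fun k => ?_
      simp only [abs_mul]
      rw [← mul_assoc, ← mul_assoc, mul_comm (weight lam1 lam2 s' k)]
      exact mul_le_mul_of_nonneg_right (hC k) (abs_nonneg _))

theorem coeFn_mulCLM (h1 : 0 < lam1) (h2 : 0 < lam2) {s s' : ℝ} {w : X → ℝ} {C : ℝ}
    (hw : Measurable w) (hC : ∀ k, |w k| * weight lam1 lam2 s' k ≤ C * weight lam1 lam2 s k)
    (u : WeightedL1 d lam1 lam2 s) :
    mulCLM h1 h2 w hw hC u =ᵐ[volume] fun k => w k * u k :=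
  coeFn_ofFun h1 h2 (integrable_mul_of_abs_le h1 h2 hw hC u)

theorem weight_zero (k : X) : weight lam1 lam2 0 k = 1 := Real.rpow_zero _

theorem integrable_test (h1 : 0 < lam1) (h2 : 0 < lam2) {s : ℝ} {w : X → ℝ} {C : ℝ}
    (hw : Measurable w) (hC : ∀ k, |w k| ≤ C * weight lam1 lam2 s k)
    (u : WeightedL1 d lam1 lam2 s) : Integrable fun k => w k * u k := by
  simpa [weight_zero] using
    integrable_mul_of_abs_le h1 h2 (s' := 0) hw (by simpa [weight_zero] using hC) u

/-- Integration against a test function `w` with `|w| ≤ C ω^s`. -/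
def testCLM (h1 : 0 < lam1) (h2 : 0 < lam2) {s : ℝ} (w : X → ℝ) {C : ℝ} (hw : Measurable w)
    (hC : ∀ k, |w k| ≤ C * weight lam1 lam2 s k) : WeightedL1 d lam1 lam2 s →L[ℝ] ℝ :=
  LinearMap.mkContinuous
    { toFun := fun u => ∫ k, w k * u k
      map_add' := fun u v => by
        rw [← integral_add (integrable_test h1 h2 hw hC u) (integrable_test h1 h2 hw hC v)]
        refine integral_congr_ae ?_
        filter_upwards [ae_of_ae_weighted h1 h2 (Lp.coeFn_add u v)] with k e
        rw [e, Pi.add_apply, mul_add]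
      map_smul' := fun r u => by
        rw [RingHom.id_apply, smul_eq_mul, ← integral_const_mul]
        refine integral_congr_ae ?_
        filter_upwards [ae_of_ae_weighted h1 h2 (Lp.coeFn_smul r u)] with k e
        rw [e, Pi.smul_apply, smul_eq_mul, mul_left_comm] }
    C (fun u => by
      change ‖∫ k, w k * u k‖ ≤ _
      rw [norm_eq_absInt h1 h2, absInt, ← integral_const_mul]
      refine norm_integral_le_of_norm_le ((integrable_mul_abs
        (fun k => (weight_pos h1 h2 s k).le) (integrable_coeFn h1 h2 u)).const_mul C)
        (ae_of_all _ fun k => ?_)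
      rw [Real.norm_eq_abs, abs_mul, ← mul_assoc]
      exact mul_le_mul_of_nonneg_right (hC k) (abs_nonneg _))

theorem testCLM_apply (h1 : 0 < lam1) (h2 : 0 < lam2) {s : ℝ} {w : X → ℝ} {C : ℝ}
    (hw : Measurable w) (hC : ∀ k, |w k| ≤ C * weight lam1 lam2 s k)
    (u : WeightedL1 d lam1 lam2 s) : testCLM h1 h2 w hw hC u = ∫ k, w k * u k := rfl

/-! ### Comparison of weights -/

theorem weight_le_weight (h1 : 0 < lam1) (h2 : 0 < lam2) {s s' : ℝ} (h : s ≤ s') (k : X) :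
    weight lam1 lam2 s k ≤ √lam1 ^ (s - s') * weight lam1 lam2 s' k := by
  have e : weight lam1 lam2 s k = omega lam1 lam2 k ^ (s - s') * weight lam1 lam2 s' k := by
    rw [weight, weight, ← Real.rpow_add (omega_pos h1 h2 k)]; ring_nf
  rw [e]
  refine mul_le_mul_of_nonneg_right ?_ (weight_pos h1 h2 s' k).le
  exact Real.rpow_le_rpow_of_nonpos (Real.sqrt_pos.2 h1) (sqrt_le_omega h2 k) (by linarith)

theorem one_le_weight (h1 : 0 < lam1) (h2 : 0 < lam2) {s : ℝ} (hs : 0 ≤ s) (k : X) :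
    1 ≤ √lam1 ^ (-s) * weight lam1 lam2 s k := by
  simpa [weight_zero] using weight_le_weight h1 h2 hs k

theorem norm_mul_weight_le (h1 : 0 < lam1) (h2 : 0 < lam2) (s : ℝ) (k : X) :
    ‖k‖ * weight lam1 lam2 s k ≤ (√lam2)⁻¹ * weight lam1 lam2 (s + 1) k := by
  have e : weight lam1 lam2 (s + 1) k = weight lam1 lam2 s k * omega lam1 lam2 k := by
    rw [weight, Real.rpow_add (omega_pos h1 h2 k), Real.rpow_one]
  have := mul_le_mul_of_nonneg_right (norm_le_omega h1 h2 k) (weight_pos h1 h2 s k).le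
  rw [e]; rw [div_eq_mul_inv] at this; linarith

theorem norm_sq_mul_weight_le (h1 : 0 < lam1) (h2 : 0 < lam2) (s : ℝ) (k : X) :
    ‖k‖ ^ 2 * weight lam1 lam2 s k ≤ lam2⁻¹ * weight lam1 lam2 (s + 2) k := by
  have e : weight lam1 lam2 (s + 2) k = weight lam1 lam2 s k * omega lam1 lam2 k ^ 2 := by
    rw [weight, Real.rpow_add (omega_pos h1 h2 k), Real.rpow_two]
  have := mul_le_mul_of_nonneg_right (norm_sq_le_omega_sq h1 h2 k) (weight_pos h1 h2 s k).le
  rw [e]; rw [div_eq_mul_inv] at this; linarith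

theorem exists_weight_bound (h1 : 0 < lam1) (h2 : 0 < lam2) {s : ℝ} (hs : 0 ≤ s) :
    ∃ C : ℝ, 0 < C ∧ ∀ k : X, 1 ≤ C * weight lam1 lam2 s k ∧
      ‖k‖ ≤ C * (‖k‖ * weight lam1 lam2 s k) ∧
      weight lam1 lam2 s k ≤ C * weight lam1 lam2 (s + 1) k ∧
      ‖k‖ * weight lam1 lam2 s k ≤ C * weight lam1 lam2 (s + 1) k := by
  have hq := Real.sqrt_pos.2 h1
  have hq2 := Real.sqrt_pos.2 h2
  refine ⟨√lam1 ^ (-s) + √lam1 ^ (s - (s + 1)) + (√lam2)⁻¹, by positivity, fun k => ?_⟩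
  have p1 := weight_pos h1 h2 s k
  have p2 := weight_pos h1 h2 (s + 1) k
  have a1 : (0 : ℝ) < √lam1 ^ (-s) := by positivity
  have a2 : (0 : ℝ) < √lam1 ^ (s - (s + 1)) := by positivity
  have a3 : (0 : ℝ) < (√lam2)⁻¹ := by positivity
  have i1 := one_le_weight h1 h2 hs k
  have i2 := weight_le_weight h1 h2 (show s ≤ s + 1 by linarith) k
  have i3 := norm_mul_weight_le h1 h2 s k
  have i0 : 1 ≤ (√lam1 ^ (-s) + √lam1 ^ (s - (s + 1)) + (√lam2)⁻¹) * weight lam1 lam2 s k := by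
    have := mul_pos a2 p1; have := mul_pos a3 p1; linarith
  refine ⟨i0, ?_, ?_, ?_⟩
  · have := mul_le_mul_of_nonneg_left i0 (norm_nonneg k)
    linarith
  · have := mul_pos a1 p2; have := mul_pos a3 p2; linarith
  · have := mul_pos a1 p2; have := mul_pos a2 p2; linarith

theorem absInt_le_mul {w w' f : X → ℝ} {C : ℝ} (hw : ∀ k, 0 ≤ w k)
    (h : ∀ k, w k ≤ C * w' k) (hf : Integrable fun k => w' k * f k) :
    absInt w f ≤ C * absInt w' f := by
  rw [← absInt_const_mul]
  exact absInt_mono hw h (by simpa only [mul_assoc] using hf.const_mul C)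

theorem integrable_of_le_mul {w w' f : X → ℝ} {C : ℝ} (hw : ∀ k, 0 ≤ w k)
    (h : ∀ k, w k ≤ C * w' k) (hm : Measurable w) (hfm : Measurable f)
    (hf : Integrable fun k => w' k * f k) : Integrable fun k => w k * f k :=
  integrable_of_weight_le hw h hm hfm (by simpa only [mul_assoc] using hf.const_mul C)

theorem Moments.of_int (h1 : 0 < lam1) (h2 : 0 < lam2) {s : ℝ} (hs : 0 ≤ s) {f : X → ℝ}
    (hm : Measurable f) (hW : Integrable fun k => weight lam1 lam2 s k * f k)
    (hKW : Integrable fun k => ‖k‖ * weight lam1 lam2 s k * f k) : Moments lam1 lam2 s f := by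
  obtain ⟨C, -, hC⟩ := exists_weight_bound (d := d) h1 h2 hs
  refine ⟨hm, ?_, ?_, hW, hKW⟩
  · simpa using integrable_of_le_mul (w := fun _ => 1) (fun _ => zero_le_one) (fun k => (hC k).1)
      measurable_const hm hW
  · exact integrable_of_le_mul (fun k => norm_nonneg k) (fun k => (hC k).2.1) measurable_norm hm
      hKW

theorem Moments.of_succ (h1 : 0 < lam1) (h2 : 0 < lam2) {s : ℝ} (hs : 0 ≤ s) {f : X → ℝ}
    (hm : Measurable f) (hW : Integrable fun k => weight lam1 lam2 (s + 1) k * f k) :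
    Moments lam1 lam2 s f := by
  obtain ⟨C, -, hC⟩ := exists_weight_bound (d := d) h1 h2 hs
  have hw := (continuous_weight h1 h2 s (d := d)).measurable
  refine Moments.of_int h1 h2 hs hm ?_ ?_
  · exact integrable_of_le_mul (fun k => (weight_pos h1 h2 s k).le) (fun k => (hC k).2.2.1) hw hm hW
  · exact integrable_of_le_mul (fun k => mul_nonneg (norm_nonneg _) (weight_pos h1 h2 s k).le)
      (fun k => (hC k).2.2.2) (by fun_prop) hm hW

theorem Moments.of_le (h1 : 0 < lam1) (h2 : 0 < lam2) {s s' : ℝ} (hs : 0 ≤ s) (h : s + 1 ≤ s')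
    {f : X → ℝ} (hm : Measurable f) (hW : Integrable fun k => weight lam1 lam2 s' k * f k) :
    Moments lam1 lam2 s f :=
  Moments.of_succ h1 h2 hs hm (integrable_of_le_mul (fun k => (weight_pos h1 h2 _ k).le)
    (fun k => weight_le_weight h1 h2 h k) (continuous_weight h1 h2 _).measurable hm hW)

theorem Moments.congr {s : ℝ} {f g : X → ℝ} (hf : Moments lam1 lam2 s f) (hg : Measurable g)
    (h : f =ᵐ[volume] g) : Moments lam1 lam2 s g where
  meas := hg
  int := hf.int.congr h
  intNorm := hf.intNorm.congr (h.mono fun k hk => by simp only [hk])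
  intWeight := hf.intWeight.congr (h.mono fun k hk => by simp only [hk])
  intNormWeight := hf.intNormWeight.congr (h.mono fun k hk => by simp only [hk])

end Spaces

/-! ### Differential inequalities for damped equations -/

section Damped

variable {d : ℕ} {lam1 lam2 : ℝ}

local notation "X" => EuclideanSpace ℝ (Fin d)

/-- The viscous term pays for the power of |k| lost by the collisions: C|k| ≤ 2ν|k|² + C²/(8ν),
hence the term C²/(8ν) in the rate. -/
theorem gronwall_weighted (h1 : 0 < lam1) (h2 : 0 < lam2) {nu s : ℝ} (hnu : 0 < nu)
    {u u' : ℝ → WeightedL1 d lam1 lam2 s} {q : ℝ → X → ℝ} {T C K ε : ℝ}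
    (hu : ContinuousOn u (Icc 0 T)) (hu' : ∀ t ∈ Ioo 0 T, HasDerivAt u (u' t) t)
    (hmom : ∀ t ∈ Ioo 0 T, Integrable fun k => ‖k‖ ^ 2 * weight lam1 lam2 s k * u t k)
    (hq : ∀ t ∈ Ioo 0 T, Integrable fun k => weight lam1 lam2 s k * q t k)
    (heq : ∀ t ∈ Ioo 0 T, ∀ᵐ k, u' t k = -(2 * nu * ‖k‖ ^ 2 * u t k) + q t k)
    (hbound : ∀ t ∈ Ioo 0 T, absInt (weight lam1 lam2 s) (q t)
      ≤ C * momKW lam1 lam2 s (u t) + K * ‖u t‖ + ε) :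
    ∀ t ∈ Icc 0 T, ‖u t‖ ≤ gronwallBound ‖u 0‖ (C ^ 2 / (8 * nu) + K) ε t := by
  have hw := (continuous_weight h1 h2 s (d := d)).measurable
  refine norm_le_gronwallBound_of_damped (a := fun k => 2 * nu * ‖k‖ ^ 2) (q := q) hu hu'
    (fun k => by positivity) (by fun_prop) (fun t ht => ?_) (fun t ht => ?_) (fun t ht => ?_)
    (fun t ht => ?_)
  · rw [integrable_weighted h1 h2]
    refine ((hmom t ht).const_mul (2 * nu)).congr (ae_of_all _ fun k => ?_)
    simp only; ring
  · exact (integrable_weighted h1 h2 s).2 (hq t ht)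
  · exact (ae_weighted h1 h2 s).2 (heq t ht)
  · rw [integral_weighted h1 h2, integral_weighted h1 h2]
    have hb := hbound t ht
    rw [absInt] at hb
    have pw : ∀ k : X, 0 < weight lam1 lam2 s k := weight_pos h1 h2 s
    have hmom' : Integrable fun k => ‖k‖ ^ 2 * weight lam1 lam2 s k * |u t k| :=
      integrable_mul_abs (fun k => by have := pw k; positivity) (hmom t ht)
    have hW : Integrable fun k => weight lam1 lam2 s k * |u t k| :=
      integrable_mul_abs (fun k => (pw k).le) (integrable_coeFn h1 h2 (u t))
    have hKW : Integrable fun k => ‖k‖ * weight lam1 lam2 s k * |u t k| := by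
      refine (hmom'.add hW).mono' (Measurable.aestronglyMeasurable ?_) (ae_of_all _ fun k => ?_)
      · have := measurable_coeFn (u t)
        simp only [← Real.norm_eq_abs]; fun_prop
      · have := pw k
        rw [Real.norm_of_nonneg (by positivity)]
        have : 0 ≤ weight lam1 lam2 s k * |u t k| := by positivity
        simp only [Pi.add_apply]
        nlinarith [sq_nonneg (‖k‖ - 1), norm_nonneg k]
    have key : C * momKW lam1 lam2 s (u t)
        ≤ 2 * nu * (∫ k, ‖k‖ ^ 2 * weight lam1 lam2 s k * |u t k|)
          + C ^ 2 / (8 * nu) * ‖u t‖ := by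
      rw [norm_eq_absInt h1 h2]
      simp only [momKW, absInt]
      rw [← integral_const_mul, ← integral_const_mul, ← integral_const_mul, ← integral_add
        (hmom'.const_mul _) (hW.const_mul _)]
      refine integral_mono (hKW.const_mul _) ((hmom'.const_mul _).add (hW.const_mul _))
        fun k => ?_
      -- Completing the square; 8ν is four times the damping coefficient 2ν.
      have hk : C * ‖k‖ ≤ 2 * nu * ‖k‖ ^ 2 + C ^ 2 / (8 * nu) := by
        have e : 2 * nu * ‖k‖ ^ 2 + C ^ 2 / (8 * nu) - C * ‖k‖
            = (4 * nu * ‖k‖ - C) ^ 2 / (8 * nu) := by field_simp; ring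
        have : 0 ≤ (4 * nu * ‖k‖ - C) ^ 2 / (8 * nu) := by positivity
        linarith
      have : 0 ≤ weight lam1 lam2 s k * |u t k| := by have := pw k; positivity
      simp only
      nlinarith
    have e1 : ∫ k, weight lam1 lam2 s k * (2 * nu * ‖k‖ ^ 2 * |u t k|)
        = 2 * nu * ∫ k, ‖k‖ ^ 2 * weight lam1 lam2 s k * |u t k| := by
      rw [← integral_const_mul]
      exact integral_congr_ae (ae_of_all _ fun k => by simp only; ring)
    rw [e1]
    linarith

theorem absInt_add_le {w f g : X → ℝ} (hw : ∀ k, 0 ≤ w k) (hf : Integrable fun k => w k * f k)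
    (hg : Integrable fun k => w k * g k) : absInt w (f + g) ≤ absInt w f + absInt w g := by
  rw [absInt, absInt, absInt, ← integral_add (integrable_mul_abs hw hf) (integrable_mul_abs hw hg)]
  refine integral_mono (integrable_mul_abs hw ?_)
    ((integrable_mul_abs hw hf).add (integrable_mul_abs hw hg)) fun k => ?_
  · simpa only [Pi.add_apply, mul_add] using! hf.add hg
  · simp only [Pi.add_apply, ← mul_add]
    exact mul_le_mul_of_nonneg_left (abs_add_le _ _) (hw k)

theorem abs_integral_sub_le {f g : X → ℝ} (hf : Integrable f) (hg : Integrable g) :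
    |(∫ k, g k) - ∫ k, f k| ≤ mom0 (g - f) := by
  rw [← integral_sub hg hf]
  simpa [mom0, absInt] using abs_integral_le_integral_abs (f := fun k => g k - f k)

/-- Local Lipschitz estimate of the collision operator, with loss of one power of `|k|`, uniformly
over masses bounded below and over bounded sets. -/
theorem exists_polColl_sub_le (h1 : 0 < lam1) (h2 : 0 < lam2) {s δ M : ℝ} (c : ℝ) (hs : 0 ≤ s)
    (hδ : 0 < δ) (hM : 0 ≤ M) :
    ∃ C : ℝ, 0 ≤ C ∧ ∀ (f g : X → ℝ) (b b' : X → X → ℝ) (ζ : ℝ), 0 ≤ ζ →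
      Moments lam1 lam2 s f → Moments lam1 lam2 s g →
      (Integrable fun k => weight lam1 lam2 (s + 1) k * f k) →
      momW lam1 lam2 s g ≤ M → momW lam1 lam2 (s + 1) f ≤ M →
      Measurable (Function.uncurry b) → Measurable (Function.uncurry b') →
      (∀ p q x, InTriad p q x → |b p q| ≤ c ^ 2 / (2 * δ) * ‖x‖) →
      (∀ p q x, InTriad p q x → |b' p q| ≤ c ^ 2 / (2 * δ) * ‖x‖) →
      (∀ p q x y, IsPair p q x y → |b p q - b' p q|
        ≤ ‖x‖ * (c ^ 2 / (2 * δ ^ 2) * |(∫ k, g k) - ∫ k, f k| + ζ * ‖y‖)) →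
      (Integrable fun k => weight lam1 lam2 s k * (polColl b g g k - polColl b' f f k)) ∧
      absInt (weight lam1 lam2 s) (fun k => polColl b g g k - polColl b' f f k)
        ≤ C * (momKW lam1 lam2 s (g - f) + momW lam1 lam2 s (g - f) + ζ) := by
  obtain ⟨a, ha, hA⟩ := exists_weight_bound (d := d) h1 h2 hs
  -- D1 comes from the difference of the functions under one kernel, D2 from the difference of the
  -- masses in the two kernels, D3 from the residual kernel error ζ.
  set D1 := 18 * 2 ^ s * (c ^ 2 / (2 * δ)) * (2 * (a * (M + a * M)))
  set D2 := 36 * 2 ^ s * (a * M) * (c ^ 2 / (2 * δ ^ 2) * a * (a * (a * M)))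
  set D3 := 36 * 2 ^ s * (a * M) * (a * (a * M))
  have pD1 : 0 ≤ D1 := by positivity
  have pD2 : 0 ≤ D2 := by positivity
  have pD3 : 0 ≤ D3 := by positivity
  refine ⟨D1 + D2 + D3, by positivity, ?_⟩
  -- The roles of f and g are not symmetric. The difference of kernels acts on f alone, which
  -- therefore needs a bound of order s + 1; g enters only through g + f and g - f, so a bound in
  -- L¹_s suffices for it. Uniqueness relies on this.
  intro f g b b' ζ hζ hf hg hfs gM fM hbm hbm' hb hb' hbb
  have pw : ∀ k : X, 0 ≤ weight lam1 lam2 s k := fun k => (weight_pos h1 h2 s k).le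
  have pkw : ∀ k : X, 0 ≤ ‖k‖ * weight lam1 lam2 s k := fun k => mul_nonneg (norm_nonneg _) (pw k)
  have hh := hg.sub hf
  have hS := hg.add hf
  obtain ⟨E1, E2⟩ := polColl_sub_estimate h1 h2 hs (β := c ^ 2 / (2 * δ)) (β' := c ^ 2 / (2 * δ))
    (by positivity) (by positivity) (by positivity) hζ hbm hbm' hb hb' hbb hf hg
  refine ⟨E1, E2.trans ?_⟩
  have b0 : ∀ F, Moments lam1 lam2 s F → mom0 F ≤ a * momW lam1 lam2 s F := fun F hF =>
    absInt_le_mul (fun _ => zero_le_one) (fun k => (hA k).1) hF.intWeight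
  have b1 : ∀ F, Moments lam1 lam2 s F → mom1 F ≤ a * momKW lam1 lam2 s F := fun F hF =>
    absInt_le_mul (fun k => norm_nonneg k) (fun k => (hA k).2.1) hF.intNormWeight
  have fW : momW lam1 lam2 s f ≤ a * M :=
    (absInt_le_mul pw (fun k => (hA k).2.2.1) hfs).trans (by gcongr)
  have fKW : momKW lam1 lam2 s f ≤ a * M :=
    (absInt_le_mul pkw (fun k => (hA k).2.2.2) hfs).trans (by gcongr)
  have f0 : mom0 f ≤ a * (a * M) := (b0 f hf).trans (by gcongr)
  have f1 : mom1 f ≤ a * (a * M) := (b1 f hf).trans (by gcongr)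
  have SW : momW lam1 lam2 s (g + f) ≤ M + a * M :=
    (absInt_add_le pw hg.intWeight hf.intWeight).trans (by gcongr)
  have S0 : mom0 (g + f) ≤ a * (M + a * M) := (b0 _ hS).trans (by gcongr)
  have nKW : 0 ≤ momKW lam1 lam2 s (g - f) := absInt_nonneg pkw _
  have nW : 0 ≤ momW lam1 lam2 s (g - f) := absInt_nonneg pw _
  have n1 : 0 ≤ mom1 (g - f) := absInt_nonneg (fun _ => norm_nonneg _) _
  have dm : |(∫ k, g k) - ∫ k, f k| ≤ a * momW lam1 lam2 s (g - f) :=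
    (abs_integral_sub_le hf.int hg.int).trans (b0 _ hh)
  have n0f : 0 ≤ mom0 f := absInt_nonneg (fun _ => zero_le_one) _
  have n1f : 0 ≤ mom1 f := absInt_nonneg (fun _ => norm_nonneg _) _
  have nWS : 0 ≤ momW lam1 lam2 s (g + f) := absInt_nonneg pw _
  have nKf : 0 ≤ momKW lam1 lam2 s f := absInt_nonneg pkw _
  have T1 : 18 * 2 ^ s * (c ^ 2 / (2 * δ)) * (momKW lam1 lam2 s (g - f) * mom0 (g + f)
        + mom1 (g - f) * momW lam1 lam2 s (g + f)) ≤ D1 * momKW lam1 lam2 s (g - f) := by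
    calc _ ≤ 18 * 2 ^ s * (c ^ 2 / (2 * δ)) * (momKW lam1 lam2 s (g - f) * (a * (M + a * M))
        + (a * momKW lam1 lam2 s (g - f)) * (M + a * M)) := by
          gcongr
          exact b1 _ hh
      _ = _ := by simp only [D1]; ring
  have T2 : 36 * 2 ^ s * momKW lam1 lam2 s f
      * (c ^ 2 / (2 * δ ^ 2) * |(∫ k, g k) - ∫ k, f k| * mom0 f + ζ * mom1 f)
      ≤ D2 * momW lam1 lam2 s (g - f) + D3 * ζ := by
    calc _ ≤ 36 * 2 ^ s * (a * M) * (c ^ 2 / (2 * δ ^ 2) * (a * momW lam1 lam2 s (g - f))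
        * (a * (a * M)) + ζ * (a * (a * M))) := by gcongr
      _ = _ := by simp only [D2, D3]; ring
  have := mul_nonneg pD1 nW
  have := mul_nonneg pD1 hζ
  have := mul_nonneg pD2 nKW
  have := mul_nonneg pD2 hζ
  have := mul_nonneg pD3 nKW
  have := mul_nonneg pD3 nW
  linarith

/-! ### Bounds of the kernels at masses bounded below -/

theorem kern_abs_le {c m δ : ℝ} (hδ : 0 < δ) (hm : δ ≤ m) (p q x : X) (hx : InTriad p q x) :
    |kern c lam1 lam2 m p q| ≤ c ^ 2 / (2 * δ) * ‖x‖ := by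
  have hm0 : 0 ≤ m := hδ.le.trans hm
  have hk := kern_nonneg (c := c) (lam1 := lam1) (lam2 := lam2) hm0 p q
  rw [abs_of_nonneg hk]
  have h := mass_mul_kern_le (c := c) (lam1 := lam1) (lam2 := lam2) hm0 hx
  have h' : δ * kern c lam1 lam2 m p q ≤ c ^ 2 / 2 * ‖x‖ :=
    (mul_le_mul_of_nonneg_right hm hk).trans h
  rw [show c ^ 2 / (2 * δ) * ‖x‖ = c ^ 2 / 2 * ‖x‖ / δ by field_simp, le_div_iff₀ hδ]
  linarith

theorem kern_abs_sub_le {c m m' δ : ℝ} (hδ : 0 < δ) (hm : δ ≤ m) (hm' : δ ≤ m') (p q x : X)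
    (hx : InTriad p q x) :
    |kern c lam1 lam2 m p q - kern c lam1 lam2 m' p q|
      ≤ c ^ 2 / (2 * δ ^ 2) * |m - m'| * ‖x‖ := by
  have h := mass_mul_mass_mul_abs_kern_sub_le (c := c) (lam1 := lam1) (lam2 := lam2)
    (hδ.le.trans hm) (hδ.le.trans hm') hx
  have hm0 : 0 ≤ m := hδ.le.trans hm
  have h' : δ * δ * |kern c lam1 lam2 m p q - kern c lam1 lam2 m' p q|
      ≤ c ^ 2 / 2 * |m - m'| * ‖x‖ := by
    refine le_trans ?_ h
    gcongr
  rw [show c ^ 2 / (2 * δ ^ 2) * |m - m'| * ‖x‖ = c ^ 2 / 2 * |m - m'| * ‖x‖ / (δ * δ) by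
    field_simp, le_div_iff₀ (by positivity)]
  linarith

theorem truncKern_nonneg {c n m : ℝ} (hm : 0 ≤ m) (p q : X) :
    0 ≤ truncKern c lam1 lam2 n m p q := by
  unfold truncKern; split_ifs
  · exact kern_nonneg hm p q
  · exact le_rfl

theorem truncKern_le_kern {c n m : ℝ} (hm : 0 ≤ m) (p q : X) :
    truncKern c lam1 lam2 n m p q ≤ kern c lam1 lam2 m p q := by
  unfold truncKern; split_ifs
  · exact le_rfl
  · exact kern_nonneg hm p q

theorem truncKern_abs_le {c n m δ : ℝ} (hδ : 0 < δ) (hm : δ ≤ m) (p q x : X)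
    (hx : InTriad p q x) : |truncKern c lam1 lam2 n m p q| ≤ c ^ 2 / (2 * δ) * ‖x‖ := by
  have hm0 : 0 ≤ m := hδ.le.trans hm
  rw [abs_of_nonneg (truncKern_nonneg hm0 p q)]
  exact (truncKern_le_kern hm0 p q).trans ((le_abs_self _).trans (kern_abs_le hδ hm p q x hx))

/-- By the triangle inequality no member of a triad exceeds the sum of the other two. A triad
discarded by the truncation thus has a large vector in every pair, which converts the truncation
error into a factor 1/n at the cost of one more norm. -/
theorem IsPair.le_max {n : ℝ} {p q x y : X} (h : IsPair p q x y)
    (hn : n < max (max ‖p‖ ‖q‖) ‖p + q‖) : n / 2 ≤ ‖x‖ ∨ n / 2 ≤ ‖y‖ := by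
  have n1 : ‖p + q‖ ≤ ‖p‖ + ‖q‖ := norm_add_le p q
  have n2 : ‖p‖ ≤ ‖p + q‖ + ‖q‖ := by simpa using norm_sub_le (p + q) q
  have n3 : ‖q‖ ≤ ‖p + q‖ + ‖p‖ := by simpa using norm_sub_le (p + q) p
  have := norm_nonneg p
  have := norm_nonneg q
  have := norm_nonneg (p + q)
  by_contra! hc
  rw [lt_max_iff, lt_max_iff] at hn
  rcases h with ⟨rfl, rfl⟩ | ⟨rfl, rfl⟩ | ⟨rfl, rfl⟩ | ⟨rfl, rfl⟩ | ⟨rfl, rfl⟩ | ⟨rfl, rfl⟩ <;>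
    rcases hn with (hn | hn) | hn <;> linarith [hc.1, hc.2]

/-- The truncated kernel approximates every kernel that agrees with `kern` on the ball. -/
theorem abs_sub_truncKern_le {c m m' δ n : ℝ} (hδ : 0 < δ) (hm : δ ≤ m) (hm' : δ ≤ m')
    (hn : 0 < n) {b : X → X → ℝ}
    (hb : ∀ p q x, InTriad p q x → |b p q| ≤ c ^ 2 / (2 * δ) * ‖x‖)
    (hbk : ∀ p q, max (max ‖p‖ ‖q‖) ‖p + q‖ ≤ n → b p q = kern c lam1 lam2 m p q)
    (p q x y : X) (hxy : IsPair p q x y) :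
    |b p q - truncKern c lam1 lam2 n m' p q|
      ≤ ‖x‖ * (c ^ 2 / (2 * δ ^ 2) * |m - m'| + c ^ 2 / (δ * n) * ‖y‖) := by
  rcases le_or_gt (max (max ‖p‖ ‖q‖) ‖p + q‖) n with h | h
  · rw [hbk p q h, truncKern_of_le h]
    have := kern_abs_sub_le (c := c) (lam1 := lam1) (lam2 := lam2) hδ hm hm' p q x hxy.fst
    have : 0 ≤ ‖x‖ * (c ^ 2 / (δ * n) * ‖y‖) := by positivity
    linarith
  · rw [truncKern_of_lt h, sub_zero]
    have e : ∀ r z : ℝ, 0 ≤ r → n / 2 ≤ z →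
        c ^ 2 / (2 * δ) * r ≤ c ^ 2 / (δ * n) * (r * z) := by
      intro r z hr hz
      calc c ^ 2 / (2 * δ) * r = c ^ 2 / (δ * n) * (r * (n / 2)) := by field_simp
        _ ≤ _ := by gcongr
    have h0 : 0 ≤ ‖x‖ * (c ^ 2 / (2 * δ ^ 2) * |m - m'|) := by positivity
    -- The kernel is bounded by the norm of one vector of the pair, chosen so that the other one is
    -- at least n/2.
    rcases hxy.le_max h with hx | hy
    · have := hb p q y hxy.symm.fst
      have := e ‖y‖ ‖x‖ (norm_nonneg _) hx
      linarith
    · have := hb p q x hxy.fst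
      have := e ‖x‖ ‖y‖ (norm_nonneg _) hy
      linarith

/-! ### Lower bounds -/

/-- F need not be integrable: its Bochner integral is then 0, which the sign of ∫ G covers. Lower
bounds of the collision operator are thus obtained before its convergence is known. -/
theorem integral_le_of_ae_le {F G : X → ℝ} (h : F ≤ᵐ[volume] G) (hG : Integrable G)
    (h0 : 0 ≤ ∫ k, G k) : ∫ k, F k ≤ ∫ k, G k := by
  by_cases hF : Integrable F
  · exact integral_mono_ae hF hG h
  · rwa [integral_undef hF]

/-- The collision operator is bounded below by the loss terms. -/
theorem polColl_ge {c : ℝ} {b : X → X → ℝ} {f : X → ℝ} (hf : Integrable f)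
    (hf0 : ∀ᵐ k, 0 ≤ f k) (hb0 : ∀ p q, 0 ≤ b p q)
    (hb : ∀ p q x, InTriad p q x → (∫ k, f k) * b p q ≤ c ^ 2 / 2 * ‖x‖) :
    ∀ᵐ k, -(2 * c ^ 2 * ‖k‖ * f k) ≤ polColl b f f k := by
  have hm0 : 0 ≤ ∫ k, f k := integral_nonneg_of_ae hf0
  set m := ∫ k, f k with hm
  rcases hm0.eq_or_lt with h | hmpos
  -- At zero mass f vanishes almost everywhere, and so do both sides.
  · have hz : f =ᵐ[volume] 0 := (integral_eq_zero_iff_of_nonneg_ae hf0 hf).1 (by rw [← hm, h])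
    filter_upwards [polColl_congr_ae b hz, hz] with k h3 h4
    rw [h3, h4]
    simp [polColl, gainIntegrand, lossIntegrand, polTriad]
  have hb' : ∀ p q x, InTriad p q x → b p q ≤ c ^ 2 / (2 * m) * ‖x‖ := fun p q x hx => by
    rw [show c ^ 2 / (2 * m) * ‖x‖ = c ^ 2 / 2 * ‖x‖ / m by field_simp, le_div_iff₀ hmpos]
    linarith [hb p q x hx]
  filter_upwards [hf0] with k hk
  set β := c ^ 2 / (2 * m)
  have hβ : β * m = c ^ 2 / 2 := by simp only [β]; field_simp
  have hβ0 : 0 ≤ β := by positivity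
  have hfk : Integrable fun q => f (k - q) := hf.comp_sub_left k
  have ek : ∫ q, f (k - q) = m := integral_sub_left_eq_self f volume k
  -- Only the products containing f(k) contribute negatively. With the kernel bounded by β‖k‖ they
  -- integrate to multiples of β‖k‖ f(k) m, and β m = c²/2 does not depend on f. The first integral
  -- costs c²‖k‖ f(k), and the doubled second one costs the same.
  have g1 : ∫ q, -gainIntegrand b f f k q ≤ ∫ q, (β * ‖k‖ * f k) * (f q + f (k - q)) := by
    refine integral_le_of_ae_le ?_ ((hf.add hfk).const_mul _) ?_
    · filter_upwards [hf0, ae_comp_sub_left hf0 k] with q a1 a2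
      have t : InTriad q (k - q) k := Or.inr (Or.inr (by abel))
      have hB := hb' _ _ _ t
      have hB0 := hb0 q (k - q)
      have e : -gainIntegrand b f f k q
          = b q (k - q) * (f k * (f q + f (k - q))) - b q (k - q) * (f q * f (k - q)) := by
        simp only [gainIntegrand, polTriad]; ring
      rw [e]
      have i1 : 0 ≤ b q (k - q) * (f q * f (k - q)) := by positivity
      have i2 : b q (k - q) * (f k * (f q + f (k - q)))
          ≤ β * ‖k‖ * (f k * (f q + f (k - q))) := by gcongr
      linarith
    · rw [integral_const_mul, integral_add hf hfk, ek]; positivity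
  have g2 : ∫ q, lossIntegrand b f f k q ≤ ∫ q, (β * ‖k‖ * f k) * f q := by
    refine integral_le_of_ae_le ?_ (hf.const_mul _) ?_
    · filter_upwards [hf0, ae_comp_add_left hf0 k] with q a1 a2
      have hB := hb' k q k (Or.inl rfl)
      have hB0 := hb0 k q
      have e : lossIntegrand b f f k q
          = b k q * (f k * f q) - b k q * (f (k + q) * (f k + f q)) := by
        simp only [lossIntegrand, polTriad]; ring
      rw [e]
      have i1 : 0 ≤ b k q * (f (k + q) * (f k + f q)) := by positivity
      have i2 : b k q * (f k * f q) ≤ β * ‖k‖ * (f k * f q) := by gcongr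
      linarith
    · rw [integral_const_mul]; positivity
  rw [integral_neg, integral_const_mul, integral_add hf hfk, ek] at g1
  rw [integral_const_mul] at g2
  have e1 : β * ‖k‖ * f k * (m + m) = c ^ 2 * ‖k‖ * f k := by
    linear_combination (2 * ‖k‖ * f k) * hβ
  have e2 : β * ‖k‖ * f k * m = c ^ 2 / 2 * ‖k‖ * f k := by
    linear_combination (‖k‖ * f k) * hβ
  change _ ≤ (∫ q, gainIntegrand b f f k q) - 2 * ∫ q, lossIntegrand b f f k q
  linarith

/-- The indicator of the ball of radius `R`. -/
def ballInd (R : ℝ) : X → ℝ := (Metric.ball (0 : X) R).indicator 1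

theorem measurable_ballInd (R : ℝ) : Measurable (ballInd R : X → ℝ) :=
  measurable_one.indicator Metric.isOpen_ball.measurableSet

theorem ballInd_nonneg (R : ℝ) (k : X) : 0 ≤ ballInd R k :=
  indicator_nonneg (fun _ _ => zero_le_one) k

theorem ballInd_le_one (R : ℝ) (k : X) : ballInd R k ≤ 1 :=
  indicator_le_self' (fun _ _ => zero_le_one) k

theorem ballInd_bound (h1 : 0 < lam1) (h2 : 0 < lam2) {s : ℝ} (hs : 0 ≤ s) (R : ℝ) (k : X) :
    |ballInd R k| ≤ √lam1 ^ (-s) * weight lam1 lam2 s k := by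
  rw [abs_of_nonneg (ballInd_nonneg R k)]
  exact (ballInd_le_one R k).trans (one_le_weight h1 h2 hs k)

theorem integral_ballInd_mul (R : ℝ) {f : X → ℝ} (hf : ∀ᵐ k, 0 ≤ f k) :
    ∫ k, ballInd R k * f k = localMass R f := by
  rw [localMass, ← integral_indicator Metric.isOpen_ball.measurableSet]
  refine integral_congr_ae ?_
  filter_upwards [hf] with k hk
  by_cases hkb : k ∈ Metric.ball (0 : X) R <;> simp [ballInd, hkb, abs_of_nonneg hk]

/-- Exponential lower bound of an integral against a test function. -/
theorem integral_test_ge (h1 : 0 < lam1) (h2 : 0 < lam2) {s T ℓ C : ℝ}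
    {u u' : ℝ → WeightedL1 d lam1 lam2 s}
    (hu : ContinuousOn u (Ico 0 T)) (hu' : ∀ t ∈ Ioo 0 T, HasDerivAt u (u' t) t) {w : X → ℝ}
    (hw : Measurable w) (hC : ∀ k, |w k| ≤ C * weight lam1 lam2 s k)
    (hge : ∀ t ∈ Ioo 0 T, ∀ᵐ k, -(ℓ * (w k * u t k)) ≤ w k * u' t k) :
    ∀ t ∈ Ico 0 T, (∫ k, w k * u 0 k) * Real.exp (-(ℓ * t)) ≤ ∫ k, w k * u t k := by
  let Λ : WeightedL1 d lam1 lam2 s →L[ℝ] ℝ := testCLM h1 h2 w hw hC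
  have hd : ∀ t ∈ Ioo 0 T, HasDerivAt (fun t => Real.exp (ℓ * t) * Λ (u t))
      (Real.exp (ℓ * t) * ℓ * Λ (u t) + Real.exp (ℓ * t) * Λ (u' t)) t := by
    intro t ht
    have e1 : HasDerivAt (fun t => Real.exp (ℓ * t)) (Real.exp (ℓ * t) * ℓ) t := by
      simpa using ((hasDerivAt_id t).const_mul ℓ).exp
    exact e1.mul (Λ.hasFDerivAt.comp_hasDerivAt t (hu' t ht))
  have hmono : MonotoneOn (fun t => Real.exp (ℓ * t) * Λ (u t)) (Ico 0 T) := by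
    refine monotoneOn_of_deriv_nonneg (convex_Ico 0 T)
      ((by fun_prop : Continuous fun t => Real.exp (ℓ * t)).continuousOn.mul
        (Λ.continuous.comp_continuousOn hu)) ?_ ?_
    · rw [interior_Ico]
      exact fun t ht => (hd t ht).differentiableAt.differentiableWithinAt
    · rw [interior_Ico]
      intro t ht
      rw [(hd t ht).deriv]
      have hle : 0 ≤ Λ (u' t) + ℓ * Λ (u t) := by
        simp only [Λ, testCLM_apply]
        rw [← integral_const_mul, ← integral_add (integrable_test h1 h2 hw hC _)
          ((integrable_test h1 h2 hw hC _).const_mul _)]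
        refine integral_nonneg_of_ae ?_
        filter_upwards [hge t ht] with k e1
        simp only [Pi.zero_apply]
        linarith
      have := mul_nonneg (Real.exp_pos (ℓ * t)).le hle
      linarith
  intro t ht
  have h0 : (0 : ℝ) ∈ Ico 0 T := ⟨le_rfl, ht.1.trans_lt ht.2⟩
  have := hmono h0 ht ht.1
  simp only [mul_zero, Real.exp_zero, one_mul, Λ, testCLM_apply] at this
  rw [Real.exp_neg, ← div_eq_mul_inv, div_le_iff₀ (Real.exp_pos _)]
  linarith

/-- Exponential lower bound of the mass in a ball. -/
theorem localMass_ge (h1 : 0 < lam1) (h2 : 0 < lam2) {nu c s T : ℝ} (hs : 0 ≤ s) (hnu : 0 < nu)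
    {u u' : ℝ → WeightedL1 d lam1 lam2 s}
    (hu : ContinuousOn u (Ico 0 T)) (hu' : ∀ t ∈ Ioo 0 T, HasDerivAt u (u' t) t)
    (hu0 : ∀ t ∈ Ico 0 T, ∀ᵐ k, 0 ≤ u t k)
    (hge : ∀ t ∈ Ioo 0 T, ∀ᵐ k,
      -((2 * nu * ‖k‖ ^ 2 + 2 * c ^ 2 * ‖k‖) * u t k) ≤ u' t k)
    (R : ℝ) :
    ∀ t ∈ Ico 0 T, localMass R (u 0) * Real.exp (-((2 * nu * R ^ 2 + 2 * c ^ 2 * R) * t))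
      ≤ localMass R (u t) := by
  intro t ht
  rw [← integral_ballInd_mul R (hu0 t ht),
    ← integral_ballInd_mul R (hu0 0 ⟨le_rfl, ht.1.trans_lt ht.2⟩)]
  refine integral_test_ge h1 h2 hu hu' (measurable_ballInd R) (ballInd_bound h1 h2 hs R)
    (fun t ht => ?_) t ht
  filter_upwards [hge t ht, hu0 t ⟨ht.1.le, ht.2⟩] with k e1 e2
  by_cases hkb : k ∈ Metric.ball (0 : X) R
  · have hk : ‖k‖ ≤ R := (mem_ball_zero_iff.1 hkb).le
    have hR : 0 ≤ R := (norm_nonneg k).trans hk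
    have : 2 * nu * ‖k‖ ^ 2 + 2 * c ^ 2 * ‖k‖ ≤ 2 * nu * R ^ 2 + 2 * c ^ 2 * R := by gcongr
    have := mul_le_mul_of_nonneg_right this e2
    simp only [ballInd, hkb, indicator_of_mem, Pi.one_apply, one_mul]
    linarith
  · simp [ballInd, hkb]

end Damped

/-! ### The truncated problem -/

section Truncated

variable {d : ℕ} {lam1 lam2 : ℝ}

local notation "X" => EuclideanSpace ℝ (Fin d)

theorem lintegral_absColl_const_le (h1 : 0 < lam1) (h2 : 0 < lam2) {s B : ℝ} (hB : 0 ≤ B)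
    {b : X → X → ℝ} (hbm : Measurable (Function.uncurry b))
    (hb : ∀ p q k, InTriad p q k → weight lam1 lam2 s k * |b p q| ≤ B) {u v : X → ℝ}
    (hum : Measurable u) (hvm : Measurable v) (hu : Integrable u) (hv : Integrable v) :
    ∫⁻ k, ENNReal.ofReal (weight lam1 lam2 s k) * absColl b u v k
      ≤ ENNReal.ofReal (18 * (B * (mom0 u * mom0 v))) := by
  have hw := (continuous_weight h1 h2 s (d := d)).measurable
  have key : ∀ p q k, InTriad p q k →
      ENNReal.ofReal (weight lam1 lam2 s k) * ‖b p q‖ₑ ≤ ENNReal.ofReal B := fun p q k hk => by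
    rw [← ofReal_norm, ← ENNReal.ofReal_mul (weight_pos h1 h2 s k).le]
    exact ENNReal.ofReal_le_ofReal (hb p q k hk)
  have hdom : Dominates (fun _ _ => ENNReal.ofReal B)
      (fun k => ENNReal.ofReal (weight lam1 lam2 s k)) b :=
    ⟨fun _ _ => rfl, measurable_const, key, key, key⟩
  refine (lintegral_absColl_le_of_two (w := fun _ _ => B) (a₁ := fun _ => B * 1)
    (b₁ := fun _ => 1) (a₂ := fun _ => 0) (b₂ := fun _ => 0) hdom hw hbm hum hvm
    (fun _ _ => by simp) (fun _ => by simpa using hB) (fun _ => zero_le_one) (fun _ => le_rfl)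
    (fun _ => le_rfl) measurable_const measurable_const measurable_const measurable_const
    (by simpa using hu.const_mul B) (by simpa using hv) (by simp) (by simp)).trans (le_of_eq ?_)
  have z : ∀ F : X → ℝ, absInt (fun _ => 0) F = 0 := fun F => by simp [absInt]
  rw [absInt_const_mul, z, z]
  congr 1
  ring

/-- The largest value of the weight on the ball of radius `n`. -/
def weightSup (lam1 lam2 s n : ℝ) : ℝ := √(lam1 + lam2 * n ^ 2) ^ s

theorem weightSup_nonneg (lam1 lam2 s n : ℝ) : 0 ≤ weightSup lam1 lam2 s n :=
  Real.rpow_nonneg (Real.sqrt_nonneg _) _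

theorem weight_le_weightSup (h1 : 0 < lam1) (h2 : 0 < lam2) {s n : ℝ} (hs : 0 ≤ s) {k : X}
    (hk : ‖k‖ ≤ n) : weight lam1 lam2 s k ≤ weightSup lam1 lam2 s n :=
  Real.rpow_le_rpow (omega_pos h1 h2 k).le (omega_le_of_norm_le h2 hk) hs

theorem InTriad.norm_le {p q k : X} {n : ℝ} (hk : InTriad p q k)
    (h : max (max ‖p‖ ‖q‖) ‖p + q‖ ≤ n) : ‖k‖ ≤ n := by
  simp only [max_le_iff] at h
  rcases hk with rfl | rfl | rfl
  exacts [h.1.1, h.1.2, h.2]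

theorem kern_zero_mass (c : ℝ) (p q : X) : kern c lam1 lam2 0 p q = 0 := by
  simp [kern, lorentzian]

theorem weight_mul_truncKern_le (h1 : 0 < lam1) (h2 : 0 < lam2) {c n m s : ℝ} (hs : 0 ≤ s)
    (hm : 0 ≤ m) (hn : 0 ≤ n) (p q k : X) (hk : InTriad p q k) :
    weight lam1 lam2 s k * |truncKern c lam1 lam2 n m p q|
      ≤ weightSup lam1 lam2 s n * (c ^ 2 / (2 * m) * n) := by
  have hS := weightSup_nonneg lam1 lam2 s n
  rcases le_or_gt (max (max ‖p‖ ‖q‖) ‖p + q‖) n with h | h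
  · refine mul_le_mul (weight_le_weightSup h1 h2 hs (hk.norm_le h)) ?_ (abs_nonneg _) hS
    -- At m = 0 the right-hand side is 0, division by zero giving zero, and the kernel vanishes as
    -- well.
    rcases hm.eq_or_lt with rfl | hm
    · rw [truncKern_of_le h, kern_zero_mass]; simp
    · refine (truncKern_abs_le hm le_rfl p q k hk).trans ?_
      gcongr
      exact hk.norm_le h
  · rw [truncKern_of_lt h, abs_zero, mul_zero]
    positivity

theorem weight_mul_truncKern_sub_le (h1 : 0 < lam1) (h2 : 0 < lam2) {c n m m' s : ℝ} (hs : 0 ≤ s)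
    (hm : 0 < m) (hm' : 0 < m') (hn : 0 ≤ n) (p q k : X) (hk : InTriad p q k) :
    weight lam1 lam2 s k * |truncKern c lam1 lam2 n m p q - truncKern c lam1 lam2 n m' p q|
      ≤ weightSup lam1 lam2 s n * (c ^ 2 / 2 * |m - m'| * n / (m * m')) := by
  have hS := weightSup_nonneg lam1 lam2 s n
  rcases le_or_gt (max (max ‖p‖ ‖q‖) ‖p + q‖) n with h | h
  · refine mul_le_mul (weight_le_weightSup h1 h2 hs (hk.norm_le h)) ?_ (abs_nonneg _) hS
    rw [truncKern_of_le h, truncKern_of_le h, le_div_iff₀ (by positivity), mul_comm]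
    refine (mass_mul_mass_mul_abs_kern_sub_le hm.le hm'.le hk).trans ?_
    gcongr
    exact hk.norm_le h
  · rw [truncKern_of_lt h, truncKern_of_lt h, sub_zero, abs_zero, mul_zero]
    positivity

theorem polColl_truncKern_of_lt {c n m : ℝ} {u v : X → ℝ} {k : X} (hk : n < ‖k‖) :
    polColl (truncKern c lam1 lam2 n m) u v k = 0 := by
  have e1 : ∀ q, truncKern c lam1 lam2 n m q (k - q) = 0 := fun q =>
    truncKern_of_lt (lt_max_of_lt_right (by rwa [add_sub_cancel]))
  have e2 : ∀ q, truncKern c lam1 lam2 n m k q = 0 := fun q =>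
    truncKern_of_lt (lt_max_of_lt_left (lt_max_of_lt_left hk))
  simp [polColl, gainIntegrand, lossIntegrand, e1, e2]

theorem polColl_ae_zero (b : X → X → ℝ) {f : X → ℝ} (h : f =ᵐ[volume] 0) :
    polColl b f f =ᵐ[volume] 0 := by
  filter_upwards [polColl_congr_ae b h] with k e
  rw [e]
  simp [polColl, gainIntegrand, lossIntegrand, polTriad]

theorem mom0_eq_integral {f : X → ℝ} (hf : ∀ k, 0 ≤ f k) : mom0 f = ∫ k, f k := by
  simp [mom0, absInt, abs_of_nonneg (hf _)]

/-- The truncated collision operator at the mass of its argument. -/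
def truncColl (c lam1 lam2 n : ℝ) (f : X → ℝ) : X → ℝ :=
  polColl (truncKern c lam1 lam2 n (∫ k, f k)) f f

theorem measurable_truncColl {c n : ℝ} {f : X → ℝ} (hf : Measurable f) :
    Measurable (truncColl c lam1 lam2 n f) :=
  measurable_polColl (measurable_truncKern _ _ _ _ _) hf hf

theorem integrable_truncColl (h1 : 0 < lam1) (h2 : 0 < lam2) {c n s : ℝ} (hs : 0 ≤ s)
    (hn : 0 ≤ n) {f : X → ℝ} (hfm : Measurable f) (hf : Integrable f) (hf0 : ∀ k, 0 ≤ f k) :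
    Integrable fun k => weight lam1 lam2 s k * truncColl c lam1 lam2 n f k := by
  have hm : 0 ≤ ∫ k, f k := integral_nonneg hf0
  have hw := (continuous_weight h1 h2 s (d := d)).measurable
  have hS := weightSup_nonneg lam1 lam2 s n
  have hB : 0 ≤ weightSup lam1 lam2 s n * (c ^ 2 / (2 * ∫ k, f k) * n) := by positivity
  refine (integrable_weight_mul hw (fun k => (weight_pos h1 h2 s k).le)
    (measurable_truncColl hfm) ?_ ((lintegral_mono fun k => ?_).trans
      (lintegral_absColl_const_le h1 h2 hB (measurable_truncKern c lam1 lam2 n (∫ k, f k))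
    (weight_mul_truncKern_le h1 h2 hs hm hn) hfm hfm hf hf))).1
  · have := absInt_nonneg (fun _ : X => zero_le_one) f
    positivity
  · gcongr
    exact enorm_polColl_le _ _ _ _

/-- The difference is split with the kernel taken at the larger mass in the bilinear term. There
1/(2 mg) times mg + mf is at most 1, which contributes 18. In the kernel difference, |mg - mf|/(mg
mf) times mf² is at most |mg - mf|, which contributes 9. The bound is therefore global and survives
small masses. -/
theorem truncColl_lipschitz_aux (h1 : 0 < lam1) (h2 : 0 < lam2) {c n s : ℝ} (hs : 0 ≤ s)
    (hn : 0 ≤ n) {f g : X → ℝ} (hfm : Measurable f) (hgm : Measurable g)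
    (hf : Integrable f) (hg : Integrable g) (hf0 : ∀ k, 0 ≤ f k) (hg0 : ∀ k, 0 ≤ g k)
    (hle : ∫ k, f k ≤ ∫ k, g k) :
    absInt (weight lam1 lam2 s) (fun k => truncColl c lam1 lam2 n g k - truncColl c lam1 lam2 n f k)
      ≤ 27 * weightSup lam1 lam2 s n * c ^ 2 * n * mom0 (g - f) := by
  have hw := (continuous_weight h1 h2 s (d := d)).measurable
  have hS := weightSup_nonneg lam1 lam2 s n
  have hmf : 0 ≤ ∫ k, f k := integral_nonneg hf0
  have hmg : 0 ≤ ∫ k, g k := integral_nonneg hg0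
  have hΔ := abs_integral_sub_le hf hg
  have hh0 : 0 ≤ mom0 (g - f) := absInt_nonneg (fun _ => zero_le_one) _
  have ef : mom0 f = ∫ k, f k := mom0_eq_integral hf0
  have eS : mom0 (g + f) = (∫ k, g k) + ∫ k, f k := by
    rw [mom0_eq_integral (f := g + f) fun k => add_nonneg (hg0 k) (hf0 k)]
    exact integral_add hg hf
  set S := weightSup lam1 lam2 s n
  set mf := ∫ k, f k with hmfd
  set mg := ∫ k, g k with hmgd
  rcases hmg.eq_or_lt with hz | hpos
  · have hfz : f =ᵐ[volume] 0 := (integral_eq_zero_iff_of_nonneg hf0 hf).1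
      (le_antisymm (hle.trans hz.symm.le) hmf)
    have hgz : g =ᵐ[volume] 0 := (integral_eq_zero_iff_of_nonneg hg0 hg).1 hz.symm
    have : absInt (weight lam1 lam2 s)
        (fun k => truncColl c lam1 lam2 n g k - truncColl c lam1 lam2 n f k) = 0 := by
      refine integral_eq_zero_of_ae ?_
      filter_upwards [polColl_ae_zero (truncKern c lam1 lam2 n mf) hfz,
        polColl_ae_zero (truncKern c lam1 lam2 n mg) hgz] with k e1 e2
      have e3 : truncColl c lam1 lam2 n g k = 0 := e2
      have e4 : truncColl c lam1 lam2 n f k = 0 := e1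
      simp [e3, e4]
    rw [this]
    positivity
  have hbm := measurable_truncKern (d := d) c lam1 lam2 n mg
  have hbm' := measurable_truncKern (d := d) c lam1 lam2 n mf
  have hbbm : Measurable (Function.uncurry
    (truncKern c lam1 lam2 n mg - truncKern c lam1 lam2 n mf : X → X → ℝ)) := hbm.sub hbm'
  have p1 : 0 ≤ S * (c ^ 2 / (2 * mg) * n) := by positivity
  have p3 : 0 ≤ S * (c ^ 2 / (2 * mf) * n) := by positivity
  have E1 := lintegral_absColl_const_le h1 h2 p1 hbm (weight_mul_truncKern_le h1 h2 hs hmg hn)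
    (hgm.sub hfm) (hgm.add hfm) (hg.sub hf) (hg.add hf)
  have E3 := lintegral_absColl_const_le h1 h2 p3 hbm' (weight_mul_truncKern_le h1 h2 hs hmf hn)
    hfm hfm hf hf
  -- If mf = 0 the kernel difference is the kernel at mg alone; any bound B will do, since it is
  -- multiplied by mf².
  obtain ⟨B, hB0, hB, hBle⟩ : ∃ B : ℝ, 0 ≤ B ∧ (∀ p q k : X, InTriad p q k →
      weight lam1 lam2 s k * |(truncKern c lam1 lam2 n mg - truncKern c lam1 lam2 n mf : X → X → ℝ) p q| ≤ B)
      ∧ B * (mf * mf) ≤ S * (c ^ 2 / 2) * n * |mg - mf| := by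
    rcases hmf.eq_or_lt with hz | hpos'
    · refine ⟨_, p1, fun p q k hk => ?_, ?_⟩
      · have e : truncKern c lam1 lam2 n mf p q = 0 := by
          unfold truncKern; rw [← hz, kern_zero_mass]; simp
        rw [Pi.sub_apply, Pi.sub_apply, e, sub_zero]
        exact weight_mul_truncKern_le h1 h2 hs hmg hn p q k hk
      · rw [← hz]; simp only [mul_zero]; positivity
    · refine ⟨_, by positivity, weight_mul_truncKern_sub_le h1 h2 hs hpos hpos' hn, ?_⟩
      calc S * (c ^ 2 / 2 * |mg - mf| * n / (mg * mf)) * (mf * mf)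
          = S * (c ^ 2 / 2) * n * |mg - mf| * (mf / mg) := by field_simp
        _ ≤ S * (c ^ 2 / 2) * n * |mg - mf| * 1 := by
            gcongr
            exact (div_le_one hpos).2 hle
        _ = _ := mul_one _
  have E2 := lintegral_absColl_const_le h1 h2 hB0 hbbm hB hfm hfm hf hf
  have ae1 := ae_absColl_lt_top_of_le hw (weight_pos h1 h2 s) hbm (hgm.sub hfm) (hgm.add hfm) E1
  have ae2 := ae_absColl_lt_top_of_le hw (weight_pos h1 h2 s) hbbm hfm hfm E2
  have ae3 := ae_absColl_lt_top_of_le hw (weight_pos h1 h2 s) hbm' hfm hfm E3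
  refine (integrable_weight_mul hw (fun k => (weight_pos h1 h2 s k).le)
    ((measurable_truncColl hgm).sub (measurable_truncColl hfm)) (by positivity) ?_).2
  have c1 : 18 * (S * (c ^ 2 / (2 * mg) * n) * (mom0 (g - f) * mom0 (g + f)))
      ≤ 18 * S * c ^ 2 * n * mom0 (g - f) := by
    rw [eS]
    calc _ ≤ 18 * (S * (c ^ 2 / (2 * mg) * n) * (mom0 (g - f) * (mg + mg))) := by gcongr
      _ = _ := by field_simp; ring
  have c2 : 18 * (B * (mom0 f * mom0 f)) ≤ 9 * S * c ^ 2 * n * mom0 (g - f) := by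
    rw [ef]
    have hBle' : B * (mf * mf) ≤ S * (c ^ 2 / 2) * n * mom0 (g - f) := hBle.trans (by gcongr)
    calc _ ≤ 18 * (S * (c ^ 2 / 2) * n * mom0 (g - f)) := by linarith
      _ = _ := by ring
  calc ∫⁻ k, ENNReal.ofReal (weight lam1 lam2 s k)
        * ‖truncColl c lam1 lam2 n g k - truncColl c lam1 lam2 n f k‖ₑ
      ≤ ∫⁻ k, (ENNReal.ofReal (weight lam1 lam2 s k)
          * absColl (truncKern c lam1 lam2 n mg) (g - f) (g + f) k
          + ENNReal.ofReal (weight lam1 lam2 s k)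
          * absColl (truncKern c lam1 lam2 n mg - truncKern c lam1 lam2 n mf) f f k) := by
        refine lintegral_mono_ae ?_
        filter_upwards [ae1, ae2, ae3] with k a1 a2 a3
        rw [truncColl, truncColl, polColl_sub hbm hbm' hfm hgm a1 a2 a3, ← mul_add]
        gcongr
        exact (enorm_add_le _ _).trans (add_le_add (enorm_polColl_le _ _ _ _)
          (enorm_polColl_le _ _ _ _))
    _ ≤ ENNReal.ofReal (18 * S * c ^ 2 * n * mom0 (g - f))
        + ENNReal.ofReal (9 * S * c ^ 2 * n * mom0 (g - f)) := by
        have m : Measurable fun k => ENNReal.ofReal (weight lam1 lam2 s k)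
            * absColl (truncKern c lam1 lam2 n mg) (g - f) (g + f) k :=
          hw.ennreal_ofReal.mul (measurable_absColl hbm (hgm.sub hfm) (hgm.add hfm))
        rw [lintegral_add_left m]
        exact add_le_add (E1.trans (ENNReal.ofReal_le_ofReal c1))
          (E2.trans (ENNReal.ofReal_le_ofReal c2))
    _ = _ := by
        rw [← ENNReal.ofReal_add (by positivity) (by positivity)]
        congr 1; ring

/-- The truncated collision operator is globally Lipschitz on nonnegative functions. -/
theorem truncColl_lipschitz (h1 : 0 < lam1) (h2 : 0 < lam2) {c n s : ℝ} (hs : 0 ≤ s)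
    (hn : 0 ≤ n) {f g : X → ℝ} (hfm : Measurable f) (hgm : Measurable g)
    (hf : Integrable f) (hg : Integrable g) (hf0 : ∀ k, 0 ≤ f k) (hg0 : ∀ k, 0 ≤ g k) :
    absInt (weight lam1 lam2 s) (fun k => truncColl c lam1 lam2 n g k - truncColl c lam1 lam2 n f k)
      ≤ 27 * weightSup lam1 lam2 s n * c ^ 2 * n * mom0 (g - f) := by
  rcases le_total (∫ k, f k) (∫ k, g k) with h | h
  · exact truncColl_lipschitz_aux h1 h2 hs hn hfm hgm hf hg hf0 hg0 h
  · have := truncColl_lipschitz_aux (c := c) h1 h2 hs hn hgm hfm hg hf hg0 hf0 h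
    simpa only [absInt, mom0, Pi.sub_apply, abs_sub_comm] using this

end Truncated

/-! ### Positivity, support and existence for the truncated equation -/

section TruncatedSolution

variable {d : ℕ} {lam1 lam2 : ℝ}

local notation "X" => EuclideanSpace ℝ (Fin d)

theorem norm_ofFun_sub (h1 : 0 < lam1) (h2 : 0 < lam2) {s : ℝ} {f g : X → ℝ}
    (hf : Integrable fun k => weight lam1 lam2 s k * f k)
    (hg : Integrable fun k => weight lam1 lam2 s k * g k) :
    ‖ofFun h1 h2 f hf - ofFun h1 h2 g hg‖ = absInt (weight lam1 lam2 s) fun k => f k - g k := by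
  rw [norm_eq_absInt h1 h2]
  refine absInt_congr ?_
  filter_upwards [coeFn_sub_ae h1 h2 (ofFun h1 h2 f hf) (ofFun h1 h2 g hg),
    coeFn_ofFun h1 h2 hf, coeFn_ofFun h1 h2 hg] with k e1 e2 e3
  rw [e1, Pi.sub_apply, e2, e3]

/-- The pointwise positive part. -/
def pos (f : X → ℝ) (k : X) : ℝ := max (f k) 0

theorem pos_nonneg (f : X → ℝ) (k : X) : 0 ≤ pos f k := le_max_right _ _

theorem measurable_pos {f : X → ℝ} (hf : Measurable f) : Measurable (pos f) :=
  hf.max measurable_const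

theorem abs_pos_sub_le (f g : X → ℝ) (k : X) : |pos f k - pos g k| ≤ |f k - g k| :=
  abs_max_sub_max_le_abs _ _ _

theorem integrable_pos {w f : X → ℝ} (hw : Measurable w) (hfm : Measurable f)
    (hf : Integrable fun k => w k * f k) : Integrable fun k => w k * pos f k := by
  refine hf.mono (hw.mul (measurable_pos hfm)).aestronglyMeasurable (ae_of_all _ fun k => ?_)
  rw [norm_mul, norm_mul]
  gcongr
  have := abs_pos_sub_le f 0 k
  simpa [pos] using this

theorem pos_ae_eq {f : X → ℝ} (hf : ∀ᵐ k, 0 ≤ f k) : pos f =ᵐ[volume] f :=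
  hf.mono fun _ hk => max_eq_left hk

/-- The damping rate of the truncated problem. -/
def truncRate (nu n : ℝ) (k : X) : ℝ := if ‖k‖ ≤ n then 2 * nu * ‖k‖ ^ 2 else 0

theorem measurable_truncRate (nu n : ℝ) : Measurable (truncRate nu n : X → ℝ) :=
  Measurable.ite (measurableSet_le measurable_norm measurable_const) (by fun_prop) measurable_const

theorem truncRate_nonneg {nu n : ℝ} (hnu : 0 < nu) (k : X) : 0 ≤ truncRate nu n k := by
  unfold truncRate; split_ifs <;> positivity

theorem truncRate_le {nu n : ℝ} (hnu : 0 < nu) (k : X) : truncRate nu n k ≤ 2 * nu * n ^ 2 := by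
  unfold truncRate; split_ifs with h
  · gcongr
  · positivity

/-- The shift that makes the truncated vector field positive. -/
def shift (c nu n : ℝ) : ℝ := 2 * nu * n ^ 2 + 2 * c ^ 2 * n

/-- The shifted truncated vector field as a function. -/
def truncField (c lam1 lam2 nu n : ℝ) (f : X → ℝ) (k : X) : ℝ :=
  (shift c nu n - truncRate nu n k) * pos f k + truncColl c lam1 lam2 n (pos f) k

theorem integrable_coeFn_of_nonneg_weight (h1 : 0 < lam1) (h2 : 0 < lam2) {s : ℝ} (hs : 0 ≤ s)
    (u : WeightedL1 d lam1 lam2 s) : Integrable u := by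
  have := integrable_test h1 h2 (w := fun _ => 1) (C := √lam1 ^ (-s)) measurable_const
    (by simpa using one_le_weight h1 h2 hs) u
  simpa using this

theorem integrable_pos_coeFn (h1 : 0 < lam1) (h2 : 0 < lam2) {s : ℝ} (hs : 0 ≤ s)
    (u : WeightedL1 d lam1 lam2 s) : Integrable (pos u) := by
  have := integrable_pos (w := fun _ => 1) measurable_const (measurable_coeFn u)
    (by simpa using integrable_coeFn_of_nonneg_weight h1 h2 hs u)
  simpa using this

theorem abs_shift_sub_le {c nu n : ℝ} (hnu : 0 < nu) (hn : 0 ≤ n) (k : X) :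
    |shift c nu n - truncRate nu n k| ≤ shift c nu n := by
  have := truncRate_nonneg (n := n) hnu k
  have := truncRate_le (n := n) hnu k
  have : 0 ≤ 2 * c ^ 2 * n := by positivity
  unfold shift at *
  rw [abs_of_nonneg (by linarith)]
  linarith

theorem integrable_truncField (h1 : 0 < lam1) (h2 : 0 < lam2) {c nu n s : ℝ} (hnu : 0 < nu)
    (hs : 0 ≤ s) (hn : 0 ≤ n) (u : WeightedL1 d lam1 lam2 s) :
    Integrable fun k => weight lam1 lam2 s k * truncField c lam1 lam2 nu n u k := by
  have hw := (continuous_weight h1 h2 s (d := d)).measurable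
  have hr := measurable_truncRate (d := d) nu n
  have hp := measurable_pos (measurable_coeFn u)
  have i1 := integrable_pos hw (measurable_coeFn u) (integrable_coeFn h1 h2 u)
  have i2 := integrable_truncColl (c := c) h1 h2 hs hn hp (integrable_pos_coeFn h1 h2 hs u)
    (pos_nonneg _)
  have i3 : Integrable fun k =>
      weight lam1 lam2 s k * ((shift c nu n - truncRate nu n k) * pos u k) := by
    refine (i1.const_mul (shift c nu n)).mono (by fun_prop) (ae_of_all _ fun k => ?_)
    rw [mul_left_comm, norm_mul, norm_mul (shift c nu n)]
    gcongr
    exact (abs_shift_sub_le hnu hn k).trans (le_abs_self _)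
  simpa only [truncField, mul_add] using! i3.add i2

/-- The vector field of the truncated problem on `L¹_s`. -/
def truncVec (h1 : 0 < lam1) (h2 : 0 < lam2) (c : ℝ) {nu n s : ℝ} (hnu : 0 < nu)
    (hs : 0 ≤ s) (hn : 0 ≤ n) (u : WeightedL1 d lam1 lam2 s) : WeightedL1 d lam1 lam2 s :=
  ofFun h1 h2 (truncField c lam1 lam2 nu n u) (integrable_truncField h1 h2 hnu hs hn u)
    - shift c nu n • u

theorem truncVec_ae (h1 : 0 < lam1) (h2 : 0 < lam2) (c : ℝ) {nu n s : ℝ} (hnu : 0 < nu)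
    (hs : 0 ≤ s) (hn : 0 ≤ n) (u : WeightedL1 d lam1 lam2 s) :
    ∀ᵐ k, truncVec h1 h2 c hnu hs hn u k
      = truncField c lam1 lam2 nu n u k - shift c nu n * u k := by
  filter_upwards [coeFn_sub_ae h1 h2 (ofFun h1 h2 (truncField c lam1 lam2 nu n u)
      (integrable_truncField h1 h2 hnu hs hn u)) (shift c nu n • u),
    coeFn_ofFun h1 h2 (integrable_truncField (c := c) h1 h2 hnu hs hn u),
    ae_of_ae_weighted h1 h2 (Lp.coeFn_smul (shift c nu n) u)] with k e1 e2 e3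
  rw [truncVec, e1, Pi.sub_apply, e2, e3, Pi.smul_apply, smul_eq_mul]

theorem exists_lipschitzWith_truncVec (h1 : 0 < lam1) (h2 : 0 < lam2) (c : ℝ) {nu n s : ℝ}
    (hnu : 0 < nu) (hs : 0 ≤ s) (hn : 0 ≤ n) :
    ∃ L : ℝ≥0, LipschitzWith L (truncVec (d := d) h1 h2 c hnu hs hn) := by
  set B := 27 * weightSup lam1 lam2 s n * c ^ 2 * n
  have hB : 0 ≤ B := by have := weightSup_nonneg lam1 lam2 s n; positivity
  have hsh : 0 ≤ shift c nu n := by unfold shift; positivity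
  have hF : LipschitzWith (Real.toNNReal (shift c nu n + B * √lam1 ^ (-s)))
      fun u : WeightedL1 d lam1 lam2 s => ofFun h1 h2 (truncField c lam1 lam2 nu n u)
        (integrable_truncField h1 h2 hnu hs hn u) := by
    refine LipschitzWith.of_dist_le' fun u v => ?_
    rw [dist_eq_norm, dist_eq_norm, norm_ofFun_sub, norm_eq_absInt h1 h2,
      absInt_congr (coeFn_sub_ae h1 h2 u v)]
    have hw := (continuous_weight h1 h2 s (d := d)).measurable
    have pw : ∀ k : X, 0 ≤ weight lam1 lam2 s k := fun k => (weight_pos h1 h2 s k).le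
    have hr := measurable_truncRate (d := d) nu n
    have mu := measurable_coeFn u
    have mv := measurable_coeFn v
    have hpu := measurable_pos mu
    have hpv := measurable_pos mv
    have iu := integrable_coeFn h1 h2 u
    have iv := integrable_coeFn h1 h2 v
    have iuv : Integrable fun k => weight lam1 lam2 s k * (⇑u - ⇑v) k := by
      simpa only [Pi.sub_apply, mul_sub] using! iu.sub iv
    have jd := (integrable_mul_abs pw iuv).const_mul (shift c nu n)
    have key : ∀ k, |(shift c nu n - truncRate nu n k) * (pos u k - pos v k)|
        ≤ shift c nu n * |(⇑u - ⇑v) k| := fun k => by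
      rw [abs_mul]
      exact mul_le_mul (abs_shift_sub_le hnu hn k) (abs_pos_sub_le _ _ _) (abs_nonneg _) hsh
    have i1 : Integrable fun k => weight lam1 lam2 s k
        * ((shift c nu n - truncRate nu n k) * (pos u k - pos v k)) := by
      refine jd.mono' (by fun_prop) (ae_of_all _ fun k => ?_)
      rw [norm_mul, Real.norm_of_nonneg (pw k), mul_left_comm]
      exact mul_le_mul_of_nonneg_left (key k) (pw k)
    have i2 : Integrable fun k => weight lam1 lam2 s k
        * (truncColl c lam1 lam2 n (pos u) k - truncColl c lam1 lam2 n (pos v) k) := by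
      simpa only [mul_sub] using! (integrable_truncColl (c := c) h1 h2 hs hn hpu
        (integrable_pos_coeFn h1 h2 hs u) (pos_nonneg _)).sub (integrable_truncColl (c := c) h1 h2
          hs hn hpv (integrable_pos_coeFn h1 h2 hs v) (pos_nonneg _))
    have e : (fun k => truncField c lam1 lam2 nu n u k - truncField c lam1 lam2 nu n v k)
        = (fun k => (shift c nu n - truncRate nu n k) * (pos u k - pos v k))
          + fun k => truncColl c lam1 lam2 n (pos u) k - truncColl c lam1 lam2 n (pos v) k := by
      ext k; simp only [truncField, Pi.add_apply]; ring
    rw [e]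
    refine (absInt_add_le pw i1 i2).trans ?_
    rw [add_mul]
    refine add_le_add ?_ ?_
    · rw [absInt, absInt, ← integral_const_mul]
      refine integral_mono (integrable_mul_abs pw i1) jd fun k => ?_
      simp only
      rw [mul_left_comm]
      exact mul_le_mul_of_nonneg_left (key k) (pw k)
    · refine (truncColl_lipschitz h1 h2 hs hn hpv hpu (integrable_pos_coeFn h1 h2 hs v)
        (integrable_pos_coeFn h1 h2 hs u) (pos_nonneg _) (pos_nonneg _)).trans ?_
      rw [mul_assoc B]
      refine mul_le_mul_of_nonneg_left ?_ hB
      refine le_trans ?_ (absInt_le_mul (w := fun _ => 1) (fun _ => zero_le_one)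
        (one_le_weight h1 h2 hs) iuv)
      refine integral_mono_of_nonneg (ae_of_all _ fun k => by positivity) ?_
        (ae_of_all _ fun k => by simpa using abs_pos_sub_le _ _ _)
      simpa using! ((integrable_coeFn_of_nonneg_weight h1 h2 hs u).sub
        (integrable_coeFn_of_nonneg_weight h1 h2 hs v)).abs
  refine ⟨_, hF.sub (g := fun u => shift c nu n • u) (lipschitzWith_smul (shift c nu n))⟩

/-- Inside the ball the two parts of the shift dominate the damping rate and the loss rate 2c²‖k‖ of
`polColl_ge`. Outside it both the truncated collisions and the truncated damping vanish. -/
theorem truncField_nonneg {c nu n : ℝ} (hnu : 0 < nu) (hn : 0 ≤ n) {f : X → ℝ}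
    (hf : Integrable (pos f)) : ∀ᵐ k, 0 ≤ truncField c lam1 lam2 nu n f k := by
  have hm : 0 ≤ ∫ k, pos f k := integral_nonneg (pos_nonneg f)
  filter_upwards [polColl_ge (c := c) (b := truncKern c lam1 lam2 n (∫ k, pos f k)) hf
    (ae_of_all _ (pos_nonneg f)) (truncKern_nonneg hm) (fun p q x hx =>
      (mul_le_mul_of_nonneg_left (truncKern_le_kern hm p q) hm).trans
        (mass_mul_kern_le hm hx))] with k hk
  have h0 := pos_nonneg f k
  unfold truncField
  rcases le_or_gt ‖k‖ n with h | h
  · have e1 := truncRate_le (n := n) hnu k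
    have e2 : 2 * c ^ 2 * ‖k‖ * pos f k ≤ 2 * c ^ 2 * n * pos f k := by gcongr
    have e3 := mul_le_mul_of_nonneg_right e1 h0
    change _ ≤ truncColl c lam1 lam2 n (pos f) k at hk
    unfold shift
    linarith
  · rw [truncColl, polColl_truncKern_of_lt h, add_zero]
    exact mul_nonneg ((abs_nonneg _).trans (by
      rw [truncRate, if_neg h.not_ge, sub_zero]; unfold shift
      exact abs_le.2 ⟨by linarith [show 0 ≤ 2 * nu * n ^ 2 + 2 * c ^ 2 * n by positivity], le_rfl⟩))
      h0

theorem indicator_bound (h1 : 0 < lam1) (h2 : 0 < lam2) {s : ℝ} (hs : 0 ≤ s) (A : Set X) (k : X) :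
    |A.indicator (1 : X → ℝ) k| ≤ √lam1 ^ (-s) * weight lam1 lam2 s k := by
  refine le_trans ?_ (one_le_weight h1 h2 hs k)
  by_cases hk : k ∈ A <;> simp [hk]

/-- A solution in `L¹_s` of the problem with kernel truncated to the ball of radius `n`. -/
structure IsTruncSolution (c lam1 lam2 nu n s : ℝ) (f0 : X → ℝ)
    (u u' : ℝ → WeightedL1 d lam1 lam2 s) : Prop where
  init : u 0 =ᵐ[volume] f0
  deriv : ∀ t, 0 ≤ t → HasDerivAt u (u' t) t
  cont_deriv : ContinuousOn u' (Ici 0)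
  nonneg : ∀ t, 0 ≤ t → ∀ᵐ k, 0 ≤ u t k
  supp : ∀ t, 0 ≤ t → ∀ᵐ k, n < ‖k‖ → u t k = 0
  eq : ∀ t, 0 ≤ t → ∀ᵐ k, u' t k = -(2 * nu * ‖k‖ ^ 2 * u t k) + truncColl c lam1 lam2 n (u t) k

theorem exists_isTruncSolution (h1 : 0 < lam1) (h2 : 0 < lam2) (c : ℝ) {nu n s : ℝ}
    (hnu : 0 < nu) (hs : 0 ≤ s) (hn : 0 ≤ n) {f0 : X → ℝ}
    (hf0 : Integrable fun k => weight lam1 lam2 s k * f0 k) (hf0p : ∀ᵐ k, 0 ≤ f0 k)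
    (hf0s : ∀ᵐ k, n < ‖k‖ → f0 k = 0) :
    ∃ u u' : ℝ → WeightedL1 d lam1 lam2 s, IsTruncSolution c lam1 lam2 nu n s f0 u u' := by
  obtain ⟨L, hL⟩ := exists_lipschitzWith_truncVec (d := d) h1 h2 c hnu hs hn
  obtain ⟨u, hu0, hu⟩ := exists_forall_hasDerivAt_of_lipschitzWith hL (ofFun h1 h2 f0 hf0)
  have hinit : u 0 =ᵐ[volume] f0 := by rw [hu0]; exact coeFn_ofFun h1 h2 hf0
  have hcont : ContinuousOn u (Ici 0) := fun t ht => (hu t ht).continuousAt.continuousWithinAt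
  -- The equation reads u' + shift · u = `truncField` ≥ 0 for a field built on the positive part of
  -- u. Hence e^{shift · t} ∫_A u increases for every measurable set A, without knowing the sign of
  -- u beforehand.
  have hnonneg : ∀ t, 0 ≤ t → ∀ᵐ k, 0 ≤ u t k := by
    intro t ht
    refine ae_nonneg_of_forall_setIntegral_nonneg (integrable_coeFn_of_nonneg_weight h1 h2 hs _)
      fun A hA _ => ?_
    have hI : ∀ F : X → ℝ, ∫ k, A.indicator (1 : X → ℝ) k * F k = ∫ k in A, F k := fun F => by
      rw [← integral_indicator hA]
      refine integral_congr_ae (ae_of_all _ fun k => ?_)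
      by_cases hk : k ∈ A <;> simp [hk]
    have := integral_test_ge h1 h2 (T := t + 1) (ℓ := shift c nu n)
      (hcont.mono fun x hx => hx.1) (fun x hx => hu x hx.1.le) (measurable_one.indicator hA)
      (indicator_bound h1 h2 hs A) (fun x hx => ?_) t ⟨ht, by linarith⟩
    · rw [hI, hI] at this
      refine le_trans (mul_nonneg ?_ (Real.exp_pos _).le) this
      refine integral_nonneg_of_ae (ae_restrict_of_ae ?_)
      filter_upwards [hinit, hf0p] with k e1 e2
      rw [Pi.zero_apply, e1]; exact e2
    · filter_upwards [truncVec_ae h1 h2 c hnu hs hn (u x), truncField_nonneg (c := c)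
        (lam1 := lam1) (lam2 := lam2) hnu hn (integrable_pos_coeFn h1 h2 hs (u x))] with k e1 e2
      rw [e1]
      by_cases hk : k ∈ A
      · simp only [hk, indicator_of_mem, Pi.one_apply]; linarith
      · simp [hk]
  have hsupp : ∀ t, 0 ≤ t → ∀ᵐ k, n < ‖k‖ → u t k = 0 := by
    intro t ht
    set A : Set X := {k | n < ‖k‖} with hAdef
    have hA : MeasurableSet A := measurableSet_lt measurable_const measurable_norm
    have hAm : Measurable fun k => -A.indicator (1 : X → ℝ) k := (measurable_one.indicator hA).neg
    -- Outside the ball u' = 0, because u coincides with its positive part there. Testing with minus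
    -- the indicator bounds ∫_A u(t) above by its initial value 0.
    have := integral_test_ge h1 h2 (T := t + 1) (ℓ := 0)
      (hcont.mono fun x hx => hx.1) (fun x hx => hu x hx.1.le) hAm
      (fun k => by rw [abs_neg]; exact indicator_bound h1 h2 hs A k)
      (fun x hx => ?_) t ⟨ht, by linarith⟩
    · have e0 : ∫ k, -A.indicator (1 : X → ℝ) k * u 0 k = 0 := by
        refine integral_eq_zero_of_ae ?_
        filter_upwards [hinit, hf0s] with k e1 e2
        by_cases hk : k ∈ A
        · simp [e1, e2 hk]
        · simp [hk]
      rw [e0, zero_mul] at this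
      have hint : Integrable fun k => A.indicator (1 : X → ℝ) k * u t k :=
        integrable_test h1 h2 (measurable_one.indicator hA) (indicator_bound h1 h2 hs A) _
      have hnn : 0 ≤ᵐ[volume] fun k => A.indicator (1 : X → ℝ) k * u t k := by
        filter_upwards [hnonneg t ht] with k hk
        exact mul_nonneg (indicator_nonneg (fun _ _ => zero_le_one) k) hk
      simp only [neg_mul, integral_neg] at this
      have hz := (integral_eq_zero_iff_of_nonneg_ae hnn hint).1
        (le_antisymm (by linarith) (integral_nonneg_of_ae hnn))
      filter_upwards [hz] with k e1 hk
      have hkA : k ∈ A := hk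
      simpa [hkA] using e1
    · filter_upwards [truncVec_ae h1 h2 c hnu hs hn (u x), hnonneg x hx.1.le] with k e1 e2
      rw [e1]
      by_cases hk : k ∈ A
      · have hk' : n < ‖k‖ := hk
        have : truncField c lam1 lam2 nu n (u x) k = shift c nu n * u x k := by
          rw [truncField, truncColl, polColl_truncKern_of_lt hk', truncRate, if_neg hk'.not_ge,
            pos, max_eq_left e2]
          ring
        rw [this]; simp
      · simp [hk]
  refine ⟨u, fun t => truncVec h1 h2 c hnu hs hn (u t), hinit, hu,
    hL.continuous.comp_continuousOn hcont, hnonneg, hsupp, fun t ht => ?_⟩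
  have hpe := pos_ae_eq (hnonneg t ht)
  filter_upwards [truncVec_ae h1 h2 c hnu hs hn (u t), hsupp t ht, hpe,
    polColl_congr_ae (truncKern c lam1 lam2 n (∫ k, pos (u t) k)) hpe] with k e1 e2 e3 e4
  rw [e1, truncField, e3]
  unfold truncColl
  rw [e4, integral_congr_ae hpe]
  -- The cut-off damping agrees with the true one on the ball, and outside the ball u vanishes.
  rcases le_or_gt ‖k‖ n with h | h
  · rw [truncRate, if_pos h]; ring
  · rw [e2 h]; ring

end TruncatedSolution

/-! ### Uniform estimates for the truncated solutions -/

section UniformEstimates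

variable {d : ℕ} {lam1 lam2 : ℝ}

local notation "X" => EuclideanSpace ℝ (Fin d)

/-- The inclusion `L¹_s' ⊆ L¹_s` for `s ≤ s'`. -/
def incl (h1 : 0 < lam1) (h2 : 0 < lam2) {s s' : ℝ} (h : s ≤ s') :
    WeightedL1 d lam1 lam2 s' →L[ℝ] WeightedL1 d lam1 lam2 s :=
  mulCLM h1 h2 (fun _ => 1) (C := √lam1 ^ (s - s')) measurable_const fun k => by
    rw [abs_one, one_mul]; exact weight_le_weight h1 h2 h k

theorem coeFn_incl (h1 : 0 < lam1) (h2 : 0 < lam2) {s s' : ℝ} (h : s ≤ s')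
    (u : WeightedL1 d lam1 lam2 s') : incl h1 h2 h u =ᵐ[volume] u := by
  have := coeFn_mulCLM h1 h2 (s := s') (s' := s) (w := fun _ => 1) (C := √lam1 ^ (s - s'))
    measurable_const (fun k => by rw [abs_one, one_mul]; exact weight_le_weight h1 h2 h k) u
  filter_upwards [this] with k hk
  rw [incl, hk, one_mul]

theorem gronwallBound_le {δ K ε x T : ℝ} (hδ : 0 ≤ δ) (hε : 0 ≤ ε) (hK : 1 ≤ K)
    (hx : x ≤ T) : gronwallBound δ K ε x ≤ (δ + ε) * Real.exp (K * T) := by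
  have hK0 : 0 < K := zero_lt_one.trans_le hK
  rw [gronwallBound_of_K_ne_0 hK0.ne']
  have h1 : Real.exp (K * x) ≤ Real.exp (K * T) := by gcongr
  have h2 : ε / K ≤ ε := div_le_self hε hK
  have h3 : 0 ≤ ε / K := by positivity
  have h4 := Real.exp_pos (K * x)
  calc _ ≤ δ * Real.exp (K * x) + ε / K * Real.exp (K * x) := by nlinarith
    _ ≤ δ * Real.exp (K * T) + ε * Real.exp (K * T) := by gcongr
    _ = _ := by ring

/-- The exponential growth rate of the moments. -/
def momentRate (c nu s : ℝ) : ℝ := (18 * 2 ^ s * c ^ 2) ^ 2 / (8 * nu)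

theorem localMass_le_integral {R : ℝ} {f : X → ℝ} (hf : Integrable f) (hf0 : ∀ᵐ k, 0 ≤ f k) :
    localMass R f ≤ ∫ k, f k := by
  rw [localMass]
  calc _ ≤ ∫ k, |f k| := setIntegral_le_integral hf.abs (ae_of_all _ fun k => abs_nonneg _)
    _ = ∫ k, f k := integral_congr_ae (hf0.mono fun k hk => abs_of_nonneg hk)

theorem localMass_congr {R : ℝ} {f g : X → ℝ} (h : f =ᵐ[volume] g) :
    localMass R f = localMass R g :=
  integral_congr_ae (ae_restrict_of_ae (h.mono fun k hk => by simp only [hk]))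

theorem integrable_of_supp (h1 : 0 < lam1) (h2 : 0 < lam2) {s n C : ℝ} {f w : X → ℝ}
    (hfm : Measurable f) (hf : Integrable fun k => weight lam1 lam2 s k * f k)
    (hs : ∀ᵐ k, n < ‖k‖ → f k = 0) (hw : Measurable w)
    (hC : ∀ k, ‖k‖ ≤ n → |w k| ≤ C * weight lam1 lam2 s k) : Integrable fun k => w k * f k := by
  refine (hf.abs.const_mul C).mono' (hw.mul hfm).aestronglyMeasurable ?_
  filter_upwards [hs] with k hk
  rcases le_or_gt ‖k‖ n with h | h
  · rw [norm_mul, Real.norm_eq_abs, abs_mul, abs_of_pos (weight_pos h1 h2 s k), ← mul_assoc]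
    exact mul_le_mul_of_nonneg_right (hC k h) (abs_nonneg _)
  · simp [hk h]

theorem IsTruncSolution.continuousOn {c nu n s : ℝ} {f0 : X → ℝ}
    {u u' : ℝ → WeightedL1 d lam1 lam2 s}
    (hu : IsTruncSolution c lam1 lam2 nu n s f0 u u') :
    ContinuousOn u (Ici 0) := fun t ht => (hu.deriv t ht).continuousAt.continuousWithinAt

theorem IsTruncSolution.deriv_ge {c nu n s : ℝ} {f0 : X → ℝ}
    {u u' : ℝ → WeightedL1 d lam1 lam2 s}
    (hu : IsTruncSolution c lam1 lam2 nu n s f0 u u')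
    (h1 : 0 < lam1) (h2 : 0 < lam2) (hs : 0 ≤ s) {t : ℝ} (ht : 0 ≤ t) :
    ∀ᵐ k, -((2 * nu * ‖k‖ ^ 2 + 2 * c ^ 2 * ‖k‖) * u t k) ≤ u' t k := by
  have hm : 0 ≤ ∫ k, u t k := integral_nonneg_of_ae (hu.nonneg t ht)
  filter_upwards [hu.eq t ht, polColl_ge (c := c)
    (b := truncKern c lam1 lam2 n (∫ k, u t k)) (integrable_coeFn_of_nonneg_weight h1 h2 hs (u t))
    (hu.nonneg t ht) (truncKern_nonneg hm) (fun p q x hx =>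
      (mul_le_mul_of_nonneg_left (truncKern_le_kern hm p q) hm).trans
        (mass_mul_kern_le hm hx))] with k e1 e2
  rw [e1, truncColl]
  linarith

theorem IsTruncSolution.integral_ge {c nu n s : ℝ} {f0 : X → ℝ}
    {u u' : ℝ → WeightedL1 d lam1 lam2 s}
    (hu : IsTruncSolution c lam1 lam2 nu n s f0 u u')
    (h1 : 0 < lam1) (h2 : 0 < lam2) (hs : 0 ≤ s) (hnu : 0 < nu) (R : ℝ) {t : ℝ} (ht : 0 ≤ t) :
    localMass R f0 * Real.exp (-((2 * nu * R ^ 2 + 2 * c ^ 2 * R) * t)) ≤ ∫ k, u t k := by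
  have := localMass_ge (c := c) h1 h2 hs hnu (T := t + 1) (hu.continuousOn.mono fun x hx => hx.1)
    (fun x hx => hu.deriv x hx.1.le) (fun x hx => hu.nonneg x hx.1)
    (fun x hx => hu.deriv_ge h1 h2 hs hx.1.le) R t ⟨ht, by linarith⟩
  rw [localMass_congr hu.init] at this
  exact this.trans (localMass_le_integral (integrable_coeFn_of_nonneg_weight h1 h2 hs _)
    (hu.nonneg t ht))

theorem IsTruncSolution.integrable_normSq {c nu n s : ℝ} {f0 : X → ℝ}
    {u u' : ℝ → WeightedL1 d lam1 lam2 s}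
    (hu : IsTruncSolution c lam1 lam2 nu n s f0 u u')
    (h1 : 0 < lam1) (h2 : 0 < lam2) {t : ℝ} (ht : 0 ≤ t) :
    Integrable fun k => ‖k‖ ^ 2 * weight lam1 lam2 s k * u t k := by
  have hw := (continuous_weight h1 h2 s (d := d)).measurable
  refine integrable_of_supp (n := n) (C := n ^ 2) h1 h2 (measurable_coeFn _)
    (integrable_coeFn h1 h2 (u t)) (hu.supp t ht) (by fun_prop) fun k hk => ?_
  have := weight_pos h1 h2 s k
  rw [abs_of_nonneg (by positivity)]
  gcongr

theorem integrable_norm_of_normSq {s : ℝ} (h1 : 0 < lam1) (h2 : 0 < lam2) {f : X → ℝ} (hm : Measurable f)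
    (hf : Integrable fun k => weight lam1 lam2 s k * f k)
    (hf2 : Integrable fun k => ‖k‖ ^ 2 * weight lam1 lam2 s k * f k) :
    Integrable fun k => ‖k‖ * weight lam1 lam2 s k * f k := by
  have hw := (continuous_weight h1 h2 s (d := d)).measurable
  have pw : ∀ k : X, 0 ≤ weight lam1 lam2 s k := fun k => (weight_pos h1 h2 s k).le
  refine integrable_of_weight_le (w' := fun k => ‖k‖ ^ 2 * weight lam1 lam2 s k
    + weight lam1 lam2 s k) (fun k => mul_nonneg (norm_nonneg _) (pw k)) (fun k => ?_)
    (by fun_prop) hm (by simpa only [add_mul] using! hf2.add hf)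
  have := pw k
  nlinarith [sq_nonneg (‖k‖ - 1), norm_nonneg k]

/-- Since `mom0 (u t)` equals the mass, the factor 1/m of the kernel cancels and 36 · 2^s · c²/2
remains. The rate `momentRate` thus depends neither on the truncation radius nor on any lower bound
for the mass; only positivity of the mass is used. -/
theorem IsTruncSolution.norm_le {c nu n s : ℝ} {f0 : X → ℝ}
    {u u' : ℝ → WeightedL1 d lam1 lam2 s}
    (hu : IsTruncSolution c lam1 lam2 nu n s f0 u u')
    (h1 : 0 < lam1) (h2 : 0 < lam2) (hs : 0 ≤ s) (hnu : 0 < nu)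
    (hpos : ∀ t, 0 ≤ t → 0 < ∫ k, u t k) {t : ℝ} (ht : 0 ≤ t) :
    ‖u t‖ ≤ ‖u 0‖ * Real.exp (momentRate c nu s * t) := by
  have key : ∀ t, 0 ≤ t →
      (Integrable fun k => weight lam1 lam2 s k * truncColl c lam1 lam2 n (u t) k) ∧
      absInt (weight lam1 lam2 s) (truncColl c lam1 lam2 n (u t))
        ≤ 18 * 2 ^ s * c ^ 2 * momKW lam1 lam2 s (u t) + 0 * ‖u t‖ + 0 := by
    intro t ht
    have hm := hpos t ht
    have hmom : Moments lam1 lam2 s (u t) := Moments.of_int h1 h2 hs (measurable_coeFn _)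
      (integrable_coeFn h1 h2 _) (integrable_norm_of_normSq h1 h2 (measurable_coeFn _)
        (integrable_coeFn h1 h2 _) (hu.integrable_normSq h1 h2 ht))
    obtain ⟨-, e2, e3⟩ := polColl_estimate h1 h2 hs (β := c ^ 2 / (2 * ∫ k, u t k))
      (by positivity) (measurable_truncKern c lam1 lam2 n (∫ k, u t k))
      (truncKern_abs_le hm le_rfl) hmom
    refine ⟨e2, e3.trans (le_of_eq ?_)⟩
    have e0 : mom0 (u t) = ∫ k, u t k := by
      simp only [mom0, absInt, one_mul]
      exact integral_congr_ae ((hu.nonneg t ht).mono fun k hk => abs_of_nonneg hk)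
    rw [e0]
    field_simp
    ring
  have := gronwall_weighted h1 h2 hnu (T := t) (q := fun t => truncColl c lam1 lam2 n (u t))
    (hu.continuousOn.mono fun x hx => hx.1) (fun x hx => hu.deriv x hx.1.le)
    (fun x hx => hu.integrable_normSq h1 h2 hx.1.le) (fun x hx => (key x hx.1.le).1)
    (fun x hx => hu.eq x hx.1.le) (fun x hx => (key x hx.1.le).2) t ⟨ht, le_rfl⟩
  rw [gronwallBound_ε0, add_zero] at this
  exact this

/-- The truncated solutions form a Cauchy sequence, with one moment less than the data. -/
theorem exists_truncSolution_sub_le (h1 : 0 < lam1) (h2 : 0 < lam2) (c : ℝ) {nu s δ M : ℝ}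
    (hs : 0 ≤ s) (hnu : 0 < nu) (hδ : 0 < δ) (hM : 0 ≤ M) (T : ℝ) :
    ∃ D : ℝ, 0 ≤ D ∧ ∀ (n n' : ℝ) (f0 g0 : X → ℝ) (u u' v v' : ℝ → WeightedL1 d lam1 lam2 (s + 1)),
      0 < n → n ≤ n' → IsTruncSolution c lam1 lam2 nu n (s + 1) f0 u u' →
      IsTruncSolution c lam1 lam2 nu n' (s + 1) g0 v v' →
      (∀ t ∈ Icc 0 T, δ ≤ ∫ k, u t k) → (∀ t ∈ Icc 0 T, δ ≤ ∫ k, v t k) →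
      (∀ t ∈ Icc 0 T, ‖u t‖ ≤ M) → (∀ t ∈ Icc 0 T, ‖v t‖ ≤ M) →
      ∀ t ∈ Icc 0 T, ‖incl h1 h2 (by linarith : s ≤ s + 1) (v t - u t)‖
        ≤ D * (momW lam1 lam2 s (g0 - f0) + 1 / n) := by
  obtain ⟨a, ha, hA⟩ := exists_weight_bound (d := d) h1 h2 hs
  obtain ⟨C, hC, hest⟩ := exists_polColl_sub_le (d := d) (M := a * M + M) h1 h2 c hs hδ
    (by positivity)
  set E := Real.exp ((C ^ 2 / (8 * nu) + (C + 1)) * T)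
  refine ⟨(1 + C * (c ^ 2 / δ)) * E, by positivity, ?_⟩
  intro n n' f0 g0 u u' v v' hn hnn hu hv hum hvm huM hvM
  set ι := incl (d := d) h1 h2 (by linarith : s ≤ s + 1)
  -- Both truncated kernels agree with `kern`, each at its own mass, on the smaller ball. Beyond it
  -- they differ by at most ζ‖x‖‖y‖.
  set ζ := c ^ 2 / (δ * n)
  have hζ : 0 ≤ ζ := by positivity
  have pw : ∀ k : X, 0 ≤ weight lam1 lam2 s k := fun k => (weight_pos h1 h2 s k).le
  have hι : ∀ w : WeightedL1 d lam1 lam2 (s + 1), ι w =ᵐ[volume] w := coeFn_incl h1 h2 _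
  have hιs : ∀ t, ι (v t - u t) =ᵐ[volume] ⇑(v t) - ⇑(u t) := fun t =>
    (hι _).trans (coeFn_sub_ae h1 h2 _ _)
  have hmom : ∀ w : WeightedL1 d lam1 lam2 (s + 1), Moments lam1 lam2 s w := fun w =>
    Moments.of_succ h1 h2 hs (measurable_coeFn w) (integrable_coeFn h1 h2 w)
  have hd : ∀ t, 0 ≤ t → HasDerivAt (fun t => ι (v t - u t)) (ι (v' t - u' t)) t := fun t ht =>
    ι.hasFDerivAt.comp_hasDerivAt t ((hv.deriv t ht).sub (hu.deriv t ht))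
  set q : ℝ → X → ℝ := fun t k => truncColl c lam1 lam2 n' (v t) k - truncColl c lam1 lam2 n (u t) k
  have hq : ∀ t ∈ Ioo 0 T, (Integrable fun k => weight lam1 lam2 s k * q t k) ∧
      absInt (weight lam1 lam2 s) (q t) ≤ C * (momKW lam1 lam2 s (⇑(v t) - ⇑(u t))
        + momW lam1 lam2 s (⇑(v t) - ⇑(u t)) + ζ) := by
    intro t ht
    have ht' : t ∈ Icc 0 T := ⟨ht.1.le, ht.2.le⟩
    have hvW : momW lam1 lam2 s (v t) ≤ a * M + M := by
      have := absInt_le_mul pw (fun k => (hA k).2.2.1) (integrable_coeFn h1 h2 (v t))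
      have h4 := hvM t ht'
      rw [norm_eq_absInt h1 h2] at h4
      have : momW lam1 lam2 s (v t) ≤ a * M := this.trans (by gcongr)
      linarith
    have huW : momW lam1 lam2 (s + 1) (u t) ≤ a * M + M := by
      have h4 := huM t ht'
      rw [norm_eq_absInt h1 h2] at h4
      have : 0 ≤ a * M := by positivity
      linarith
    exact hest (u t) (v t) _ _ ζ hζ (hmom _) (hmom _) (integrable_coeFn h1 h2 _) hvW huW
      (measurable_truncKern _ _ _ _ _) (measurable_truncKern _ _ _ _ _)
      (truncKern_abs_le hδ (hvm t ht')) (truncKern_abs_le hδ (hum t ht'))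
      (abs_sub_truncKern_le hδ (hvm t ht') (hum t ht') hn (truncKern_abs_le hδ (hvm t ht'))
        fun p q hpq => truncKern_of_le (hpq.trans hnn))
  have h0 : ‖ι (v 0 - u 0)‖ = momW lam1 lam2 s (g0 - f0) := by
    rw [norm_eq_absInt h1 h2]
    refine absInt_congr ((hιs 0).trans ?_)
    filter_upwards [hu.init, hv.init] with k e1 e2
    simp [e1, e2]
  intro t ht
  have hG := gronwall_weighted h1 h2 hnu (u := fun t => ι (v t - u t)) (T := T) (C := C)
    (K := C + 1) (ε := C * ζ) (q := q)
    (fun x hx => (hd x hx.1).continuousAt.continuousWithinAt) (fun x hx => hd x hx.1.le)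
    (fun x hx => ?_) (fun x hx => (hq x hx).1) (fun x hx => ?_) (fun x hx => ?_) t ht
  · refine hG.trans ((gronwallBound_le (norm_nonneg _) (by positivity) ?_ ht.2).trans ?_)
    · have : 0 ≤ C ^ 2 / (8 * nu) := by positivity
      linarith
    · rw [h0]
      have hm0 : 0 ≤ momW lam1 lam2 s (g0 - f0) := absInt_nonneg pw _
      have e : C * ζ = C * (c ^ 2 / δ) * (1 / n) := by simp only [ζ]; field_simp
      rw [e]
      have i1 : 0 ≤ C * (c ^ 2 / δ) := by positivity
      have i2 : 0 ≤ 1 / n := by positivity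
      have i3 : momW lam1 lam2 s (g0 - f0) + C * (c ^ 2 / δ) * (1 / n)
          ≤ (1 + C * (c ^ 2 / δ)) * (momW lam1 lam2 s (g0 - f0) + 1 / n) := by
        have := mul_nonneg i1 hm0
        linarith
      calc _ ≤ (1 + C * (c ^ 2 / δ)) * (momW lam1 lam2 s (g0 - f0) + 1 / n) * E := by gcongr
        _ = _ := by ring
  · have e : ∀ {m : ℝ} {w w' : ℝ → WeightedL1 d lam1 lam2 (s + 1)} {F : X → ℝ},
        IsTruncSolution c lam1 lam2 nu m (s + 1) F w w' →
        Integrable fun k => ‖k‖ ^ 2 * weight lam1 lam2 s k * w x k := fun {m w w' F} hw => by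
      have hwm := (continuous_weight h1 h2 s (d := d)).measurable
      refine integrable_of_le_mul (C := a)
        (w' := fun k => ‖k‖ ^ 2 * weight lam1 lam2 (s + 1) k) (fun k => ?_) (fun k => ?_)
        (by fun_prop) (measurable_coeFn _) (hw.integrable_normSq h1 h2 hx.1.le)
      · have := pw k; positivity
      · have := (hA k).2.2.1
        calc _ ≤ ‖k‖ ^ 2 * (a * weight lam1 lam2 (s + 1) k) := by gcongr
          _ = _ := by ring
    refine ((e hv).sub (e hu)).congr ?_
    filter_upwards [hιs x] with k hk
    rw [hk]
    simp only [Pi.sub_apply]; ring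
  · filter_upwards [hιs x, hι (v' x - u' x), coeFn_sub_ae h1 h2 (v' x) (u' x), hu.eq x hx.1.le,
      hv.eq x hx.1.le] with k e1 e2 e3 e4 e5
    rw [e1, e2, e3, Pi.sub_apply, Pi.sub_apply, e4, e5]
    simp only [q]; ring
  · refine (hq x hx).2.trans ?_
    simp only [norm_eq_absInt h1 h2, momKW, momW, absInt_congr (hιs x)]
    have : 0 ≤ absInt (weight lam1 lam2 s) (⇑(v x) - ⇑(u x)) := absInt_nonneg pw _
    linarith

end UniformEstimates

/-! ### The sequence of truncated solutions and its limit -/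

section Approximation

variable {d : ℕ} {lam1 lam2 : ℝ}

local notation "X" => EuclideanSpace ℝ (Fin d)

/-- The restriction of a function to the closed ball of radius `r`. -/
def cutoff (r : ℝ) (f : X → ℝ) (k : X) : ℝ := if ‖k‖ ≤ r then f k else 0

theorem measurable_cutoff (r : ℝ) {f : X → ℝ} (hf : Measurable f) : Measurable (cutoff r f) :=
  Measurable.ite (measurableSet_le measurable_norm measurable_const) hf measurable_const

theorem abs_cutoff_le (r : ℝ) (f : X → ℝ) (k : X) : |cutoff r f k| ≤ |f k| := by
  unfold cutoff; split_ifs <;> simp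

theorem integrable_cutoff (r : ℝ) {w f : X → ℝ} (hw : Measurable w) (hf : Measurable f)
    (h : Integrable fun k => w k * f k) : Integrable fun k => w k * cutoff r f k := by
  refine h.mono (hw.mul (measurable_cutoff r hf)).aestronglyMeasurable (ae_of_all _ fun k => ?_)
  rw [norm_mul, norm_mul]
  gcongr
  exact abs_cutoff_le r f k

theorem absInt_cutoff_le (r : ℝ) {w f : X → ℝ} (hw : ∀ k, 0 ≤ w k)
    (h : Integrable fun k => w k * f k) : absInt w (cutoff r f) ≤ absInt w f :=
  integral_mono_of_nonneg (ae_of_all _ fun k => mul_nonneg (hw k) (abs_nonneg _))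
    (integrable_mul_abs hw h)
    (ae_of_all _ fun k => mul_le_mul_of_nonneg_left (abs_cutoff_le r f k) (hw k))

theorem localMass_cutoff {R r : ℝ} (h : R ≤ r) (f : X → ℝ) :
    localMass R (cutoff r f) = localMass R f := by
  refine setIntegral_congr_fun Metric.isOpen_ball.measurableSet fun k hk => ?_
  have : ‖k‖ ≤ r := (mem_ball_zero_iff.1 hk).le.trans h
  simp [cutoff, this]

/-- The difference lives where ‖k‖ > r, so a factor ‖k‖/r may be inserted. This matches the rate 1/n
of the truncation error. -/
theorem momW_cutoff_sub_le (h1 : 0 < lam1) (h2 : 0 < lam2) {s r r' : ℝ} (hr : 0 < r)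
    (hrr : r ≤ r') {f : X → ℝ}
    (hf : Integrable fun k => ‖k‖ * weight lam1 lam2 s k * f k) :
    momW lam1 lam2 s (cutoff r' f - cutoff r f) ≤ momKW lam1 lam2 s f / r := by
  have pw : ∀ k : X, 0 ≤ weight lam1 lam2 s k := fun k => (weight_pos h1 h2 s k).le
  have pkw : ∀ k : X, 0 ≤ ‖k‖ * weight lam1 lam2 s k := fun k => mul_nonneg (norm_nonneg _) (pw k)
  rw [div_eq_inv_mul, momKW, absInt, ← integral_const_mul]
  refine integral_mono_of_nonneg (ae_of_all _ fun k => mul_nonneg (pw k) (abs_nonneg _))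
    ((integrable_mul_abs pkw hf).const_mul _) (ae_of_all _ fun k => ?_)
  have p0 : 0 ≤ weight lam1 lam2 s k * |f k| := mul_nonneg (pw k) (abs_nonneg _)
  have key : |(cutoff r' f - cutoff r f) k| ≤ r⁻¹ * ‖k‖ * |f k| := by
    simp only [Pi.sub_apply, cutoff]
    have h0 : 0 ≤ r⁻¹ * ‖k‖ * |f k| := by positivity
    by_cases a : ‖k‖ ≤ r
    · rw [if_pos a, if_pos (a.trans hrr)]; simpa using h0
    · have : 1 ≤ r⁻¹ * ‖k‖ := by
        rw [← div_eq_inv_mul, one_le_div hr]; exact (not_le.1 a).le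
      rw [if_neg a, sub_zero]
      refine le_trans ?_ (le_mul_of_one_le_left (abs_nonneg _) this)
      split_ifs <;> simp
  simp only
  calc _ ≤ weight lam1 lam2 s k * (r⁻¹ * ‖k‖ * |f k|) := mul_le_mul_of_nonneg_left key (pw k)
    _ = _ := by ring

/-- A sequence of truncated solutions with uniform bounds which is Cauchy. -/
structure IsApprox (h1 : 0 < lam1) (h2 : 0 < lam2) (c nu s A K : ℝ) (f0 : X → ℝ) (r : ℕ → ℝ)
    (U U' : ℕ → ℝ → WeightedL1 d lam1 lam2 (s + 1)) : Prop where
  pos : ∀ n, 0 < r n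
  tendsto : Tendsto r atTop atTop
  sol : ∀ n, IsTruncSolution c lam1 lam2 nu (r n) (s + 1) (cutoff (r n) f0) (U n) (U' n)
  mass : ∀ T, ∃ δ, 0 < δ ∧ ∀ n, ∀ t ∈ Icc 0 T, δ ≤ ∫ k, U n t k
  norm : ∀ n t, 0 ≤ t → ‖U n t‖ ≤ A * Real.exp (K * t)
  cauchy : ∀ T, ∃ D, 0 ≤ D ∧ ∀ n m, n ≤ m → ∀ t ∈ Icc 0 T,
    ‖incl h1 h2 (by linarith : s ≤ s + 1) (U m t - U n t)‖ ≤ D / r n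

/-- All constants are uniform in n: the moment bound because `momentRate` ignores the radius, the
mass bound because every cut-off datum has the same mass in the ball of radius R. -/
theorem exists_isApprox (h1 : 0 < lam1) (h2 : 0 < lam2) (c : ℝ) {nu s R : ℝ} (hs : 0 ≤ s)
    (hnu : 0 < nu) {f0 : X → ℝ} (hf0m : Measurable f0)
    (hf0 : Integrable fun k => weight lam1 lam2 (s + 1) k * f0 k) (hf0p : ∀ᵐ k, 0 ≤ f0 k)
    (hR : 0 < localMass R f0) :
    ∃ (r : ℕ → ℝ) (U U' : ℕ → ℝ → WeightedL1 d lam1 lam2 (s + 1)),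
      IsApprox h1 h2 c nu s (momW lam1 lam2 (s + 1) f0) (momentRate c nu (s + 1)) f0 r U U' := by
  have hs1 : 0 ≤ s + 1 := by linarith
  -- Every truncation ball contains the ball of radius R, where the datum is known to have mass; the
  -- 1 keeps the radii positive.
  set r : ℕ → ℝ := fun n => n + 1 + |R| with hr
  have rpos : ∀ n, 0 < r n := fun n => by positivity
  have rmono : ∀ n m, n ≤ m → r n ≤ r m := fun n m h => by simp only [r]; gcongr
  have hRr : ∀ n, R ≤ r n := fun n => by
    have := le_abs_self R
    have : (0 : ℝ) ≤ n := n.cast_nonneg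
    simp only [r]; linarith
  have hw := (continuous_weight h1 h2 (s + 1) (d := d)).measurable
  have pw : ∀ k : X, 0 ≤ weight lam1 lam2 (s + 1) k := fun k => (weight_pos h1 h2 _ k).le
  have key : ∀ n, ∃ u u' : ℝ → WeightedL1 d lam1 lam2 (s + 1),
      IsTruncSolution c lam1 lam2 nu (r n) (s + 1) (cutoff (r n) f0) u u' := fun n =>
    exists_isTruncSolution h1 h2 c hnu hs1 (rpos n).le (integrable_cutoff _ hw hf0m hf0)
      (hf0p.mono fun k hk => by unfold cutoff; split_ifs <;> simp [hk])
      (ae_of_all _ fun k hk => if_neg hk.not_ge)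
  choose U U' hU using key
  have hmass : ∀ n t, 0 ≤ t → localMass R f0
      * Real.exp (-((2 * nu * R ^ 2 + 2 * c ^ 2 * R) * t)) ≤ ∫ k, U n t k := fun n t ht => by
    have := (hU n).integral_ge h1 h2 hs1 hnu R ht
    rwa [localMass_cutoff (hRr n)] at this
  have hmassT : ∀ T, ∃ δ, 0 < δ ∧ ∀ n, ∀ t ∈ Icc 0 T, δ ≤ ∫ k, U n t k := fun T => by
    refine ⟨localMass R f0 * Real.exp (-(|2 * nu * R ^ 2 + 2 * c ^ 2 * R| * T)), by positivity,
      fun n t ht => le_trans ?_ (hmass n t ht.1)⟩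
    gcongr
    · exact ht.1
    · exact le_abs_self _
    · exact ht.2
  have hnorm : ∀ n t, 0 ≤ t → ‖U n t‖
      ≤ momW lam1 lam2 (s + 1) f0 * Real.exp (momentRate c nu (s + 1) * t) := fun n t ht => by
    refine ((hU n).norm_le h1 h2 hs1 hnu (fun t ht => lt_of_lt_of_le (by positivity)
      (hmass n t ht)) ht).trans ?_
    gcongr
    rw [norm_eq_absInt h1 h2, absInt_congr (hU n).init]
    exact absInt_cutoff_le _ pw hf0
  refine ⟨r, U, U', rpos, ?_, hU, hmassT, hnorm, fun T => ?_⟩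
  · exact tendsto_atTop_add_const_right _ _ (tendsto_atTop_add_const_right _ _
      tendsto_natCast_atTop_atTop)
  · obtain ⟨δ, hδ, hm⟩ := hmassT T
    have hA : 0 ≤ momW lam1 lam2 (s + 1) f0 := absInt_nonneg pw _
    set M := momW lam1 lam2 (s + 1) f0 * Real.exp (momentRate c nu (s + 1) * T)
    have hK : 0 ≤ momentRate c nu (s + 1) := by unfold momentRate; positivity
    have hM : ∀ n, ∀ t ∈ Icc 0 T, ‖U n t‖ ≤ M := fun n t ht => by
      refine (hnorm n t ht.1).trans ?_
      simp only [M]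
      gcongr
      exact ht.2
    obtain ⟨D, hD, hest⟩ := exists_truncSolution_sub_le (d := d) (M := M) h1 h2 c hs hnu hδ
      (by positivity) T
    have hmom := Moments.of_succ h1 h2 hs hf0m hf0
    have hKW : 0 ≤ momKW lam1 lam2 s f0 := absInt_nonneg (fun k =>
      mul_nonneg (norm_nonneg _) (weight_pos h1 h2 s k).le) _
    refine ⟨D * (momKW lam1 lam2 s f0 + 1), by positivity, fun n m hnm t ht => ?_⟩
    refine (hest _ _ _ _ _ _ _ _ (rpos n) (rmono n m hnm) (hU n) (hU m) (hm n) (hm m) (hM n)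
      (hM m) t ht).trans ?_
    rw [mul_div_assoc, add_div]
    gcongr
    exact momW_cutoff_sub_le h1 h2 (rpos n) (rmono n m hnm) hmom.intNormWeight

theorem exists_subseq_tendsto_ae (h1 : 0 < lam1) (h2 : 0 < lam2) {s : ℝ}
    {u : ℕ → WeightedL1 d lam1 lam2 s} {g : WeightedL1 d lam1 lam2 s}
    (h : Tendsto u atTop (𝓝 g)) : ∃ φ : ℕ → ℕ, StrictMono φ ∧
      ∀ᵐ k, Tendsto (fun n => u (φ n) k) atTop (𝓝 (g k)) := by
  obtain ⟨φ, hφ, hae⟩ := (tendstoInMeasure_of_tendsto_Lp h).exists_seq_tendsto_ae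
  exact ⟨φ, hφ, (ae_weighted h1 h2 s).1 hae⟩

theorem nonneg_of_tendsto (h1 : 0 < lam1) (h2 : 0 < lam2) {s : ℝ}
    {u : ℕ → WeightedL1 d lam1 lam2 s} {g : WeightedL1 d lam1 lam2 s}
    (h : Tendsto u atTop (𝓝 g)) (h0 : ∀ n, ∀ᵐ k, 0 ≤ u n k) : ∀ᵐ k, 0 ≤ g k := by
  obtain ⟨φ, -, hae⟩ := exists_subseq_tendsto_ae h1 h2 h
  filter_upwards [hae, ae_all_iff.2 h0] with k e1 e2
  exact ge_of_tendsto' e1 fun n => e2 _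

/-- Fatou's lemma: a higher moment passes to the limit. -/
theorem absInt_le_of_tendsto (h1 : 0 < lam1) (h2 : 0 < lam2) {s A : ℝ} {w : X → ℝ}
    (hw : Measurable w) (hw0 : ∀ k, 0 ≤ w k)
    {u : ℕ → WeightedL1 d lam1 lam2 s} {g : WeightedL1 d lam1 lam2 s}
    (h : Tendsto u atTop (𝓝 g)) (hi : ∀ n, Integrable fun k => w k * u n k)
    (hA : ∀ n, absInt w (u n) ≤ A) :
    (Integrable fun k => w k * g k) ∧ absInt w g ≤ A := by
  obtain ⟨φ, -, hae⟩ := exists_subseq_tendsto_ae h1 h2 h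
  have hA0 : 0 ≤ A := (absInt_nonneg hw0 _).trans (hA 0)
  refine integrable_weight_mul hw hw0 (measurable_coeFn g) hA0 ?_
  have e : ∀ᵐ k, ENNReal.ofReal (w k) * ‖g k‖ₑ
      = liminf (fun n => ENNReal.ofReal (w k) * ‖u (φ n) k‖ₑ) atTop := by
    filter_upwards [hae] with k hk
    exact (ENNReal.Tendsto.const_mul hk.enorm (Or.inr ENNReal.ofReal_ne_top)).liminf_eq.symm
  rw [lintegral_congr_ae e]
  refine (lintegral_liminf_le fun n =>
    hw.ennreal_ofReal.mul (measurable_coeFn (u (φ n))).enorm).trans ?_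
  refine (liminf_le_liminf (v := fun _ => ENNReal.ofReal A) (Eventually.of_forall fun n => ?_)).trans
    (by simp)
  exact (ofReal_absInt hw0 (hi (φ n))).le.trans (ENNReal.ofReal_le_ofReal (hA _))

end Approximation

/-! ### Limits of the truncated solutions and of their time derivatives -/

section Limit

variable {d : ℕ} {lam1 lam2 : ℝ}

local notation "X" => EuclideanSpace ℝ (Fin d)

/-- A global solution with one derivative in `L¹_s` and bounded moments of order `s + 3`. -/
structure IsRegularSolution (c lam1 lam2 nu s A K : ℝ) (f0 : X → ℝ)
    (f f' : ℝ → WeightedL1 d lam1 lam2 s) : Prop where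
  init : f 0 =ᵐ[volume] f0
  cont : ContinuousOn f (Ici 0)
  deriv : ∀ t, 0 < t → HasDerivAt f (f' t) t
  cont_deriv : ContinuousOn f' (Ioi 0)
  nonneg : ∀ t, 0 ≤ t → ∀ᵐ k, 0 ≤ f t k
  mass : ∀ T, ∃ δ, 0 < δ ∧ ∀ t ∈ Icc 0 T, δ ≤ ∫ k, f t k
  int : ∀ t, 0 ≤ t → Integrable fun k => weight lam1 lam2 (s + 3) k * f t k
  moment : ∀ t, 0 ≤ t → momW lam1 lam2 (s + 3) (f t) ≤ A * Real.exp (K * t)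
  eq : ∀ t, 0 < t → ∀ᵐ k, f' t k = -(2 * nu * ‖k‖ ^ 2 * f t k) + collision c lam1 lam2 (f t) k

/-- The right-hand side of the equation. -/
def field (c lam1 lam2 nu : ℝ) (f : X → ℝ) (k : X) : ℝ :=
  -(2 * nu * ‖k‖ ^ 2 * f k) + polColl (kern c lam1 lam2 (∫ p, f p)) f f k

/-- Completeness at each time, then m → ∞ in the Cauchy estimate to keep the rate. The value at time
t is chosen once, so a single G serves every T; at negative times it is arbitrary. -/
theorem IsApprox.exists_limit {h1 : 0 < lam1} {h2 : 0 < lam2} {c nu s A K : ℝ} {f0 : X → ℝ}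
    {r : ℕ → ℝ} {U U' : ℕ → ℝ → WeightedL1 d lam1 lam2 (s + 1)}
    (h : IsApprox h1 h2 c nu s A K f0 r U U') :
    ∃ G : ℝ → WeightedL1 d lam1 lam2 s, ∀ T, ∃ D, 0 ≤ D ∧ ∀ n, ∀ t ∈ Icc 0 T,
      ‖G t - incl h1 h2 (by linarith : s ≤ s + 1) (U n t)‖ ≤ D / r n := by
  have hlim : ∀ D, Tendsto (fun n => D / r n) atTop (𝓝 0) := fun D =>
    h.tendsto.const_div_atTop D
  have key : ∀ t, ∃ g : WeightedL1 d lam1 lam2 s, 0 ≤ t → Tendsto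
      (fun n => incl h1 h2 (by linarith : s ≤ s + 1) (U n t)) atTop (𝓝 g) := fun t => by
    by_cases ht : 0 ≤ t
    · obtain ⟨D, -, hc⟩ := h.cauchy t
      obtain ⟨g, hg⟩ := cauchySeq_tendsto_of_complete (cauchySeq_of_le_tendsto_0'
        (s := fun n => incl h1 h2 (by linarith : s ≤ s + 1) (U n t)) _ (fun n m hnm => by
          have := hc n m hnm t ⟨ht, le_rfl⟩
          rwa [map_sub, ← dist_eq_norm, dist_comm] at this) (hlim D))
      exact ⟨g, fun _ => hg⟩
    · exact ⟨0, fun h => absurd h ht⟩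
  choose G hG using key
  refine ⟨G, fun T => ?_⟩
  obtain ⟨D, hD, hc⟩ := h.cauchy T
  refine ⟨D, hD, fun n t ht => ?_⟩
  refine le_of_tendsto ((hG t ht.1).sub_const _).norm ?_
  filter_upwards [eventually_ge_atTop n] with m hm
  simpa only [map_sub] using hc n m hm t ht

theorem tendstoUniformlyOn_of_norm_le {E : Type*} [NormedAddCommGroup E] {F : ℕ → ℝ → E}
    {G : ℝ → E} {S : Set ℝ} {r : ℕ → ℝ} {D : ℝ} (hr : Tendsto r atTop atTop)
    (h : ∀ n, ∀ t ∈ S, ‖G t - F n t‖ ≤ D / r n) : TendstoUniformlyOn F G atTop S := by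
  rw [Metric.tendstoUniformlyOn_iff]
  intro ε hε
  filter_upwards [(hr.const_div_atTop D).eventually (gt_mem_nhds hε)] with n hn t ht
  rw [dist_eq_norm]
  exact (h n t ht).trans_lt hn

theorem norm_sq_weight_bound (h1 : 0 < lam1) (h2 : 0 < lam2) (nu s : ℝ) (k : X) :
    |-(2 * nu * ‖k‖ ^ 2)| * weight lam1 lam2 s k
      ≤ 2 * |nu| * lam2⁻¹ * weight lam1 lam2 (s + 2) k := by
  rw [abs_neg, abs_mul, abs_mul, abs_of_nonneg (sq_nonneg ‖k‖), abs_two]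
  have := norm_sq_mul_weight_le h1 h2 s k
  calc _ = 2 * |nu| * (‖k‖ ^ 2 * weight lam1 lam2 s k) := by ring
    _ ≤ 2 * |nu| * (lam2⁻¹ * weight lam1 lam2 (s + 2) k) := by gcongr
    _ = _ := by ring

theorem integrable_field (h1 : 0 < lam1) (h2 : 0 < lam2) (c nu : ℝ) {s : ℝ} (hs : 0 ≤ s)
    (g : WeightedL1 d lam1 lam2 (s + 2)) (hg : 0 < ∫ k, g k) :
    Integrable fun k => weight lam1 lam2 s k * field c lam1 lam2 nu g k := by
  have hmom : Moments lam1 lam2 s g := Moments.of_le h1 h2 hs (by linarith) (measurable_coeFn g)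
    (integrable_coeFn h1 h2 g)
  have e1 := (polColl_estimate h1 h2 hs (β := c ^ 2 / (2 * ∫ k, g k)) (by positivity)
    (measurable_kern c lam1 lam2 (∫ k, g k)) (kern_abs_le hg le_rfl) hmom).2.1
  have e2 := integrable_mul_of_abs_le h1 h2 (s' := s) (w := fun k : X => -(2 * nu * ‖k‖ ^ 2))
    (by fun_prop) (norm_sq_weight_bound h1 h2 nu s) g
  refine (e2.add e1).congr (ae_of_all _ fun k => ?_)
  simp only [Pi.add_apply, field]
  ring

/-- The viscous term costs two powers of the weight and the collisions one, so a rate in L¹_{s+2}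
for the solutions becomes the same rate in L¹_s for the time derivatives. -/
theorem IsApprox.exists_deriv_sub_le {h1 : 0 < lam1} {h2 : 0 < lam2} {c nu s A K : ℝ} {f0 : X → ℝ}
    {r : ℕ → ℝ} {U U' : ℕ → ℝ → WeightedL1 d lam1 lam2 (s + 2 + 1)} (hs : 0 ≤ s)
    (h : IsApprox h1 h2 c nu (s + 2) A K f0 r U U') {G : ℝ → WeightedL1 d lam1 lam2 (s + 2)}
    {F : ℝ → WeightedL1 d lam1 lam2 s} {T D δ M : ℝ} (hδ : 0 < δ)
    (hUm : ∀ n, ∀ t ∈ Icc 0 T, δ ≤ ∫ k, U n t k) (hGm : ∀ t ∈ Icc 0 T, δ ≤ ∫ k, G t k)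
    (hF : ∀ t ∈ Icc 0 T, F t =ᵐ[volume] field c lam1 lam2 nu (G t))
    (hU : ∀ n, ∀ t ∈ Icc 0 T, ‖U n t‖ ≤ M) (hG : ∀ t ∈ Icc 0 T, ‖G t‖ ≤ M)
    (hGU : ∀ n, ∀ t ∈ Icc 0 T,
      ‖G t - incl h1 h2 (by linarith : s + 2 ≤ s + 2 + 1) (U n t)‖ ≤ D / r n) :
    ∃ D', ∀ n, ∀ t ∈ Icc 0 T,
      ‖F t - incl h1 h2 (by linarith : s ≤ s + 2 + 1) (U' n t)‖ ≤ D' / r n := by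
  by_cases hT : T < 0
  · exact ⟨0, fun n t ht => absurd (ht.1.trans ht.2) hT.not_ge⟩
  have hM : 0 ≤ M := (norm_nonneg _).trans (hG 0 ⟨le_rfl, not_lt.1 hT⟩)
  obtain ⟨a, ha, hA⟩ := exists_weight_bound (d := d) h1 h2 hs
  set a2 := √lam1 ^ (s - (s + 2))
  set a3 := √lam1 ^ (s + 1 - (s + 2 + 1))
  set a4 := √lam1 ^ (s + 1 - (s + 2))
  have pa2 : 0 ≤ a2 := Real.rpow_nonneg (Real.sqrt_nonneg _) _
  have pa3 : 0 ≤ a3 := Real.rpow_nonneg (Real.sqrt_nonneg _) _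
  have pa4 : 0 ≤ a4 := Real.rpow_nonneg (Real.sqrt_nonneg _) _
  obtain ⟨C, hC, hest⟩ := exists_polColl_sub_le (d := d) (M := a2 * M + a3 * M) h1 h2 c hs hδ
    (by positivity)
  refine ⟨2 * |nu| * lam2⁻¹ * D + C * (a * (a4 * D) + a2 * D + c ^ 2 / δ), fun n t ht => ?_⟩
  have rp := h.pos n
  have pw : ∀ x, ∀ k : X, 0 ≤ weight lam1 lam2 x k := fun x k => (weight_pos h1 h2 x k).le
  set ι := incl (d := d) h1 h2 (by linarith : s + 2 ≤ s + 2 + 1)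
  set u := ι (U n t)
  have hu : u =ᵐ[volume] U n t := coeFn_incl h1 h2 _ _
  have hsub := coeFn_sub_ae h1 h2 (G t) u
  have hmom : ∀ w : WeightedL1 d lam1 lam2 (s + 2), Moments lam1 lam2 s w := fun w =>
    Moments.of_le h1 h2 hs (by linarith) (measurable_coeFn w) (integrable_coeFn h1 h2 w)
  have hUi : Integrable fun k => weight lam1 lam2 (s + 1) k * U n t k :=
    integrable_of_le_mul (pw _) (fun k => weight_le_weight h1 h2 (by linarith) k)
      (continuous_weight h1 h2 _).measurable (measurable_coeFn _) (integrable_coeFn h1 h2 (U n t))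
  have hζ : 0 ≤ c ^ 2 / (δ * r n) := by positivity
  have hgW : momW lam1 lam2 s (G t) ≤ a2 * M + a3 * M := by
    have e := absInt_le_mul (pw s) (fun k => weight_le_weight h1 h2 (by linarith : s ≤ s + 2) k)
      (integrable_coeFn h1 h2 (G t))
    rw [← norm_eq_absInt h1 h2] at e
    have e2 : momW lam1 lam2 s (G t) ≤ a2 * M :=
      e.trans (mul_le_mul_of_nonneg_left (hG t ht) pa2)
    have : 0 ≤ a3 * M := by positivity
    linarith
  have huW : momW lam1 lam2 (s + 1) (U n t) ≤ a2 * M + a3 * M := by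
    have e := absInt_le_mul (pw (s + 1)) (fun k => weight_le_weight h1 h2
      (by linarith : s + 1 ≤ s + 2 + 1) k) (integrable_coeFn h1 h2 (U n t))
    rw [← norm_eq_absInt h1 h2] at e
    have e2 : momW lam1 lam2 (s + 1) (U n t) ≤ a3 * M :=
      e.trans (mul_le_mul_of_nonneg_left (hU n t ht) pa3)
    have : 0 ≤ a2 * M := by positivity
    linarith
  obtain ⟨q1, q2⟩ := hest (U n t) (G t) (kern c lam1 lam2 (∫ k, G t k))
    (truncKern c lam1 lam2 (r n) (∫ k, U n t k)) _ hζ ((hmom u).congr (measurable_coeFn _) hu)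
    (hmom (G t)) hUi hgW huW (measurable_kern _ _ _ _) (measurable_truncKern _ _ _ _ _)
    (kern_abs_le hδ (hGm t ht)) (truncKern_abs_le hδ (hUm n t ht))
    (abs_sub_truncKern_le hδ (hGm t ht) (hUm n t ht) rp (kern_abs_le hδ (hGm t ht))
      fun _ _ _ => rfl)
  have hdiff : (⇑(G t) - ⇑(U n t)) =ᵐ[volume] ⇑(G t - u) := by
    filter_upwards [hsub, hu] with k e1 e2
    rw [e1, Pi.sub_apply, Pi.sub_apply, e2]
  have hn := hGU n t ht
  rw [norm_eq_absInt h1 h2] at hn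
  have hi := integrable_coeFn h1 h2 (G t - u)
  have w0 : momW lam1 lam2 s (⇑(G t) - ⇑(U n t)) ≤ a2 * (D / r n) := by
    rw [momW, absInt_congr hdiff]
    exact (absInt_le_mul (pw s) (fun k => weight_le_weight h1 h2 (by linarith : s ≤ s + 2) k)
      hi).trans (mul_le_mul_of_nonneg_left hn pa2)
  have w1 : momKW lam1 lam2 s (⇑(G t) - ⇑(U n t)) ≤ a * (a4 * (D / r n)) := by
    rw [momKW, absInt_congr hdiff]
    have hb : ∀ k : X, ‖k‖ * weight lam1 lam2 s k ≤ a * a4 * weight lam1 lam2 (s + 2) k :=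
      fun k => ((hA k).2.2.2).trans (by
        rw [mul_assoc]
        exact mul_le_mul_of_nonneg_left (weight_le_weight h1 h2 (by linarith) k) ha.le)
    refine (absInt_le_mul (fun k => mul_nonneg (norm_nonneg _) (pw s k)) hb hi).trans ?_
    rw [mul_assoc]
    gcongr
  set P : X → ℝ := fun k => -(2 * nu * ‖k‖ ^ 2) * (G t - u) k
  have iP : Integrable fun k => weight lam1 lam2 s k * P k :=
    integrable_mul_of_abs_le h1 h2 (s' := s) (w := fun k : X => -(2 * nu * ‖k‖ ^ 2))
      (by fun_prop) (norm_sq_weight_bound h1 h2 nu s) (G t - u)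
  have bP : absInt (weight lam1 lam2 s) P ≤ 2 * |nu| * lam2⁻¹ * (D / r n) := by
    have e : absInt (weight lam1 lam2 s) P
        = absInt (fun k => |-(2 * nu * ‖k‖ ^ 2)| * weight lam1 lam2 s k) (G t - u) := by
      refine integral_congr_ae (ae_of_all _ fun k => ?_)
      simp only [P, abs_mul (-(2 * nu * ‖k‖ ^ 2))]
      ring
    rw [e]
    refine (absInt_le_mul (fun k => mul_nonneg (abs_nonneg _) (pw s k))
      (norm_sq_weight_bound h1 h2 nu s) hi).trans ?_
    gcongr
  have hsplit : ⇑(F t - incl h1 h2 (by linarith : s ≤ s + 2 + 1) (U' n t)) =ᵐ[volume]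
      P + fun k => polColl (kern c lam1 lam2 (∫ k, G t k)) (G t) (G t) k
        - polColl (truncKern c lam1 lam2 (r n) (∫ k, U n t k)) (U n t) (U n t) k := by
    filter_upwards [coeFn_sub_ae h1 h2 (F t) (incl h1 h2 (by linarith : s ≤ s + 2 + 1) (U' n t)),
      coeFn_incl h1 h2 (by linarith : s ≤ s + 2 + 1) (U' n t), hF t ht, (h.sol n).eq t ht.1,
      hdiff] with k e1 e2 e3 e4 e5
    rw [e1, Pi.sub_apply, e2, e3, e4, field, truncColl, Pi.add_apply]
    simp only [P, ← e5, Pi.sub_apply]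
    ring
  rw [norm_eq_absInt h1 h2, absInt_congr hsplit]
  refine (absInt_add_le (pw s) iP q1).trans ((add_le_add bP q2).trans ?_)
  have hmul := mul_le_mul_of_nonneg_left
    (add_le_add (add_le_add w1 w0) (le_refl (c ^ 2 / (δ * r n)))) hC
  refine (add_le_add le_rfl hmul).trans (le_of_eq ?_)
  field_simp

end Limit

/-! ### Passage to the limit and global existence -/

section Existence

variable {d : ℕ} {lam1 lam2 : ℝ}

local notation "X" => EuclideanSpace ℝ (Fin d)

theorem tendsto_integral_of_tendsto (h1 : 0 < lam1) (h2 : 0 < lam2) {s : ℝ} (hs : 0 ≤ s)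
    {u : ℕ → WeightedL1 d lam1 lam2 s} {g : WeightedL1 d lam1 lam2 s}
    (h : Tendsto u atTop (𝓝 g)) : Tendsto (fun n => ∫ k, u n k) atTop (𝓝 (∫ k, g k)) := by
  have hC : ∀ k : X, |(1 : ℝ)| ≤ √lam1 ^ (-s) * weight lam1 lam2 s k := fun k => by
    simpa using one_le_weight h1 h2 hs k
  have := ((testCLM h1 h2 (fun _ => 1) measurable_const hC).continuous.tendsto g).comp h
  simpa only [Function.comp_def, testCLM_apply, one_mul] using this

theorem field_congr_ae (c lam1 lam2 nu : ℝ) {f g : X → ℝ} (h : f =ᵐ[volume] g) :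
    field c lam1 lam2 nu f =ᵐ[volume] fun k =>
      -(2 * nu * ‖k‖ ^ 2 * g k) + collision c lam1 lam2 g k := by
  filter_upwards [h, collision_congr_ae c lam1 lam2 h] with k e1 e2
  rw [field, ← collision_eq_polColl, e1, e2]

theorem continuousOn_Ici_of_Icc {E : Type*} [TopologicalSpace E] {f : ℝ → E}
    (h : ∀ T, ContinuousOn f (Icc 0 T)) : ContinuousOn f (Ici 0) := fun t ht =>
  (h (t + 1) t ⟨ht, by linarith⟩).mono_of_mem_nhdsWithin
    (inter_mem self_mem_nhdsWithin (mem_nhdsWithin_of_mem_nhds (Iic_mem_nhds (by linarith))))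

/-- The truncated solutions live in L¹_{s+3}, converge in L¹_{s+2}, and their derivatives converge
in L¹_s, both uniformly on compact time intervals; hence the limit is C¹ in L¹_s for positive times.
The moment of order s + 3 does not converge but passes to the limit by Fatou's lemma. -/
theorem IsApprox.exists_isRegularSolution {h1 : 0 < lam1} {h2 : 0 < lam2} {c nu s A K : ℝ}
    {f0 : X → ℝ} {r : ℕ → ℝ} {U U' : ℕ → ℝ → WeightedL1 d lam1 lam2 (s + 2 + 1)} (hs : 0 ≤ s)
    (hK : 0 ≤ K) (h : IsApprox h1 h2 c nu (s + 2) A K f0 r U U') :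
    ∃ f f' : ℝ → WeightedL1 d lam1 lam2 s, IsRegularSolution c lam1 lam2 nu s A K f0 f f' := by
  have hs2 : 0 ≤ s + 2 := by linarith
  have hs3 : s + 3 = s + 2 + 1 := by ring
  obtain ⟨G, hG⟩ := h.exists_limit
  set ι := incl (d := d) h1 h2 (by linarith : s + 2 ≤ s + 2 + 1)
  set j := incl (d := d) h1 h2 (by linarith : s ≤ s + 2)
  set J := incl (d := d) h1 h2 (by linarith : s ≤ s + 2 + 1)
  have hι : ∀ w : WeightedL1 d lam1 lam2 (s + 2 + 1), ι w =ᵐ[volume] w := coeFn_incl h1 h2 _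
  have hj : ∀ w : WeightedL1 d lam1 lam2 (s + 2), j w =ᵐ[volume] w := coeFn_incl h1 h2 _
  have hJ : ∀ w : WeightedL1 d lam1 lam2 (s + 2 + 1), J w =ᵐ[volume] w := coeFn_incl h1 h2 _
  have hjι : ∀ w, j (ι w) = J w := fun w => ext_ae h1 h2 <| by
    filter_upwards [hj (ι w), hι w, hJ w] with k e1 e2 e3
    rw [e1, e2, e3]
  have hunif : ∀ T, TendstoUniformlyOn (fun n t => ι (U n t)) G atTop (Icc 0 T) := fun T => by
    obtain ⟨D, -, hD⟩ := hG T
    exact tendstoUniformlyOn_of_norm_le h.tendsto hD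
  have hlim : ∀ t, 0 ≤ t → Tendsto (fun n => ι (U n t)) atTop (𝓝 (G t)) := fun t ht =>
    (hunif t).tendsto_at ⟨ht, le_rfl⟩
  have hUc : ∀ n, ContinuousOn (U n) (Ici 0) := fun n => (h.sol n).continuousOn
  have hGc : ContinuousOn G (Ici 0) := continuousOn_Ici_of_Icc fun T =>
    (hunif T).continuousOn (Frequently.of_forall fun n =>
      ι.continuous.comp_continuousOn ((hUc n).mono fun x hx => hx.1))
  have hnonneg : ∀ t, 0 ≤ t → ∀ᵐ k, 0 ≤ G t k := fun t ht =>
    nonneg_of_tendsto h1 h2 (hlim t ht) fun n => by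
      filter_upwards [hι (U n t), (h.sol n).nonneg t ht] with k e1 e2
      rw [e1]; exact e2
  have hmass : ∀ T, ∃ δ, 0 < δ ∧ (∀ n, ∀ t ∈ Icc 0 T, δ ≤ ∫ k, U n t k) ∧
      ∀ t ∈ Icc 0 T, δ ≤ ∫ k, G t k := fun T => by
    obtain ⟨δ, hδ, hm⟩ := h.mass T
    refine ⟨δ, hδ, hm, fun t ht => ?_⟩
    refine ge_of_tendsto' (tendsto_integral_of_tendsto h1 h2 hs2 (hlim t ht.1)) fun n => ?_
    rw [integral_congr_ae (hι _)]
    exact hm n t ht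
  have hpos : ∀ t, 0 ≤ t → 0 < ∫ k, G t k := fun t ht => by
    obtain ⟨δ, hδ, -, hm⟩ := hmass t
    exact hδ.trans_le (hm t ⟨ht, le_rfl⟩)
  have hA0 : 0 ≤ A := by simpa using (norm_nonneg _).trans (h.norm 0 0 le_rfl)
  have hmoment : ∀ t, 0 ≤ t → (Integrable fun k => weight lam1 lam2 (s + 3) k * G t k) ∧
      momW lam1 lam2 (s + 3) (G t) ≤ A * Real.exp (K * t) := fun t ht => by
    rw [hs3]
    refine absInt_le_of_tendsto h1 h2 (continuous_weight h1 h2 _).measurable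
      (fun k => (weight_pos h1 h2 _ k).le) (hlim t ht) (fun n => ?_) fun n => ?_
    · exact (integrable_coeFn h1 h2 (U n t)).congr ((hι (U n t)).mono fun k hk => by
        simp only [hk])
    · rw [absInt_congr (hι (U n t)), ← norm_eq_absInt h1 h2]
      exact h.norm n t ht
  have hinit : G 0 =ᵐ[volume] f0 := by
    obtain ⟨φ, hφ, hae⟩ := exists_subseq_tendsto_ae h1 h2 (hlim 0 le_rfl)
    filter_upwards [hae, ae_all_iff.2 fun n => hι (U n 0), ae_all_iff.2 fun n => (h.sol n).init]
      with k e1 e2 e3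
    -- At a fixed k the cut-off datum equals f0 k as soon as the radius exceeds ‖k‖.
    refine tendsto_nhds_unique e1 (tendsto_const_nhds.congr' ?_)
    filter_upwards [(h.tendsto.comp hφ.tendsto_atTop).eventually_ge_atTop ‖k‖] with n hn
    rw [e2, e3]
    exact (if_pos hn).symm
  have hF : ∀ t, ∃ v : WeightedL1 d lam1 lam2 s, 0 ≤ t →
      v =ᵐ[volume] field c lam1 lam2 nu (G t) := fun t => by
    by_cases ht : 0 ≤ t
    · exact ⟨_, fun _ => coeFn_ofFun h1 h2 (integrable_field h1 h2 c nu hs (G t) (hpos t ht))⟩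
    · exact ⟨0, fun h => absurd h ht⟩
  choose F hF using hF
  have hunif' : ∀ T, TendstoUniformlyOn (fun n t => J (U' n t)) F atTop (Icc 0 T) := fun T => by
    obtain ⟨D, hD0, hD⟩ := hG T
    obtain ⟨δ, hδ, hm1, hm2⟩ := hmass T
    set M := A * Real.exp (K * T)
    have hM : ∀ n, ∀ t ∈ Icc 0 T, ‖U n t‖ ≤ M := fun n t ht => by
      refine (h.norm n t ht.1).trans ?_
      simp only [M]; gcongr; exact ht.2
    have hM0 : 0 ≤ M := by positivity
    have hr0 := h.pos 0
    have hGM : ∀ t ∈ Icc 0 T, ‖G t‖ ≤ M + (D / r 0 + ‖ι‖ * M) := fun t ht => by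
      have e1 := norm_add_le (G t - ι (U 0 t)) (ι (U 0 t))
      rw [sub_add_cancel] at e1
      have e2 := (ι.le_opNorm (U 0 t)).trans (mul_le_mul_of_nonneg_left (hM 0 t ht)
        (norm_nonneg ι))
      have e3 := hD 0 t ht
      linarith
    have hp : 0 ≤ D / r 0 + ‖ι‖ * M := by positivity
    obtain ⟨D', hD'⟩ := h.exists_deriv_sub_le hs hδ hm1 hm2 (fun t ht => hF t ht.1)
      (fun n t ht => (hM n t ht).trans (le_add_of_nonneg_right hp)) hGM hD
    exact tendstoUniformlyOn_of_norm_le h.tendsto hD'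
  refine ⟨fun t => j (G t), F, (hj _).trans hinit, j.continuous.comp_continuousOn hGc,
    fun t ht => ?_, fun t ht => ?_, fun t ht => ?_, fun T => ?_, fun t ht => ?_, fun t ht => ?_,
    fun t ht => ?_⟩
  · refine hasDerivAt_of_tendstoUniformlyOn (l := atTop) (f := fun n t => J (U n t)) isOpen_Ioo
      ((hunif' (t + 1)).mono Ioo_subset_Icc_self) (Eventually.of_forall fun n x hx =>
        J.hasFDerivAt.comp_hasDerivAt x ((h.sol n).deriv x hx.1.le)) (fun x hx => ?_)
      (⟨ht, by linarith⟩ : t ∈ Ioo 0 (t + 1))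
    simpa only [Function.comp_def, hjι] using (j.continuous.tendsto _).comp (hlim x hx.1.le)
  · have ht0 : 0 < t := ht
    have hc : ContinuousOn F (Icc 0 (t + 1)) := (hunif' (t + 1)).continuousOn
      (Frequently.of_forall fun n => J.continuous.comp_continuousOn
        ((h.sol n).cont_deriv.mono fun x hx => hx.1))
    exact (hc.continuousAt (Icc_mem_nhds ht0 (by linarith))).continuousWithinAt
  · filter_upwards [hj (G t), hnonneg t ht] with k e1 e2
    rw [e1]; exact e2
  · obtain ⟨δ, hδ, -, hm⟩ := hmass T
    refine ⟨δ, hδ, fun t ht => ?_⟩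
    rw [integral_congr_ae (hj (G t))]
    exact hm t ht
  · exact (hmoment t ht).1.congr ((hj (G t)).mono fun k hk => by simp only [hk])
  · rw [momW, absInt_congr (hj (G t))]
    exact (hmoment t ht).2
  · exact (hF t ht.le).trans (field_congr_ae c lam1 lam2 nu (hj (G t)).symm)

theorem exists_isRegularSolution (h1 : 0 < lam1) (h2 : 0 < lam2) (c : ℝ) {nu s R : ℝ}
    (hs : 0 ≤ s) (hnu : 0 < nu) {f0 : X → ℝ} (hf0m : Measurable f0)
    (hf0 : Integrable fun k => weight lam1 lam2 (s + 3) k * f0 k) (hf0p : ∀ᵐ k, 0 ≤ f0 k)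
    (hR : 0 < localMass R f0) :
    ∃ f f' : ℝ → WeightedL1 d lam1 lam2 s, IsRegularSolution c lam1 lam2 nu s
      (momW lam1 lam2 (s + 3) f0) (momentRate c nu (s + 3)) f0 f f' := by
  have hs3 : s + 3 = s + 2 + 1 := by ring
  rw [hs3] at hf0 ⊢
  obtain ⟨r, U, U', h⟩ := exists_isApprox h1 h2 c (by linarith : 0 ≤ s + 2) hnu hf0m hf0 hf0p hR
  exact h.exists_isRegularSolution hs (by unfold momentRate; positivity)

end Existence

/-! ### Regularity and uniqueness of strong solutions -/

section Uniqueness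

variable {d : ℕ} {lam1 lam2 : ℝ}

local notation "X" => EuclideanSpace ℝ (Fin d)

/-- The collision operator loses at most one power of `|k|` on `L¹_s`. -/
theorem integrable_polColl_div (h1 : 0 < lam1) (h2 : 0 < lam2) {s β : ℝ} (hs : 0 ≤ s)
    (hβ : 0 ≤ β) {b : X → X → ℝ} (hbm : Measurable (Function.uncurry b))
    (hb : ∀ p q x, InTriad p q x → |b p q| ≤ β * ‖x‖) (g : WeightedL1 d lam1 lam2 s) :
    Integrable fun k => weight lam1 lam2 s k / (1 + ‖k‖) * polColl b g g k := by
  have hw := (continuous_weight h1 h2 s (d := d)).measurable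
  have pw : ∀ k : X, 0 ≤ weight lam1 lam2 s k := fun k => (weight_pos h1 h2 s k).le
  have hφ : Measurable fun k : X => weight lam1 lam2 s k / (1 + ‖k‖) := by fun_prop
  have key : ∀ p q x y k, IsPair p q x y → InTriad p q k →
      ENNReal.ofReal (weight lam1 lam2 s k / (1 + ‖k‖)) * ‖b p q‖ₑ
        ≤ ENNReal.ofReal (β * 2 ^ s * (weight lam1 lam2 s x + weight lam1 lam2 s y)) := by
    intro p q x y k hxy hk
    have pk := pw k
    rw [← ofReal_norm, ← ENNReal.ofReal_mul (by positivity)]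
    refine ENNReal.ofReal_le_ofReal ?_
    rw [Real.norm_eq_abs]
    -- The kernel is bounded through the output variable k, so dividing by 1 + ‖k‖ exactly removes
    -- the loss and no moment above order s is needed.
    calc _ ≤ weight lam1 lam2 s k / (1 + ‖k‖) * (β * ‖k‖) := by gcongr; exact hb p q k hk
      _ = β * weight lam1 lam2 s k * (‖k‖ / (1 + ‖k‖)) := by ring
      _ ≤ β * weight lam1 lam2 s k * 1 := by
        gcongr
        rw [div_le_one (by positivity)]; linarith
      _ = β * weight lam1 lam2 s k := mul_one _
      _ ≤ β * (2 ^ s * (weight lam1 lam2 s x + weight lam1 lam2 s y)) := by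
        gcongr; exact hxy.weight_le h1 h2 hs hk
      _ = _ := by ring
  have hdom : Dominates (fun p q => ENNReal.ofReal
      (β * 2 ^ s * (weight lam1 lam2 s p + weight lam1 lam2 s q)))
      (fun k => ENNReal.ofReal (weight lam1 lam2 s k / (1 + ‖k‖))) b :=
    ⟨fun p q => by rw [add_comm],
      (((hw.comp measurable_fst).add (hw.comp measurable_snd)).const_mul _).ennreal_ofReal,
      fun p q k => key p q p q k (by simp [IsPair]),
      fun p q k => key p q (p + q) p k (by simp [IsPair]),
      fun p q k => key p q (p + q) q k (by simp [IsPair])⟩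
  have hg := measurable_coeFn g
  have p1 : ∀ k : X, 0 ≤ β * 2 ^ s * weight lam1 lam2 s k := fun k => by
    have := pw k; positivity
  have i1 : Integrable fun k => β * 2 ^ s * weight lam1 lam2 s k * g k := by
    simpa only [mul_assoc] using! (integrable_coeFn h1 h2 g).const_mul (β * 2 ^ s)
  have i2 : Integrable fun k => (1 : ℝ) * g k := by
    simpa using integrable_coeFn_of_nonneg_weight h1 h2 hs g
  have E := lintegral_absColl_le_of_two (a₁ := fun k => β * 2 ^ s * weight lam1 lam2 s k)
    (b₁ := fun _ => 1) (a₂ := fun _ => 1) (b₂ := fun k => β * 2 ^ s * weight lam1 lam2 s k) hdom hφ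
    hbm hg hg (fun p q => by linarith) p1 (fun _ => zero_le_one) (fun _ => zero_le_one) p1
    (by fun_prop) (by fun_prop) (by fun_prop) (by fun_prop) i1 i2 i2 i1
  refine (integrable_weight_mul hφ (fun k => by have := pw k; positivity)
    (measurable_polColl hbm hg hg) ?_ ((lintegral_mono fun k => ?_).trans E)).1
  · have := absInt_nonneg p1 g
    have := absInt_nonneg (w := fun _ => 1) (fun _ => zero_le_one) g
    positivity
  · gcongr
    exact enorm_polColl_le _ _ _ _

/-- A solution has two more moments than the space in which its time derivative lies. -/
theorem integrable_normSq_of_eq (h1 : 0 < lam1) (h2 : 0 < lam2) {c nu s : ℝ} (hs : 0 ≤ s)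
    (hnu : 0 < nu) {g g' : WeightedL1 d lam1 lam2 s} (hm : 0 < ∫ k, g k)
    (heq : ∀ᵐ k, g' k = -(2 * nu * ‖k‖ ^ 2 * g k) + collision c lam1 lam2 g k) :
    Integrable fun k => ‖k‖ ^ 2 * weight lam1 lam2 s k * g k := by
  rw [collision_eq_polColl] at heq
  have hw := (continuous_weight h1 h2 s (d := d)).measurable
  have pw : ∀ k : X, 0 ≤ weight lam1 lam2 s k := fun k => (weight_pos h1 h2 s k).le
  have mg := measurable_coeFn g
  have ig := integrable_coeFn h1 h2 g
  have ig' := integrable_coeFn h1 h2 g'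
  have hb := kern_abs_le (c := c) (lam1 := lam1) (lam2 := lam2) (d := d) hm le_rfl
  have hbm := measurable_kern (d := d) c lam1 lam2 (∫ k, g k)
  have hβ : 0 ≤ c ^ 2 / (2 * ∫ k, g k) := by positivity
  -- The regularity is gained in two rounds. Here the equation, solved for 2ν‖k‖² g and divided by 1
  -- + ‖k‖, gains one power of ‖k‖ using only that g and g' lie in L¹_s.
  have half : Integrable fun k => (‖k‖ ^ 2 * weight lam1 lam2 s k) / (1 + ‖k‖) * g k := by
    have e1 := integrable_polColl_div h1 h2 hs hβ hbm hb g
    have e2 : Integrable fun k => weight lam1 lam2 s k / (1 + ‖k‖) * g' k :=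
      integrable_of_weight_le (fun k => div_nonneg (pw k) (by positivity))
        (fun k => div_le_self (pw k) (by linarith [norm_nonneg k])) (by fun_prop)
        (measurable_coeFn g') ig'
    refine ((e1.sub e2).const_mul (2 * nu)⁻¹).congr ?_
    filter_upwards [heq] with k hk
    have : 1 + ‖k‖ ≠ 0 := by positivity
    rw [Pi.sub_apply, hk]
    field_simp
    ring
  have hKW : Integrable fun k => ‖k‖ * weight lam1 lam2 s k * g k := by
    refine integrable_of_weight_le (w' := fun k => (‖k‖ ^ 2 * weight lam1 lam2 s k) / (1 + ‖k‖)
      + weight lam1 lam2 s k) (fun k => mul_nonneg (norm_nonneg _) (pw k)) (fun k => ?_)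
      (by fun_prop) mg (by simpa only [add_mul] using! half.add ig)
    have e : (‖k‖ ^ 2 * weight lam1 lam2 s k) / (1 + ‖k‖) + weight lam1 lam2 s k
        - ‖k‖ * weight lam1 lam2 s k = weight lam1 lam2 s k / (1 + ‖k‖) := by
      have : 1 + ‖k‖ ≠ 0 := by positivity
      field_simp; ring
    have : 0 ≤ weight lam1 lam2 s k / (1 + ‖k‖) := div_nonneg (pw k) (by positivity)
    linarith
  -- With the first power in hand the collision term lies in L¹_s itself, and the undivided equation
  -- yields the second power.
  have e1 := (polColl_estimate h1 h2 hs hβ hbm hb (Moments.of_int h1 h2 hs mg ig hKW)).2.1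
  refine ((e1.sub ig').const_mul (2 * nu)⁻¹).congr ?_
  filter_upwards [heq] with k hk
  rw [Pi.sub_apply, hk]
  field_simp
  ring

theorem collision_ge (h1 : 0 < lam1) (h2 : 0 < lam2) (c : ℝ) {s : ℝ} (hs : 0 ≤ s)
    {g : WeightedL1 d lam1 lam2 s} (hg : ∀ᵐ k, 0 ≤ g k) :
    ∀ᵐ k, -(2 * c ^ 2 * ‖k‖ * g k) ≤ collision c lam1 lam2 g k := by
  have hm : 0 ≤ ∫ k, g k := integral_nonneg_of_ae hg
  rw [collision_eq_polColl]
  exact polColl_ge (integrable_coeFn_of_nonneg_weight h1 h2 hs g) hg (kern_nonneg hm)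
    fun p q x hx => mass_mul_kern_le hm hx

/-- Local lower bound of the mass of a solution. -/
theorem localMass_ge_of_eq (h1 : 0 < lam1) (h2 : 0 < lam2) {c nu s T : ℝ} (hs : 0 ≤ s)
    (hnu : 0 < nu) {f0 : X → ℝ} {g g' : ℝ → WeightedL1 d lam1 lam2 s} (hinit : g 0 =ᵐ[volume] f0)
    (hg : ContinuousOn g (Ico 0 T)) (hg' : ∀ t ∈ Ioo 0 T, HasDerivAt g (g' t) t)
    (hg0 : ∀ t ∈ Ico 0 T, ∀ᵐ k, 0 ≤ g t k)
    (heq : ∀ t ∈ Ioo 0 T, ∀ᵐ k,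
      g' t k = -(2 * nu * ‖k‖ ^ 2 * g t k) + collision c lam1 lam2 (g t) k) (R : ℝ) :
    ∀ t ∈ Ico 0 T, localMass R f0 * Real.exp (-((2 * nu * R ^ 2 + 2 * c ^ 2 * R) * t))
      ≤ ∫ k, g t k := by
  intro t ht
  have := localMass_ge (c := c) h1 h2 hs hnu hg hg' hg0 (fun t ht => ?_) R t ht
  · rw [localMass_congr hinit] at this
    exact this.trans (localMass_le_integral (integrable_coeFn_of_nonneg_weight h1 h2 hs _)
      (hg0 t ht))
  · filter_upwards [heq t ht, collision_ge h1 h2 c hs (hg0 t ⟨ht.1.le, ht.2⟩)] with k e1 e2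
    rw [e1]
    linarith

/-- A comparison of an arbitrary strong solution g with the regular one f: the moment bound of order
above s is demanded only from f. The extra moments of g supplied by `integrable_normSq_of_eq` are
used merely as finiteness at each positive time, without uniform control as t → 0. -/
theorem IsRegularSolution.eq_of_eq (h1 : 0 < lam1) (h2 : 0 < lam2) {c nu s A K T R : ℝ}
    (hs : 0 ≤ s) (hnu : 0 < nu) (hK : 0 ≤ K) {f0 : X → ℝ}
    {f f' g g' : ℝ → WeightedL1 d lam1 lam2 s}
    (hf : IsRegularSolution c lam1 lam2 nu s A K f0 f f') (hR : 0 < localMass R f0)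
    (hinit : g 0 =ᵐ[volume] f0)
    (hg : ContinuousOn g (Ico 0 T)) (hg' : ∀ t ∈ Ioo 0 T, HasDerivAt g (g' t) t)
    (hg0 : ∀ t ∈ Ico 0 T, ∀ᵐ k, 0 ≤ g t k)
    (heq : ∀ t ∈ Ioo 0 T, ∀ᵐ k,
      g' t k = -(2 * nu * ‖k‖ ^ 2 * g t k) + collision c lam1 lam2 (g t) k) :
    ∀ t ∈ Ico 0 T, g t = f t := by
  intro τ hτ
  have pw : ∀ x, ∀ k : X, 0 ≤ weight lam1 lam2 x k := fun x k => (weight_pos h1 h2 x k).le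
  have hsub : Icc 0 τ ⊆ Ico 0 T := fun t ht => ⟨ht.1, ht.2.trans_lt hτ.2⟩
  have hsub' : Ioo 0 τ ⊆ Ioo 0 T := fun t ht => ⟨ht.1, ht.2.trans hτ.2⟩
  obtain ⟨δ, hδ, hfδ, hgδ⟩ : ∃ δ, 0 < δ ∧ (∀ t ∈ Icc 0 τ, δ ≤ ∫ k, f t k) ∧
      ∀ t ∈ Icc 0 τ, δ ≤ ∫ k, g t k := by
    obtain ⟨δ, hδ, hm⟩ := hf.mass τ
    set δ' := localMass R f0 * Real.exp (-(|2 * nu * R ^ 2 + 2 * c ^ 2 * R| * τ))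
    refine ⟨min δ δ', lt_min hδ (by positivity), fun t ht => (min_le_left _ _).trans (hm t ht),
      fun t ht => (min_le_right _ _).trans (le_trans ?_ (localMass_ge_of_eq h1 h2 hs hnu hinit hg
        hg' hg0 heq R t (hsub ht)))⟩
    simp only [δ']
    gcongr
    · exact ht.1
    · exact le_abs_self _
    · exact ht.2
  -- The only uniform bound on g is continuity in L¹_s on a compact interval.
  obtain ⟨B, hB⟩ := isCompact_Icc.exists_bound_of_continuousOn (hg.mono hsub)
  have hB0 : 0 ≤ B := (norm_nonneg _).trans (hB 0 ⟨le_rfl, hτ.1⟩)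
  have hA0 : 0 ≤ A := by
    simpa using (absInt_nonneg (pw _) _).trans (hf.moment 0 le_rfl)
  set a := √lam1 ^ (s + 1 - (s + 3))
  have pa : 0 ≤ a := Real.rpow_nonneg (Real.sqrt_nonneg _) _
  obtain ⟨C, hC, hest⟩ := exists_polColl_sub_le (d := d) (M := B + a * (A * Real.exp (K * τ)))
    h1 h2 c hs hδ (by positivity)
  have feq : ∀ t ∈ Ioo 0 τ, _ := fun t ht => hf.eq t ht.1
  have hf2 : ∀ t ∈ Ioo 0 τ, Integrable fun k => ‖k‖ ^ 2 * weight lam1 lam2 s k * f t k :=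
    fun t ht => integrable_normSq_of_eq h1 h2 hs hnu
      (hδ.trans_le (hfδ t ⟨ht.1.le, ht.2.le⟩)) (feq t ht)
  have hg2 : ∀ t ∈ Ioo 0 τ, Integrable fun k => ‖k‖ ^ 2 * weight lam1 lam2 s k * g t k :=
    fun t ht => integrable_normSq_of_eq h1 h2 hs hnu
      (hδ.trans_le (hgδ t ⟨ht.1.le, ht.2.le⟩)) (heq t (hsub' ht))
  have hmom : ∀ w : WeightedL1 d lam1 lam2 s, (Integrable fun k =>
      ‖k‖ ^ 2 * weight lam1 lam2 s k * w k) → Moments lam1 lam2 s w := fun w hw =>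
    Moments.of_int h1 h2 hs (measurable_coeFn w) (integrable_coeFn h1 h2 w)
      (integrable_norm_of_normSq h1 h2 (measurable_coeFn w) (integrable_coeFn h1 h2 w) hw)
  set q : ℝ → X → ℝ := fun t k => collision c lam1 lam2 (g t) k - collision c lam1 lam2 (f t) k
  have hq : ∀ t ∈ Ioo 0 τ, (Integrable fun k => weight lam1 lam2 s k * q t k) ∧
      absInt (weight lam1 lam2 s) (q t) ≤ C * (momKW lam1 lam2 s (⇑(g t) - ⇑(f t))
        + momW lam1 lam2 s (⇑(g t) - ⇑(f t)) + 0) := by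
    intro t ht
    have ht' : t ∈ Icc 0 τ := ⟨ht.1.le, ht.2.le⟩
    simp only [q, collision_eq_polColl]
    refine hest (f t) (g t) _ _ 0 le_rfl (hmom _ (hf2 t ht)) (hmom _ (hg2 t ht)) ?_ ?_ ?_
      (measurable_kern _ _ _ _) (measurable_kern _ _ _ _) (kern_abs_le hδ (hgδ t ht'))
      (kern_abs_le hδ (hfδ t ht')) fun p r x y hxy => ?_
    · exact integrable_of_le_mul (pw _) (fun k => weight_le_weight h1 h2 (by linarith) k)
        (continuous_weight h1 h2 _).measurable (measurable_coeFn _) (hf.int t ht.1.le)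
    · rw [momW, ← norm_eq_absInt h1 h2]
      have := hB t ht'
      have : 0 ≤ a * (A * Real.exp (K * τ)) := by positivity
      linarith
    · have e := absInt_le_mul (pw (s + 1)) (fun k => weight_le_weight h1 h2
        (by linarith : s + 1 ≤ s + 3) k) (hf.int t ht.1.le)
      have e2 : A * Real.exp (K * t) ≤ A * Real.exp (K * τ) := by
        gcongr; exact ht.2.le
      have e3 : momW lam1 lam2 (s + 1) (f t) ≤ a * (A * Real.exp (K * τ)) :=
        e.trans (mul_le_mul_of_nonneg_left ((hf.moment t ht.1.le).trans e2) pa)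
      linarith
    · have := kern_abs_sub_le (c := c) (lam1 := lam1) (lam2 := lam2) hδ (hgδ t ht') (hfδ t ht')
        p r x hxy.fst
      linarith
  have hG := gronwall_weighted h1 h2 hnu (u := fun t => g t - f t) (u' := fun t => g' t - f' t)
    (T := τ) (C := C) (K := C) (ε := 0) (q := q)
    ((hg.mono hsub).sub (hf.cont.mono fun t ht => ht.1))
    (fun t ht => (hg' t (hsub' ht)).sub (hf.deriv t ht.1)) (fun t ht => ?_)
    (fun t ht => (hq t ht).1) (fun t ht => ?_) (fun t ht => ?_) τ ⟨hτ.1, le_rfl⟩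
  · have h0 : g 0 - f 0 = 0 := sub_eq_zero.2 (ext_ae h1 h2 (hinit.trans hf.init.symm))
    rw [h0, norm_zero, show ∀ L x, gronwallBound 0 L 0 x = 0 by simp [gronwallBound]] at hG
    exact sub_eq_zero.1 (norm_le_zero_iff.1 hG)
  · refine ((hg2 t ht).sub (hf2 t ht)).congr ?_
    filter_upwards [coeFn_sub_ae h1 h2 (g t) (f t)] with k e
    rw [e]
    simp only [Pi.sub_apply]; ring
  · filter_upwards [coeFn_sub_ae h1 h2 (g t) (f t), coeFn_sub_ae h1 h2 (g' t) (f' t), feq t ht,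
      heq t (hsub' ht)] with k e1 e2 e3 e4
    rw [e1, e2, Pi.sub_apply, Pi.sub_apply, e3, e4]
    simp only [q]; ring
  · refine (hq t ht).2.trans (le_of_eq ?_)
    simp only [norm_eq_absInt h1 h2, momKW, momW, absInt_congr (coeFn_sub_ae h1 h2 (g t) (f t))]
    ring

theorem collisionConverges_of_moments (h1 : 0 < lam1) (h2 : 0 < lam2) (c : ℝ) {s : ℝ} (hs : 0 ≤ s)
    {f : X → ℝ} (hf : Moments lam1 lam2 s f) (hm : 0 < ∫ k, f k) :
    CollisionConverges c lam1 lam2 f := by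
  have hbm := measurable_kern (d := d) c lam1 lam2 (∫ k, f k)
  filter_upwards [(polColl_estimate h1 h2 hs (β := c ^ 2 / (2 * ∫ k, f k)) (by positivity) hbm
    (kern_abs_le hm le_rfl) hf).1] with k hk
  constructor
  · exact (integrable_gainIntegrand hbm hf.meas hf.meas hk).congr
      (ae_of_all _ fun q => gainIntegrand_kern c lam1 lam2 f k q)
  · exact (integrable_lossIntegrand hbm hf.meas hf.meas hk).congr
      (ae_of_all _ fun q => lossIntegrand_kern c lam1 lam2 f k q)

end Uniqueness

/-! ### A priori bounds for the global solution -/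

section Bounds

variable {d : ℕ} {lam1 lam2 : ℝ}

local notation "X" => EuclideanSpace ℝ (Fin d)

theorem localMass_mono {R R' : ℝ} (h : R ≤ R') {f : X → ℝ} (hf : Integrable f) :
    localMass R f ≤ localMass R' f :=
  setIntegral_mono_set hf.abs.integrableOn (ae_of_all _ fun _ => abs_nonneg _)
    (Metric.ball_subset_ball h).eventuallyLE

theorem localMass_le_integral_abs (R : ℝ) {f : X → ℝ} (hf : Integrable f) :
    localMass R f ≤ ∫ k, |f k| :=
  setIntegral_le_integral hf.abs (ae_of_all _ fun _ => abs_nonneg _)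

theorem exists_localMass_pos {f : X → ℝ} (hf : Integrable f) (h : 0 < ∫ k, |f k|) :
    ∃ R : ℝ, 0 ≤ R ∧ 0 < localMass R f := by
  have hU : ⋃ n : ℕ, Metric.ball (0 : X) n = univ := Metric.iUnion_ball_nat 0
  have := tendsto_setIntegral_of_monotone (μ := volume) (f := fun k : X => |f k|)
    (s := fun n : ℕ => Metric.ball (0 : X) n) (fun n => Metric.isOpen_ball.measurableSet)
    (fun n m hnm => Metric.ball_subset_ball (by exact_mod_cast hnm)) hf.abs.integrableOn
  rw [hU, setIntegral_univ] at this
  obtain ⟨n, hn⟩ := (this.eventually_const_lt h).exists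
  exact ⟨n, n.cast_nonneg, hn⟩

/-- Here K is the actual growth rate of the moments, and the coefficient of T on the right has the
form of `growthRate`. Since 1 + e^{ET} ≥ R₀T, the last term is at least C₀R₀T²/m0 ≥ K²T²/2, while KT
≤ 1/2 + K²T²/2. The requirement on R₀ therefore does not involve T, and the price is a factor
e^{1/2}. -/
theorem mul_le_half_add {C0 μ m0 K R0 E T : ℝ} (hC0 : 0 < C0) (hμ : 0 < μ) (hμm : μ ≤ m0)
    (hK : K ^ 2 * m0 ≤ 2 * C0 * R0) (hE : R0 ≤ E) (hT : 0 ≤ T) :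
    K * T ≤ 1 / 2 + C0 * (1 + Real.exp (E * T)) / μ * T := by
  have hm0 : 0 < m0 := hμ.trans_le hμm
  have e1 : R0 * T ≤ 1 + Real.exp (E * T) := by
    have h1 := Real.add_one_le_exp (E * T)
    have h2 : R0 * T ≤ E * T := mul_le_mul_of_nonneg_right hE hT
    linarith
  have e2 : C0 * (R0 * T) / m0 ≤ C0 * (1 + Real.exp (E * T)) / μ := by gcongr
  have e3 : C0 * (R0 * T) / m0 * T ≤ C0 * (1 + Real.exp (E * T)) / μ * T :=
    mul_le_mul_of_nonneg_right e2 hT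
  have e4 : K ^ 2 / 2 * T ^ 2 ≤ C0 * (R0 * T) / m0 * T := by
    have : K ^ 2 / 2 ≤ C0 * R0 / m0 := by
      rw [le_div_iff₀ hm0]; linarith
    calc _ ≤ C0 * R0 / m0 * T ^ 2 := mul_le_mul_of_nonneg_right this (sq_nonneg T)
      _ = _ := by ring
  nlinarith [sq_nonneg (K * T - 1)]

theorem exp_half_le_two : Real.exp (1 / 2) ≤ 2 := by
  have h := Real.add_one_le_exp (-(1 / 2) : ℝ)
  rw [Real.exp_neg] at h
  have h2 : (2 : ℝ)⁻¹ ≤ (Real.exp (1 / 2))⁻¹ := by norm_num at h ⊢; linarith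
  exact (inv_le_inv₀ (by norm_num) (Real.exp_pos _)).1 h2

/-- An exponential lower bound valid for all times from one for short and one for long times. -/
theorem mul_exp_neg_le {m0 μ A ℓ D t m : ℝ} (hm0 : 0 < m0) (hμ : 0 < μ) (hA : 0 < A)
    (hshort : t ≤ 1 → m0 - A * t ≤ m) (hlong : μ * Real.exp (-(ℓ * t)) ≤ m) (ht : 0 ≤ t)
    (hD1 : 2 * A / m0 ≤ D) (hD2 : ℓ + m0 / μ / min 1 (m0 / (2 * A)) ≤ D) :
    m0 * Real.exp (-(D * t)) ≤ m := by
  -- Until t0 the linear bound is still at least m0/2, and D ≥ 2A/m0 makes the exponential lie below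
  -- it.
  set t0 := min 1 (m0 / (2 * A))
  have ht0 : 0 < t0 := lt_min one_pos (by positivity)
  have hD0 : 0 < D := lt_of_lt_of_le (by positivity) hD1
  rcases le_or_gt t t0 with h | h
  · refine le_trans ?_ (hshort (h.trans (min_le_left _ _)))
    have hle : t ≤ m0 / (2 * A) := h.trans (min_le_right _ _)
    rw [le_div_iff₀ (by positivity)] at hle
    rw [div_le_iff₀ hm0] at hD1
    have h1 := Real.add_one_le_exp (D * t)
    have hDt : 0 ≤ D * t := by positivity
    rw [Real.exp_neg, ← div_eq_mul_inv, div_le_iff₀ (Real.exp_pos _)]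
    have hpos : 0 ≤ m0 - A * t := by nlinarith
    refine le_trans ?_ (mul_le_mul_of_nonneg_left h1 hpos)
    have e : (m0 - A * t) * (D * t + 1) = m0 + t * (D * m0 - A) - A * t * (D * t) := by ring
    have e2 : A * t * (D * t) ≤ m0 / 2 * (D * t) := mul_le_mul_of_nonneg_right (by linarith) hDt
    have e3 : 0 ≤ t * (D * m0 / 2 - A) := mul_nonneg ht (by linarith)
    nlinarith
  · refine le_trans ?_ hlong
    have h1 : m0 / μ ≤ (D - ℓ) * t0 := by
      rw [← div_le_iff₀ ht0]; linarith
    have h2 : (D - ℓ) * t0 ≤ (D - ℓ) * t := by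
      have : 0 ≤ D - ℓ := by
        have : 0 < m0 / μ / t0 := by positivity
        linarith
      exact mul_le_mul_of_nonneg_left h.le this
    have h3 := Real.add_one_le_exp ((D - ℓ) * t)
    have h4 : m0 / μ ≤ Real.exp ((D - ℓ) * t) := by linarith
    rw [div_le_iff₀ hμ] at h4
    have e : Real.exp (-(ℓ * t)) = Real.exp ((D - ℓ) * t) * Real.exp (-(D * t)) := by
      rw [← Real.exp_add]; ring_nf
    rw [e, ← mul_assoc, mul_comm μ]
    exact mul_le_mul_of_nonneg_right h4 (Real.exp_pos _).le

/-- The loss rate is controlled by the weight. -/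
theorem exists_lossRate_le (h1 : 0 < lam1) (h2 : 0 < lam2) (c nu : ℝ) {s : ℝ} (hs : 2 ≤ s) :
    ∃ κ, 0 ≤ κ ∧ ∀ k : X, |2 * nu * ‖k‖ ^ 2 + 2 * c ^ 2 * ‖k‖| ≤ κ * weight lam1 lam2 s k := by
  have hq := Real.sqrt_pos.2 h1
  have hq2 := Real.sqrt_pos.2 h2
  refine ⟨2 * |nu| * (lam2⁻¹ * √lam1 ^ (0 + 2 - s))
    + 2 * c ^ 2 * ((√lam2)⁻¹ * √lam1 ^ (0 + 1 - s)), by positivity, fun k => ?_⟩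
  have e1 : ‖k‖ ^ 2 ≤ lam2⁻¹ * √lam1 ^ (0 + 2 - s) * weight lam1 lam2 s k := by
    have a := norm_sq_mul_weight_le h1 h2 0 k
    rw [weight_zero, mul_one] at a
    rw [mul_assoc]
    refine a.trans ?_
    gcongr
    exact weight_le_weight h1 h2 (by linarith) k
  have e2 : ‖k‖ ≤ (√lam2)⁻¹ * √lam1 ^ (0 + 1 - s) * weight lam1 lam2 s k := by
    have a := norm_mul_weight_le h1 h2 0 k
    rw [weight_zero, mul_one] at a
    rw [mul_assoc]
    refine a.trans ?_
    gcongr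
    exact weight_le_weight h1 h2 (by linarith) k
  calc _ ≤ |2 * nu * ‖k‖ ^ 2| + |2 * c ^ 2 * ‖k‖| := abs_add_le _ _
    _ = 2 * |nu| * ‖k‖ ^ 2 + 2 * c ^ 2 * ‖k‖ := by
      rw [abs_mul, abs_mul, abs_two, abs_of_nonneg (sq_nonneg ‖k‖),
        abs_of_nonneg (by positivity : 0 ≤ 2 * c ^ 2 * ‖k‖)]
    _ ≤ 2 * |nu| * (lam2⁻¹ * √lam1 ^ (0 + 2 - s) * weight lam1 lam2 s k)
        + 2 * c ^ 2 * ((√lam2)⁻¹ * √lam1 ^ (0 + 1 - s) * weight lam1 lam2 s k) := by gcongr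
    _ = _ := by ring

/-- The mass decays at most linearly for short times. -/
theorem IsRegularSolution.exists_mass_ge (h1 : 0 < lam1) (h2 : 0 < lam2) {c nu s A K : ℝ}
    (hs : 0 ≤ s) (hK : 0 ≤ K) {f0 : X → ℝ} {f f' : ℝ → WeightedL1 d lam1 lam2 s}
    (hf : IsRegularSolution c lam1 lam2 nu s A K f0 f f') :
    ∃ B, 0 < B ∧ ∀ t, 0 ≤ t → t ≤ 1 → (∫ k, f 0 k) - B * t ≤ ∫ k, f t k := by
  obtain ⟨κ, hκ, hκw⟩ := exists_lossRate_le (d := d) h1 h2 c nu (by linarith : 2 ≤ s + 3)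
  have hA0 : 0 ≤ A := by
    simpa using (absInt_nonneg (fun k => (weight_pos h1 h2 _ k).le) _).trans (hf.moment 0 le_rfl)
  -- The weight of order s + 3 controls the loss rate, and its moment is at most A e^K on [0, 1];
  -- the added 1 only makes B positive.
  set B := κ * (A * Real.exp K) + 1 with hB
  refine ⟨B, by positivity, fun t ht0 ht1 => ?_⟩
  have hC : ∀ k : X, |(1 : ℝ)| ≤ √lam1 ^ (-s) * weight lam1 lam2 s k := fun k => by
    simpa using one_le_weight h1 h2 hs k
  let Λ : WeightedL1 d lam1 lam2 s →L[ℝ] ℝ := testCLM h1 h2 (fun _ => 1) measurable_const hC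
  have hΛ : ∀ w, Λ w = ∫ k, w k := fun w => by simp only [Λ, testCLM_apply, one_mul]
  have hd : ∀ t ∈ Ioo (0 : ℝ) 1, HasDerivAt (fun t => Λ (f t) + B * t) (Λ (f' t) + B * 1) t :=
    fun t ht => (Λ.hasFDerivAt.comp_hasDerivAt t (hf.deriv t ht.1)).add
      ((hasDerivAt_id t).const_mul B)
  have hmono : MonotoneOn (fun t => Λ (f t) + B * t) (Icc 0 1) := by
    refine monotoneOn_of_deriv_nonneg (convex_Icc 0 1) ((Λ.continuous.comp_continuousOn
      (hf.cont.mono fun x hx => hx.1)).add (by fun_prop)) ?_ ?_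
    · rw [interior_Icc]
      exact fun t ht => (hd t ht).differentiableAt.differentiableWithinAt
    · rw [interior_Icc]
      intro t ht
      rw [(hd t ht).deriv, hΛ]
      have hi := (integrable_mul_abs (fun k => (weight_pos h1 h2 _ k).le)
        (hf.int t ht.1.le)).const_mul κ
      have hle : ∫ k, -(κ * (weight lam1 lam2 (s + 3) k * |f t k|)) ≤ ∫ k, f' t k := by
        refine integral_mono_ae hi.neg (integrable_coeFn_of_nonneg_weight h1 h2 hs _) ?_
        filter_upwards [hf.eq t ht.1, collision_ge h1 h2 c hs (hf.nonneg t ht.1.le),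
          hf.nonneg t ht.1.le] with k e1 e2 e3
        have e4 := mul_le_mul_of_nonneg_right ((le_abs_self _).trans (hκw k)) e3
        rw [e1, abs_of_nonneg e3]
        linarith
      rw [integral_neg, integral_const_mul] at hle
      have hm := hf.moment t ht.1.le
      rw [momW, absInt] at hm
      have e5 : A * Real.exp (K * t) ≤ A * Real.exp K := by
        gcongr
        exact mul_le_of_le_one_right hK ht.2.le
      have e6 := mul_le_mul_of_nonneg_left (hm.trans e5) hκ
      linarith
  have := hmono (⟨le_rfl, zero_le_one⟩ : (0 : ℝ) ∈ Icc (0 : ℝ) 1) ⟨ht0, ht1⟩ ht0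
  simp only [hΛ, mul_zero, add_zero] at this
  linarith

theorem IsRegularSolution.isStrongSolution {c nu s A K : ℝ}
    {f0 : X → ℝ} {f f' : ℝ → WeightedL1 d lam1 lam2 s}
    (hf : IsRegularSolution c lam1 lam2 nu s A K f0 f f') (T : ℝ) :
    IsStrongSolution c lam1 lam2 nu s f0 T f where
  nonneg t ht := hf.nonneg t ht.1
  continuousOn := hf.cont.mono fun t ht => ht.1
  contDiffOn := by
    rw [show (1 : WithTop ℕ∞) = 0 + 1 from rfl, contDiffOn_succ_iff_deriv_of_isOpen isOpen_Ioo]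
    refine ⟨fun t ht => (hf.deriv t ht.1).differentiableAt.differentiableWithinAt, by simp, ?_⟩
    rw [contDiffOn_zero]
    exact (hf.cont_deriv.mono fun t ht => ht.1).congr fun t ht => (hf.deriv t ht.1).deriv
  equation t ht := by
    rw [(hf.deriv t ht.1).deriv]
    filter_upwards [hf.eq t ht.1] with k hk
    rw [hk]; ring
  initial := hf.init

theorem IsRegularSolution.eq_of_isStrongSolution (h1 : 0 < lam1) (h2 : 0 < lam2)
    {c nu s A K T R : ℝ} (hs : 0 ≤ s) (hnu : 0 < nu) (hK : 0 ≤ K) {f0 : X → ℝ}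
    {f f' g : ℝ → WeightedL1 d lam1 lam2 s}
    (hf : IsRegularSolution c lam1 lam2 nu s A K f0 f f') (hR : 0 < localMass R f0)
    (hg : IsStrongSolution c lam1 lam2 nu s f0 T g) : ∀ t ∈ Ico 0 T, g t = f t := by
  refine hf.eq_of_eq h1 h2 hs hnu hK hR (g' := _root_.deriv g) hg.initial hg.continuousOn
    (fun t ht => ?_) hg.nonneg fun t ht => ?_
  · exact ((hg.contDiffOn.differentiableOn one_ne_zero).differentiableAt
      (Ioo_mem_nhds ht.1 ht.2)).hasDerivAt
  · filter_upwards [hg.equation t ht] with k hk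
    rw [← hk]; ring

/-- The hypothesis Rlow/2 ≤ ∫|f0| leaves no constant to spare, so the lower bound must be m0 e^{-Dt}
with the full mass m0. The decay estimate in a ball alone would lose the factor μ/m0; the linear
bound at short times repairs this. For the moments there is room: the factor e^{1/2} ≤ 2 is absorbed
by 2R_* + 1. -/
theorem IsRegularSolution.mem_invariantSet (h1 : 0 < lam1) (h2 : 0 < lam2)
    {c nu s A K Rup Rlow R C0 : ℝ} (hs : 0 ≤ s) (hnu : 0 < nu) (hK : 0 ≤ K) (hC0 : 0 < C0)
    (hR0 : 0 ≤ R) {f0 : X → ℝ} {f f' : ℝ → WeightedL1 d lam1 lam2 s}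
    (hf : IsRegularSolution c lam1 lam2 nu s A K f0 f f') (hR : 0 < localMass R f0)
    (hA : A ≤ Rup) (hlow : Rlow / 2 ≤ ∫ k, |f0 k|) :
    ∃ Rmin : ℝ, 0 < Rmin ∧ ∀ R0 : ℝ, Rmin ≤ R0 → 0 < localMass R0 f0 ∧
      ∀ T : ℝ, 0 < T → ∀ t ∈ Ico 0 T,
        (f t : X → ℝ) ∈ invariantSet lam1 lam2 nu s Rup Rlow C0 R0 T f0 T := by
  have if0 : Integrable f0 := (integrable_coeFn_of_nonneg_weight h1 h2 hs (f 0)).congr hf.init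
  obtain ⟨B, hB, hBm⟩ := hf.exists_mass_ge h1 h2 hs hK
  have habs : ∀ t, 0 ≤ t → ∫ k, |f t k| = ∫ k, f t k := fun t ht =>
    integral_congr_ae ((hf.nonneg t ht).mono fun k hk => abs_of_nonneg hk)
  set m0 := ∫ k, |f0 k|
  have hm0e : ∫ k, f 0 k = m0 := by
    rw [← habs 0 le_rfl]
    exact integral_congr_ae (hf.init.mono fun k hk => by simp only [hk])
  set μ := localMass R f0
  have hμm : μ ≤ m0 := localMass_le_integral_abs R if0
  have hm0 : 0 < m0 := hR.trans_le hμm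
  set ℓ := 2 * nu * R ^ 2 + 2 * c ^ 2 * R
  have hℓ : 0 ≤ ℓ := by positivity
  set t0 := min 1 (m0 / (2 * B))
  have ht0 : 0 < t0 := lt_min one_pos (by positivity)
  have q1 : 0 ≤ K ^ 2 * m0 / (2 * C0) := by positivity
  have q2 : 0 < 2 * B / m0 := by positivity
  have q3 : 0 < m0 / μ / t0 := by positivity
  -- One summand for each requirement: R for positive local mass, the second for `mul_le_half_add`,
  -- the last two for the conditions on D in `mul_exp_neg_le`, as `decayRate` is at least R0. None
  -- of them involves T.
  refine ⟨R + K ^ 2 * m0 / (2 * C0) + 2 * B / m0 + (ℓ + m0 / μ / t0), by linarith,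
    fun R0 hRmin => ?_⟩
  have hR0R : R ≤ R0 := by linarith
  have hR0nn : 0 ≤ R0 := by linarith
  have hloc : 0 < localMass R0 f0 := hR.trans_le (localMass_mono hR0R if0)
  refine ⟨hloc, fun T hT t ht => ?_⟩
  have hE : R0 ≤ 4 * nu * R0 ^ 2 + 8 * R0 := by
    have : 0 ≤ 4 * nu * R0 ^ 2 := by positivity
    linarith
  refine ⟨memLp_one_iff_integrable.2 ((integrable_weighted h1 h2 _).2 (hf.int t ht.1)),
    hf.nonneg t ht.1, ?_, ?_⟩
  · have hA0 : 0 ≤ A := by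
      simpa using (absInt_nonneg (fun k => (weight_pos h1 h2 _ k).le) _).trans
        (hf.moment 0 le_rfl)
    have e0 : weightedNorm lam1 lam2 (s + 3) (f t) = momW lam1 lam2 (s + 3) (f t) :=
      integral_congr_ae (ae_of_all _ fun k => mul_comm _ _)
    have hKm : K ^ 2 * m0 ≤ 2 * C0 * R0 := by
      have : K ^ 2 * m0 / (2 * C0) ≤ R0 := by linarith
      rwa [div_le_iff₀ (by positivity), mul_comm R0] at this
    have key := mul_le_half_add hC0 hloc (localMass_le_integral_abs R0 if0) hKm hE hT.le
    have e1 : K * t ≤ K * T := mul_le_mul_of_nonneg_left ht.2.le hK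
    rw [e0]
    calc _ ≤ A * Real.exp (K * t) := hf.moment t ht.1
      _ ≤ Rup * Real.exp (1 / 2 + growthRate nu C0 R0 T f0 * T) := by
        refine mul_le_mul hA (Real.exp_le_exp.2 (e1.trans key)) (Real.exp_pos _).le
          (hA0.trans hA)
      _ = Rup * Real.exp (1 / 2) * Real.exp (growthRate nu C0 R0 T f0 * T) := by
        rw [Real.exp_add]; ring
      _ ≤ (2 * Rup + 1) * Real.exp (growthRate nu C0 R0 T f0 * T) := by
        refine mul_le_mul_of_nonneg_right ?_ (Real.exp_pos _).le
        have := mul_le_mul_of_nonneg_left exp_half_le_two (hA0.trans hA)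
        linarith
  · rw [habs t ht.1]
    have hlong := localMass_ge_of_eq (T := T) h1 h2 hs hnu hf.init
      (hf.cont.mono fun x hx => hx.1) (fun x hx => hf.deriv x hx.1) (fun x hx => hf.nonneg x hx.1)
      (fun x hx => hf.eq x hx.1) R t ht
    have key := mul_exp_neg_le (D := decayRate nu R0) hm0 hR hB
      (fun h => hm0e ▸ hBm t ht.1 h) hlong ht.1 (by rw [decayRate]; linarith)
      (by rw [decayRate]; linarith)
    refine le_trans ?_ key
    have hD : 0 ≤ decayRate nu R0 := by rw [decayRate]; linarith
    -- Membership is claimed in the set at the final time T, so t < T only weakens the bounds.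
    have e2 : Real.exp (-(decayRate nu R0) * T) ≤ Real.exp (-(decayRate nu R0 * t)) := by
      refine Real.exp_le_exp.2 ?_
      have := mul_le_mul_of_nonneg_left ht.2.le hD
      linarith
    calc _ = Rlow / 2 * Real.exp (-(decayRate nu R0) * T) := by ring
      _ ≤ m0 * Real.exp (-(decayRate nu R0) * T) :=
        mul_le_mul_of_nonneg_right hlow (Real.exp_pos _).le
      _ ≤ _ := mul_le_mul_of_nonneg_left e2 hm0.le

end Bounds

end

end WaveKinetic

/-! ### The main theorem -/

open WaveKinetic

theorem theorem1 (d : ℕ) (hd : 2 ≤ d)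
    (c lam1 lam2 nu N : ℝ) (hlam1 : 0 < lam1) (hlam2 : 0 < lam2) (hnu : 0 < nu) (hN : 0 < N)
    (Rup Rlow : ℝ) (hRlow : 0 < Rlow) (hR : Rlow < Rup)
    (f0 : EuclideanSpace ℝ (Fin d) → ℝ)
    (hf0 : f0 ∈ initialSet d lam1 lam2 N Rup Rlow)
    (hf0_low : Rlow < weightedNorm lam1 lam2 (N + 3) f0)
    (hf0_up : weightedNorm lam1 lam2 (N + 3) f0 < Rup) :
    ∃ f : ℝ → WeightedL1 d lam1 lam2 N,
      (∀ T : ℝ, 0 < T →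
        IsStrongSolution c lam1 lam2 nu N f0 T f ∧
        ∀ g : ℝ → WeightedL1 d lam1 lam2 N,
          IsStrongSolution c lam1 lam2 nu N f0 T g → ∀ t ∈ Set.Ico 0 T, g t = f t) ∧
      (∀ t : ℝ, 0 ≤ t → CollisionConverges c lam1 lam2 (f t)) ∧
      (∀ C0 : ℝ, 0 < C0 →
        ∃ Rmin : ℝ, 0 < Rmin ∧ ∀ R0 : ℝ, Rmin ≤ R0 →
          0 < localMass R0 f0 ∧
          ∀ T : ℝ, 0 < T → ∀ t ∈ Set.Ico 0 T,
            (f t : EuclideanSpace ℝ (Fin d) → ℝ)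
              ∈ invariantSet lam1 lam2 nu N Rup Rlow C0 R0 T f0 T) := by
  obtain ⟨hmem, hnn, -, hmass⟩ := hf0
  have hN3 : 0 ≤ N + 3 := by linarith
  have hint := (integrable_weighted hlam1 hlam2 (N + 3)).1 (memLp_one_iff_integrable.1 hmem)
  -- f0 is only almost everywhere measurable, whereas the existence proof needs a genuinely
  -- measurable datum; its class in L¹_{N+3} provides one.
  set u0 := ofFun hlam1 hlam2 f0 hint
  have hu0 : u0 =ᵐ[volume] f0 := coeFn_ofFun hlam1 hlam2 hint
  have if0 : Integrable f0 :=
    (integrable_coeFn_of_nonneg_weight hlam1 hlam2 hN3 u0).congr hu0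
  obtain ⟨R, hR0, hRpos⟩ := exists_localMass_pos if0 (by linarith)
  obtain ⟨f, f', hf⟩ := exists_isRegularSolution hlam1 hlam2 c (R := R) hN.le hnu
    (measurable_coeFn u0) (integrable_coeFn hlam1 hlam2 u0)
    (by filter_upwards [hu0, hnn] with k e1 e2; rw [e1]; exact e2)
    (by rwa [localMass_congr hu0])
  have hA : momW lam1 lam2 (N + 3) u0 ≤ Rup := by
    rw [momW, absInt_congr hu0]
    refine le_trans (le_of_eq ?_) hf0_up.le
    exact integral_congr_ae (Filter.Eventually.of_forall fun k => mul_comm _ _)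
  have hK : 0 ≤ momentRate c nu (N + 3) := by unfold momentRate; positivity
  -- Only the initial condition mentions the datum, so the solution for the representative is one
  -- for f0. It is global, and a single f serves all T.
  replace hf : IsRegularSolution c lam1 lam2 nu N (momW lam1 lam2 (N + 3) u0)
      (momentRate c nu (N + 3)) f0 f f' := { hf with init := hf.init.trans hu0 }
  refine ⟨f, fun T _ => ⟨hf.isStrongSolution T, fun g hg =>
    hf.eq_of_isStrongSolution hlam1 hlam2 hN.le hnu hK hRpos hg⟩, fun t ht => ?_, fun C0 hC0 =>
    hf.mem_invariantSet hlam1 hlam2 hN.le hnu hK hC0 hR0 hRpos hA hmass⟩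
  obtain ⟨δ, hδ, hm⟩ := hf.mass t
  exact collisionConverges_of_moments hlam1 hlam2 c hN.le
    (Moments.of_le hlam1 hlam2 hN.le (by linarith) (measurable_coeFn _) (hf.int t ht))
    (hδ.trans_le (hm t ⟨ht, le_rfl⟩))
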